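/- Let $K$ be a field of characteristic $0$, $A$ a $\mathbb Z$-graded, graded commutative, associative, unital $K$-algebra, and $L,P$ graded $A$-modules. All signs are Koszul signs with respect to the degree; a $k$-linear map $f$ has degree $\bar f=d$ if $\deg f(\xi_1,\dots,\xi_k)=d+\sum_i\bar\xi_i$. For homogeneous $\xi=(\xi_1,\dots,\xi_m)$ and $S\subset\{1,\dots,m\}$ write $\xi_S$ for the subsequence indexed by $S$, $\bar\xi_S=\sum_{i\in S}\bar\xi_i$, and $\alpha(S,\xi)$ for the Koszul sign of the unshuffle $\xi\mapsto(\xi_S,\xi_{S^c})$. *Forms.* $\mathrm{Sym}_A(L,P)=\bigoplus_{k\ge 0}\mathrm{Sym}^k_A(L,P)$ is the bigraded space of graded symmetric, graded $A$-multilinear maps $L^{k}\to P$ (finite sums of homogeneous ones). $\mathrm{Sym}_A(L,A)$ is a graded commutative algebra acting on it by $(\omega\Omega)(\xi)=\sum_S\alpha(S,\xi)(-1)^{\bar\Omega\,\bar\xi_S}\omega(\xi_S)\Omega(\xi_{S^c})$. *The source.* A multiderivation of $L$ with $k$ entries is a pair $\mathbb X=(X,\sigma)$ where $X:L^k\to L$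 is graded symmetric and $K$-multilinear, $\sigma:L^{k-1}\to\mathrm{Der}\,A$ is graded symmetric and graded $A$-multilinear, and $X(\xi_1,\dots,\xi_{k-1},a\zeta)=\sigma(\xi_1,\dots,\xi_{k-1})(a)\,\zeta+(-1)^{(\bar X+\bar\xi_1+\cdots+\bar\xi_{k-1})\bar a}\,a\,X(\xi_1,\dots,\xi_{k-1},\zeta)$; for $k=0$ it is just an element $X\in L$. $\mathcal L^k(P)$ is the space of pairs $(\mathbb X,\nabla)$, where $\mathbb X$ is a multiderivation with $k$ entries and $\nabla:L^{k-1}\to\mathrm{End}_KP$ (absent if $k=0$) is graded symmetric, graded $A$-multilinear for $(a\varphi)(p)=a\varphi(p)$, of the same degree as $X$, and satisfies $\nabla(\xi)(ap)=\sigma(\xi)(a)\,p+(-1)^{(\bar\nabla+\bar\xi_1+\cdots+\bar\xi_{k-1})\bar a}\,a\,\nabla(\xi)(p)$. Put $\mathcal L(P)=\bigoplus_k\mathcal L^k(P)$, graded by the degree. With $$(f\circ X)(\xi)=\sum_S\alpha(S,\xi)\,f(X(\xi_S),\xi_{S^c}),\qquad [\nabla,\nabla'](\xi)=\sum_S\alpha(S,\xi)(-1)^{\bar\nabla'\bar\xi_S}[\nabla(\xi_S),\nabla'(\xi_{S^c})],$$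 its bracket is $[(X,\sigma,\nabla),(X',\sigma',\nabla')]=(X'',\sigma'',\nabla'')$, where $X''=X\circ X'-(-1)^{\bar X\bar X'}X'\circ X$, $\ \sigma''=\sigma\circ X'-(-1)^{\bar X\bar X'}\sigma'\circ X+[\sigma,\sigma']$, $\ \nabla''=\nabla\circ X'-(-1)^{\bar X\bar X'}\nabla'\circ X+[\nabla,\nabla']$. *The target.* A $\mathrm{Sym}_A(L,A)$-module derivation of $\mathrm{Sym}_A(L,P)$ of degree $d$ is a pair $(D,\tau)$ of $K$-linear operators of degree $d$, $\tau$ (the symbol) a graded derivation of the algebra $\mathrm{Sym}_A(L,A)$ and $D(\omega\Omega)=\tau(\omega)\Omega+(-1)^{d\bar\omega}\omega D(\Omega)$. Let $\mathfrak D$ be the bigraded space spanned by those which are also homogeneous in the number of entries, i.e. for which there is $s\in\mathbb Z$ such that $D$ and $\tau$ take $\ell$-forms to $(\ell+s)$-forms for all $\ell$ (zero if $\ell+s<0$); its bracket is the graded commutator. **Proposition.** With these brackets $\mathcal L(P)$ and $\mathfrak D$ are graded Lie algebras (graded by the degree), and there is a morphism of graded Lie algebras $\eta^L:\mathcal L(P)\to\mathfrak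 D$, given on $P$-valued forms by $\eta^L(\mathbb X,\nabla)(\Omega)=\nabla\circ\Omega-(-1)^{\bar X\bar\Omega}\,\Omega\circ X$, where $(\nabla\circ\Omega)(\xi)=\sum_S\alpha(S,\xi)(-1)^{\bar\Omega\bar\xi_S}\nabla(\xi_S)(\Omega(\xi_{S^c}))$. The symbol of $\eta^L(\mathbb X,\nabla)$ is $\eta(\mathbb X)$, where $\eta(\mathbb X)(\omega)=\sigma\circ\omega-(-1)^{\bar X\bar\omega}\,\omega\circ X$, and for $(\mathbb X,\nabla)\in\mathcal L^k(P)$ the operator $\eta^L(\mathbb X,\nabla)$ takes $\ell$-forms to $(\ell+k-1)$-forms. If $L$ is projective and finitely generated over $A$, then $\eta^L$ is an isomorphism. -/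

import Mathlib

open scoped DirectSum

namespace GradedLR

/-! Throughout, gradings are over `ℤ`, a graded vector space is a vector space with a family of
subspaces `ℤ → Submodule K V`, and all signs are Koszul signs `(-1) ^ m`, `m : ℤ`, in `K`. -/

noncomputable section

set_option linter.unusedSectionVars false

/-- Graded commutativity `a b = (-1)^{|a||b|} b a`. -/
class GradedCommutative {K A : Type*} [Field K] [Ring A] [Algebra K A]
    (𝒜 : ℤ → Submodule K A) : Prop where
  comm : ∀ (r s : ℤ) (a b : A), a ∈ 𝒜 r → b ∈ 𝒜 s → a * b = (-1 : K) ^ (r * s) • (b * a)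

/-- Families `(f_k)` of `K`-multilinear maps `f_k : L^k → Q`, one for each number `k` of
entries. -/
abbrev Cochain (K L Q : Type*) [Field K] [AddCommGroup L] [Module K L]
    [AddCommGroup Q] [Module K Q] : Type _ :=
  (k : ℕ) → MultilinearMap K (fun _ : Fin k => L) Q

section Multilinear

variable {K L M N Q : Type*} [Field K] [AddCommGroup L] [Module K L] [AddCommGroup M] [Module K M]
  [AddCommGroup N] [Module K N] [AddCommGroup Q] [Module K Q]

/-- The multilinear map which agrees with `F n` on tuples of homogeneous elements of degrees
`n 0, n 1, …`. -/
def ofHomogeneous (ℒ : ℤ → Submodule K L) [DirectSum.Decomposition ℒ] {m : ℕ}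
    (F : (Fin m → ℤ) → MultilinearMap K (fun _ : Fin m => L) Q) :
    MultilinearMap K (fun _ : Fin m => L) Q :=
  (MultilinearMap.fromDFinsuppEquiv (fun _ : Fin m => ℤ) K
    (M := fun (_ : Fin m) (j : ℤ) => ℒ j)
    (fun n => (F n).compLinearMap (fun i => (ℒ (n i)).subtype))).compLinearMap
    (fun _ => (DirectSum.decomposeLinearEquiv ℒ).toLinearMap)

theorem ofHomogeneous_apply (ℒ : ℤ → Submodule K L) [DirectSum.Decomposition ℒ] {m : ℕ}
    (F : (Fin m → ℤ) → MultilinearMap K (fun _ : Fin m => L) Q)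
    (n : Fin m → ℤ) (ξ : Fin m → L) (h : ∀ i, ξ i ∈ ℒ (n i)) :
    ofHomogeneous ℒ F ξ = F n ξ := by
  have e : (fun i => DirectSum.decomposeLinearEquiv ℒ (ξ i)) =
      fun i => DFinsupp.single (β := fun j => ℒ j) (n i) (⟨ξ i, h i⟩ : ℒ (n i)) := by
    funext i
    exact DirectSum.decompose_of_mem ℒ (h i)
  have := MultilinearMap.fromDFinsuppEquiv_single (R := K) (κ := fun _ : Fin m => ℤ)
    (M := fun (_ : Fin m) (j : ℤ) => ℒ j)
    (fun n => (F n).compLinearMap (fun i => (ℒ (n i)).subtype)) n (fun i => ⟨ξ i, h i⟩)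
  rw [← e] at this
  simpa [ofHomogeneous] using this

theorem ext_homogeneous (ℒ : ℤ → Submodule K L) [DirectSum.Decomposition ℒ] {m : ℕ}
    {f g : MultilinearMap K (fun _ : Fin m => L) Q}
    (h : ∀ (n : Fin m → ℤ) (ξ : Fin m → L), (∀ i, ξ i ∈ ℒ (n i)) → f ξ = g ξ) : f = g := by
  let dec := DirectSum.decomposeLinearEquiv ℒ
  have key : f.compLinearMap (fun _ => dec.symm.toLinearMap) =
      g.compLinearMap (fun _ => dec.symm.toLinearMap) := by
    refine (MultilinearMap.fromDFinsuppEquiv (fun _ : Fin m => ℤ) K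
      (M := fun (_ : Fin m) (j : ℤ) => ℒ j) (N := Q)).symm.injective ?_
    funext n
    ext x
    change f (fun i => dec.symm (DFinsupp.single (n i) (x i))) =
      g (fun i => dec.symm (DFinsupp.single (n i) (x i)))
    refine h n _ fun i => ?_
    have : dec.symm (DFinsupp.single (n i) (x i)) = x i := by
      rw [LinearEquiv.symm_apply_eq]
      exact (DirectSum.decompose_coe ℒ (x i)).symm
    rw [this]
    exact (x i).2
  ext ξ
  have := congrArg (fun φ => φ (fun i => dec (ξ i))) key
  simpa using this

/-- The subsequence of `ξ` indexed by the elements of `S`, in increasing order. -/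
def sub {α : Type*} {m : ℕ} (S : Finset (Fin m)) (ξ : Fin m → α) : Fin S.card → α :=
  fun i => ξ (S.orderEmbOfFin rfl i)

/-- The `m`-linear map `ξ ↦ g (ξ_S) (ξ_{Sᶜ})`. -/
def merge {m : ℕ} (S : Finset (Fin m))
    (g : MultilinearMap K (fun _ : Fin S.card => L)
      (MultilinearMap K (fun _ : Fin Sᶜ.card => L) Q)) :
    MultilinearMap K (fun _ : Fin m => L) Q :=
  (MultilinearMap.curryFinFinset K Q L rfl rfl).symm g

theorem merge_apply {m : ℕ} (S : Finset (Fin m))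
    (g : MultilinearMap K (fun _ : Fin S.card => L)
      (MultilinearMap K (fun _ : Fin Sᶜ.card => L) Q)) (ξ : Fin m → L) :
    merge S g ξ = g (sub S ξ) (sub Sᶜ ξ) := rfl

/-- The Koszul sign `α(σ, ξ)` of the unshuffle `σ` that lists first the elements of `S` and then
those of `Sᶜ`, each in increasing order, for homogeneous `ξ` of degrees `n`: the product of
`(-1)^{n_i n_j}` over the pairs `j < i` with `i ∈ S` and `j ∉ S`. Unshuffles in `S_{p,m-p}`
correspond in this way to the subsets `S` of `{1, …, m}` with `p` elements. -/
def unshuffleSign (K : Type*) [Field K] {m : ℕ} (n : Fin m → ℤ) (S : Finset (Fin m)) : K :=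
  ∏ i ∈ S, ∏ j ∈ Sᶜ with j < i, (-1 : K) ^ (n i * n j)

/-- Precomposition of linear maps with a fixed multilinear map `g`. -/
def precomp {m : ℕ} (g : MultilinearMap K (fun _ : Fin m => L) N) :
    (N →ₗ[K] Q) →ₗ[K] MultilinearMap K (fun _ : Fin m => L) Q where
  toFun φ := φ.compMultilinearMap g
  map_add' _ _ := rfl
  map_smul' _ _ := rfl

/-- The product of two families of multilinear maps along bilinear maps `B`:
`(f · g)(ξ) = ∑_σ α(σ, ξ) (-1)^{e |ξ_S|} B(f(ξ_S), g(ξ_{Sᶜ}))`, summed over unshuffles, where `e`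
is the degree of `g`. The bilinear map may depend on the total degrees of `ξ_S` and `ξ_{Sᶜ}`. -/
def cup (ℒ : ℤ → Submodule K L) [DirectSum.Decomposition ℒ] (B : ℤ → ℤ → M →ₗ[K] N →ₗ[K] Q)
    (e : ℤ) (f : Cochain K L M) (g : Cochain K L N) : Cochain K L Q := fun _ =>
  ofHomogeneous ℒ fun n => ∑ S, (unshuffleSign K n S * (-1 : K) ^ (e * ∑ i ∈ S, n i)) •
    merge S ((precomp (g Sᶜ.card) ∘ₗ B (∑ i ∈ S, n i) (∑ i ∈ Sᶜ, n i)).compMultilinearMap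
      (f S.card))

theorem cup_apply (ℒ : ℤ → Submodule K L) [DirectSum.Decomposition ℒ]
    (B : ℤ → ℤ → M →ₗ[K] N →ₗ[K] Q) (e : ℤ) (f : Cochain K L M) (g : Cochain K L N) {m : ℕ}
    (n : Fin m → ℤ) (ξ : Fin m → L) (h : ∀ i, ξ i ∈ ℒ (n i)) :
    cup ℒ B e f g m ξ = ∑ S, (unshuffleSign K n S * (-1 : K) ^ (e * ∑ i ∈ S, n i)) •
      B (∑ i ∈ S, n i) (∑ i ∈ Sᶜ, n i) (f S.card (sub S ξ)) (g Sᶜ.card (sub Sᶜ ξ)) := by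
  rw [cup, ofHomogeneous_apply ℒ _ n ξ h, sum_apply]
  rfl

/-- The Gerstenhaber-type composition
`(f ∘ X)(ξ) = ∑_σ α(σ, ξ) f(X(ξ_S), ξ_{Sᶜ})`, summed over unshuffles. -/
def gerst (ℒ : ℤ → Submodule K L) [DirectSum.Decomposition ℒ]
    (f : Cochain K L Q) (X : Cochain K L L) : Cochain K L Q := fun _ =>
  ofHomogeneous ℒ fun n => ∑ S, unshuffleSign K n S •
    merge S ((f (Sᶜ.card + 1)).curryLeft.compMultilinearMap (X S.card))

theorem gerst_apply (ℒ : ℤ → Submodule K L) [DirectSum.Decomposition ℒ]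
    (f : Cochain K L Q) (X : Cochain K L L) {m : ℕ}
    (n : Fin m → ℤ) (ξ : Fin m → L) (h : ∀ i, ξ i ∈ ℒ (n i)) :
    gerst ℒ f X m ξ = ∑ S, unshuffleSign K n S •
      f (Sᶜ.card + 1) (Fin.cons (X S.card (sub S ξ)) (sub Sᶜ ξ)) := by
  rw [gerst, ofHomogeneous_apply ℒ _ n ξ h, sum_apply]
  rfl

/-- Families with finitely many nonzero members. -/
def finiteCochains (K L Q : Type*) [Field K] [AddCommGroup L] [Module K L]
    [AddCommGroup Q] [Module K Q] : Submodule K (Cochain K L Q) where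
  carrier := {f | ∃ N : ℕ, ∀ k, N ≤ k → f k = 0}
  zero_mem' := ⟨0, fun _ _ => rfl⟩
  add_mem' := by
    rintro f g ⟨N, hN⟩ ⟨M, hM⟩
    refine ⟨max N M, fun k hk => ?_⟩
    simp [hN k (le_of_max_le_left hk), hM k (le_of_max_le_right hk)]
  smul_mem' := by
    rintro c f ⟨N, hN⟩
    exact ⟨N, fun k hk => by simp [hN k hk]⟩

/-- Families whose only possibly nonzero member is the one with `k` entries (so they are zero
if `k < 0`). -/
def weight (K L Q : Type*) [Field K] [AddCommGroup L] [Module K L]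
    [AddCommGroup Q] [Module K Q] (k : ℤ) : Submodule K (Cochain K L Q) where
  carrier := {f | ∀ j : ℕ, (j : ℤ) ≠ k → f j = 0}
  zero_mem' := fun _ _ => rfl
  add_mem' := fun {f g} hf hg j hj => by simp [hf j hj, hg j hj]
  smul_mem' := fun c f hf j hj => by simp [hf j hj]

/-- Multilinear maps of degree `d`. -/
def degreeMaps (ℒ : ℤ → Submodule K L) (𝒬 : ℤ → Submodule K Q) (d : ℤ) (k : ℕ) :
    Submodule K (MultilinearMap K (fun _ : Fin k => L) Q) where
  carrier := {f | ∀ (n : Fin k → ℤ) (ξ : Fin k → L), (∀ i, ξ i ∈ ℒ (n i)) →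
    f ξ ∈ 𝒬 (d + ∑ i, n i)}
  zero_mem' := fun _ _ _ => Submodule.zero_mem _
  add_mem' := fun hf hg n ξ h => Submodule.add_mem _ (hf n ξ h) (hg n ξ h)
  smul_mem' := fun c _ hf n ξ h => Submodule.smul_mem _ c (hf n ξ h)

/-- Graded symmetric multilinear maps: interchanging two neighbouring homogeneous arguments of
degrees `p` and `q` multiplies the value by `(-1)^{p q}`. -/
def gradedSymmetric (ℒ : ℤ → Submodule K L) (k : ℕ) :
    Submodule K (MultilinearMap K (fun _ : Fin k => L) Q) where
  carrier := {f | ∀ (n : Fin k → ℤ) (ξ : Fin k → L), (∀ i, ξ i ∈ ℒ (n i)) →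
    ∀ i j : Fin k, (j : ℕ) = i + 1 → f (ξ ∘ Equiv.swap i j) = (-1 : K) ^ (n i * n j) • f ξ}
  zero_mem' := fun _ _ _ _ _ _ => by simp
  add_mem' := fun {f g} hf hg n ξ h i j hij => by
    simp only [add_apply, hf n ξ h i j hij, hg n ξ h i j hij, smul_add]
  smul_mem' := fun c f hf n ξ h i j hij => by
    simp only [smul_apply, hf n ξ h i j hij, smul_comm c]

variable {A : Type*} [Ring A] [Algebra K A] [Module A L] [Module A Q] [IsScalarTower K A Q]

/-- Graded `A`-multilinearity of a multilinear map of degree `d`: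
`f(…, a ξ_i, …) = (-1)^{|a| (d + |ξ_1| + ⋯ + |ξ_{i-1}|)} a f(…, ξ_i, …)`. -/
def gradedLinear (𝒜 : ℤ → Submodule K A) (ℒ : ℤ → Submodule K L) (d : ℤ) (k : ℕ) :
    Submodule K (MultilinearMap K (fun _ : Fin k => L) Q) where
  carrier := {f | ∀ (n : Fin k → ℤ) (ξ : Fin k → L), (∀ i, ξ i ∈ ℒ (n i)) →
    ∀ (r : ℤ) (a : A), a ∈ 𝒜 r → ∀ i : Fin k,
      f (Function.update ξ i (a • ξ i)) =
        (-1 : K) ^ (r * (d + ∑ j with j < i, n j)) • a • f ξ}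
  zero_mem' := fun _ _ _ _ _ _ _ => by simp
  add_mem' := fun {f g} hf hg n ξ h r a ha i => by
    simp only [add_apply, hf n ξ h r a ha i, hg n ξ h r a ha i, smul_add]
  smul_mem' := fun c f hf n ξ h r a ha i => by
    simp only [smul_apply, hf n ξ h r a ha i, smul_comm c]

end Multilinear

/-! ### Symmetry of products -/

section Symmetry

variable {K : Type*} [Field K]

theorem unshuffleSign_eq {m : ℕ} (n : Fin m → ℤ) (S : Finset (Fin m)) :
    unshuffleSign K n S =
      ∏ p : Fin m × Fin m, if p.1 ∈ S ∧ p.2 ∉ S ∧ p.2 < p.1 then (-1 : K) ^ (n p.1 * n p.2) else 1 := by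
  rw [unshuffleSign, Fintype.prod_prod_type, ← Finset.prod_subset (Finset.subset_univ S)]
  · refine Finset.prod_congr rfl fun i hi => ?_
    rw [Finset.prod_filter, ← Finset.prod_subset (Finset.subset_univ Sᶜ)]
    · refine Finset.prod_congr rfl fun j hj => ?_
      simp only [Finset.mem_compl] at hj
      simp [hi, hj]
    · intro j _ hj
      simp only [Finset.mem_compl, not_not] at hj
      simp [hj]
  · intro i _ hi
    simp [hi]

theorem neg_one_zpow_mul_self (x : ℤ) : (-1 : K) ^ x * (-1 : K) ^ x = 1 := by
  rw [← mul_zpow]; simp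

theorem neg_one_zpow_congr {x y : ℤ} (h : Even (x - y)) : (-1 : K) ^ x = (-1 : K) ^ y := by
  obtain ⟨z, hz⟩ := h
  have : x = y + (z + z) := by omega
  rw [this, zpow_add₀ (by simp), zpow_add₀ (by simp), neg_one_zpow_mul_self, mul_one]

theorem unshuffleSign_swap {m : ℕ} (n : Fin m → ℤ) (S : Finset (Fin m)) (i j : Fin m)
    (hij : (j : ℕ) = i + 1) :
    unshuffleSign K (n ∘ Equiv.swap i j) S =
      (if (i ∈ S ↔ j ∈ S) then 1 else (-1 : K) ^ (n i * n j)) *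
        unshuffleSign K n (S.map (Equiv.swap i j).toEmbedding) := by
  have hne : i ≠ j := by rintro rfl; omega
  rw [unshuffleSign_eq, unshuffleSign_eq,
    ← Equiv.prod_comp ((Equiv.swap i j).prodCongr (Equiv.swap i j))
      (fun p : Fin m × Fin m => if p.1 ∈ S.map (Equiv.swap i j).toEmbedding ∧
        p.2 ∉ S.map (Equiv.swap i j).toEmbedding ∧ p.2 < p.1 then
        (-1 : K) ^ (n p.1 * n p.2) else 1)]
  have hw : (if (i ∈ S ↔ j ∈ S) then 1 else (-1 : K) ^ (n i * n j)) =
      ∏ p : Fin m × Fin m, if p.1 ∈ S ∧ p.2 ∉ S ∧ (p = (i, j) ∨ p = (j, i)) then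
        (-1 : K) ^ (n i * n j) else 1 := by
    by_cases hi : i ∈ S <;> by_cases hj : j ∈ S
    · rw [if_pos (by tauto), Finset.prod_eq_one]
      rintro ⟨a, b⟩ _
      rw [if_neg]
      rintro ⟨h1, h2, h3⟩
      simp only [Prod.mk.injEq] at h3
      rcases h3 with ⟨rfl, rfl⟩ | ⟨rfl, rfl⟩ <;> tauto
    · rw [if_neg (by tauto), Finset.prod_eq_single (i, j)]
      · simp [hi, hj]
      · rintro ⟨a, b⟩ _ hab
        rw [if_neg]
        rintro ⟨h1, h2, h3 | h3⟩
        · exact hab h3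
        · simp only [Prod.mk.injEq] at h3
          rcases h3 with ⟨rfl, rfl⟩; exact hj h1
      · simp
    · rw [if_neg (by tauto), Finset.prod_eq_single (j, i)]
      · simp [hi, hj]
      · rintro ⟨a, b⟩ _ hab
        rw [if_neg]
        rintro ⟨h1, h2, h3 | h3⟩
        · simp only [Prod.mk.injEq] at h3
          rcases h3 with ⟨rfl, rfl⟩; exact hi h1
        · exact hab h3
      · simp
    · rw [if_pos (by tauto), Finset.prod_eq_one]
      rintro ⟨a, b⟩ _
      rw [if_neg]
      rintro ⟨h1, h2, h3⟩
      simp only [Prod.mk.injEq] at h3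
      rcases h3 with ⟨rfl, rfl⟩ | ⟨rfl, rfl⟩ <;> tauto
  rw [hw, ← Finset.prod_mul_distrib]
  refine Finset.prod_congr rfl ?_
  rintro ⟨a, b⟩ _
  simp only [Equiv.prodCongr_apply, Prod.map_apply, Finset.mem_map_equiv, Equiv.symm_swap,
    Equiv.swap_apply_self, Function.comp_apply, Prod.mk.injEq]
  by_cases ha : a ∈ S
  swap
  · simp [ha]
  by_cases hb : b ∈ S
  · simp [hb]
  have hab : a ≠ b := by rintro rfl; exact hb ha
  simp only [ha, hb, not_false_eq_true, true_and]
  by_cases h1 : a = i ∧ b = j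
  · obtain ⟨rfl, rfl⟩ := h1
    have hlt : a < b := by rw [Fin.lt_def]; omega
    have hlt' : ¬ b < a := not_lt.2 hlt.le
    simp [hlt, hlt', mul_comm (n b), neg_one_zpow_mul_self]
  by_cases h2 : a = j ∧ b = i
  · obtain ⟨rfl, rfl⟩ := h2
    have hlt : b < a := by rw [Fin.lt_def]; omega
    have hlt' : ¬ a < b := not_lt.2 hlt.le
    simp [hlt, hlt']
  rw [if_neg (by tauto : ¬ ((a = i ∧ b = j) ∨ (a = j ∧ b = i))), one_mul]
  have key : b < a ↔ Equiv.swap i j b < Equiv.swap i j a := by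
    simp only [Equiv.swap_apply_def]
    split_ifs <;> simp only [Fin.lt_def, Fin.ext_iff] at * <;> omega
  simp only [key]

variable {L Q : Type*} [AddCommGroup L] [Module K L] [AddCommGroup Q] [Module K Q]

theorem apply_sub {f : Cochain K L Q} {m k : ℕ} (S : Finset (Fin m)) (hk : S.card = k)
    (ξ : Fin m → L) : f S.card (sub S ξ) = f k (fun i => ξ (S.orderEmbOfFin hk i)) := by
  subst hk; rfl

theorem mem_sub {ℒ : ℤ → Submodule K L} {m : ℕ} (S : Finset (Fin m)) {n : Fin m → ℤ}
    {ξ : Fin m → L} (h : ∀ i, ξ i ∈ ℒ (n i)) (i : Fin S.card) : sub S ξ i ∈ ℒ (sub S n i) :=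
  h _

theorem sum_sub {m : ℕ} (S : Finset (Fin m)) (n : Fin m → ℤ) :
    ∑ i, sub S n i = ∑ i ∈ S, n i := by
  rw [← Finset.sum_coe_sort S n, ← Equiv.sum_comp (S.orderIsoOfFin rfl).toEquiv]
  rfl

theorem apply_sub_swap {ℒ : ℤ → Submodule K L} {f : Cochain K L Q}
    (hf : ∀ k, f k ∈ gradedSymmetric ℒ k) {m : ℕ} (S : Finset (Fin m)) (n : Fin m → ℤ)
    (ξ : Fin m → L) (h : ∀ i, ξ i ∈ ℒ (n i)) (i j : Fin m) (hij : (j : ℕ) = i + 1) :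
    f S.card (sub S (ξ ∘ Equiv.swap i j)) =
      (if i ∈ S ∧ j ∈ S then (-1 : K) ^ (n i * n j) else 1) •
        f (S.map (Equiv.swap i j).toEmbedding).card
          (sub (S.map (Equiv.swap i j).toEmbedding) ξ) := by
  have hne : i ≠ j := by rintro rfl; omega
  rw [apply_sub (S.map (Equiv.swap i j).toEmbedding) (Finset.card_map _)]
  by_cases hi : i ∈ S ∧ j ∈ S
  · rw [if_pos hi]
    have hS : S.map (Equiv.swap i j).toEmbedding = S := by
      ext a
      rw [Finset.mem_map_equiv, Equiv.symm_swap, Equiv.swap_apply_def]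
      split_ifs with h1 h2
      · subst h1; tauto
      · subst h2; tauto
      · rfl
    obtain ⟨a, ha⟩ : ∃ a, S.orderEmbOfFin rfl a = i := by
      have : i ∈ Set.range (S.orderEmbOfFin rfl) := by simpa using hi.1
      exact this
    obtain ⟨b, hb⟩ : ∃ b, S.orderEmbOfFin rfl b = j := by
      have : j ∈ Set.range (S.orderEmbOfFin rfl) := by simpa using hi.2
      exact this
    have hab : (b : ℕ) = a + 1 := by
      have hlt : a < b := by
        rw [← (S.orderEmbOfFin rfl).lt_iff_lt, ha, hb, Fin.lt_def]; omega
      by_contra hcon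
      have hlt2 : (a : ℕ) + 1 < b := by rw [Fin.lt_def] at hlt; omega
      let c : Fin S.card := ⟨a + 1, by omega⟩
      have h1 : S.orderEmbOfFin rfl a < S.orderEmbOfFin rfl c :=
        (S.orderEmbOfFin rfl).lt_iff_lt.2 (by simp [Fin.lt_def, c])
      have h2 : S.orderEmbOfFin rfl c < S.orderEmbOfFin rfl b :=
        (S.orderEmbOfFin rfl).lt_iff_lt.2 (by simp [Fin.lt_def, c, hlt2])
      rw [ha, Fin.lt_def] at h1
      rw [hb, Fin.lt_def] at h2
      omega
    have e1 : sub S (ξ ∘ Equiv.swap i j) = sub S ξ ∘ Equiv.swap a b := by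
      funext c
      simp only [sub, Function.comp_apply]
      congr 1
      rw [← ha, ← hb]
      exact (S.orderEmbOfFin rfl).injective.swap_apply a b c
    have e2 : ∀ c, (S.map (Equiv.swap i j).toEmbedding).orderEmbOfFin (Finset.card_map _) c =
        S.orderEmbOfFin rfl c := by
      intro c
      have := Finset.orderEmbOfFin_unique' (s := S) (k := S.card) rfl
        (f := (S.map (Equiv.swap i j).toEmbedding).orderEmbOfFin (Finset.card_map _))
        (fun x => by
          have := Finset.orderEmbOfFin_mem (S.map (Equiv.swap i j).toEmbedding)
            (Finset.card_map _) x
          exact (Finset.ext_iff.1 hS _).1 this)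
      rw [this]
    simp only [e2]
    rw [e1, hf _ (sub S n) (sub S ξ) (mem_sub S h) a b hab]
    simp only [sub, ha, hb]
    rfl
  · rw [if_neg hi, one_smul]
    congr 1
    funext c
    simp only [sub, Function.comp_apply]
    congr 1
    have := Finset.orderEmbOfFin_unique (s := S.map (Equiv.swap i j).toEmbedding)
      (Finset.card_map _) (f := fun c => Equiv.swap i j (S.orderEmbOfFin rfl c))
      (fun x => Finset.mem_map_of_mem _ (Finset.orderEmbOfFin_mem S rfl x))
      (by
        intro a b hab
        beta_reduce
        have h1 := (S.orderEmbOfFin rfl).lt_iff_lt.2 hab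
        have h2 := Finset.orderEmbOfFin_mem S rfl a
        have h3 := Finset.orderEmbOfFin_mem S rfl b
        generalize S.orderEmbOfFin rfl a = x at *
        generalize S.orderEmbOfFin rfl b = y at *
        have h4 : ¬ (x = i ∧ y = j) := by rintro ⟨rfl, rfl⟩; exact hi ⟨h2, h3⟩
        simp only [Equiv.swap_apply_def]
        clear hf h hi
        split_ifs <;> simp only [Fin.lt_def, Fin.ext_iff] at * <;> omega)
    exact congrFun this c

variable {M N : Type*} [AddCommGroup M] [Module K M] [AddCommGroup N] [Module K N]

theorem cup_gradedSymmetric (ℒ : ℤ → Submodule K L) [DirectSum.Decomposition ℒ]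
    (B : ℤ → ℤ → M →ₗ[K] N →ₗ[K] Q) (e : ℤ) (f : Cochain K L M) (g : Cochain K L N)
    (hf : ∀ k, f k ∈ gradedSymmetric ℒ k) (hg : ∀ k, g k ∈ gradedSymmetric ℒ k) (m : ℕ) :
    cup ℒ B e f g m ∈ gradedSymmetric ℒ m := by
  intro n ξ h i j hij
  have hne : i ≠ j := by rintro rfl; omega
  rw [cup_apply ℒ B e f g (n ∘ Equiv.swap i j) (ξ ∘ Equiv.swap i j) (fun a => h _), cup_apply ℒ B e f g n ξ h,
    Finset.smul_sum]
  refine Finset.sum_equiv (Equiv.finsetCongr (Equiv.swap i j)) (by simp) fun S _ => ?_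
  rw [Equiv.finsetCongr_apply]
  have hc : (S.map (Equiv.swap i j).toEmbedding)ᶜ = Sᶜ.map (Equiv.swap i j).toEmbedding := by
    ext a; simp [Finset.mem_map_equiv]
  have hs : ∀ T : Finset (Fin m), ∑ a ∈ T, (n ∘ Equiv.swap i j) a =
      ∑ a ∈ T.map (Equiv.swap i j).toEmbedding, n a := fun T => by simp
  rw [hc, hs, hs, apply_sub_swap hf S n ξ h i j hij, apply_sub_swap hg Sᶜ n ξ h i j hij,
    unshuffleSign_swap n S i j hij]
  simp only [map_smul, LinearMap.smul_apply, smul_smul]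
  congr 1
  simp only [Finset.mem_compl]
  by_cases hi : i ∈ S <;> by_cases hj : j ∈ S <;> simp [hi, hj] <;> ring

theorem cup_finite (ℒ : ℤ → Submodule K L) [DirectSum.Decomposition ℒ]
    (B : ℤ → ℤ → M →ₗ[K] N →ₗ[K] Q) (e : ℤ) (f : Cochain K L M) (g : Cochain K L N)
    (hf : f ∈ finiteCochains K L M) (hg : g ∈ finiteCochains K L N) :
    cup ℒ B e f g ∈ finiteCochains K L Q := by
  obtain ⟨k, hk⟩ := hf
  obtain ⟨l, hl⟩ := hg
  refine ⟨k + l, fun m hm => ?_⟩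
  have h0 : ofHomogeneous ℒ (fun _ => (0 : MultilinearMap K (fun _ : Fin m => L) Q)) = 0 := by
    have e0 : (fun n : Fin m → ℤ => (0 : MultilinearMap K (fun _ : Fin m => L) Q).compLinearMap
        (fun i => (ℒ (n i)).subtype)) = 0 := rfl
    rw [ofHomogeneous, e0, map_zero]
    rfl
  rw [← h0, cup]
  congr 1
  funext n
  refine Finset.sum_eq_zero fun S _ => ?_
  ext ξ
  rw [smul_apply, merge_apply]
  change _ • B _ _ (f S.card (sub S ξ)) (g Sᶜ.card (sub Sᶜ ξ)) = 0
  have hc := Finset.card_add_card_compl S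
  rw [Fintype.card_fin] at hc
  by_cases h : k ≤ S.card
  · simp [hk _ h]
  · simp [hl Sᶜ.card (by omega)]

theorem prod_neg_one_zpow {ι : Type*} (s : Finset ι) (x : ι → ℤ) :
    ∏ i ∈ s, (-1 : K) ^ x i = (-1 : K) ^ ∑ i ∈ s, x i := by
  classical
  induction s using Finset.induction_on with
  | empty => simp
  | insert a s ha ih => rw [Finset.prod_insert ha, Finset.sum_insert ha, ih, zpow_add₀ (by simp)]

theorem unshuffleSign_update_mem {m : ℕ} (n : Fin m → ℤ) (S : Finset (Fin m)) (i : Fin m)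
    (hi : i ∈ S) (r : ℤ) :
    unshuffleSign K (Function.update n i (n i + r)) S =
      unshuffleSign K n S * (-1 : K) ^ (r * ∑ j ∈ Sᶜ with j < i, n j) := by
  have h1 : (-1 : K) ^ (r * ∑ j ∈ Sᶜ with j < i, n j) =
      ∏ a ∈ S, if a = i then (-1 : K) ^ (r * ∑ j ∈ Sᶜ with j < a, n j) else 1 := by
    rw [Finset.prod_ite_eq' S i, if_pos hi]
  rw [h1, unshuffleSign, unshuffleSign, ← Finset.prod_mul_distrib]
  refine Finset.prod_congr rfl fun a ha => ?_
  by_cases hai : a = i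
  · subst hai
    rw [if_pos rfl, Finset.mul_sum, ← prod_neg_one_zpow, ← Finset.prod_mul_distrib]
    refine Finset.prod_congr rfl fun b hb => ?_
    have hb' : b ≠ a := by
      rintro rfl
      simp at hb
    rw [Function.update_self, Function.update_of_ne hb', ← zpow_add₀ (by simp)]
    congr 1
    ring
  · rw [if_neg hai, mul_one]
    refine Finset.prod_congr rfl fun b hb => ?_
    have hb' : b ≠ i := by
      rintro rfl
      simp only [Finset.mem_filter, Finset.mem_compl] at hb
      exact hb.1 hi
    rw [Function.update_of_ne hai, Function.update_of_ne hb']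

theorem unshuffleSign_update_notMem {m : ℕ} (n : Fin m → ℤ) (S : Finset (Fin m)) (i : Fin m)
    (hi : i ∉ S) (r : ℤ) :
    unshuffleSign K (Function.update n i (n i + r)) S =
      unshuffleSign K n S * (-1 : K) ^ (r * ∑ j ∈ S with i < j, n j) := by
  rw [unshuffleSign, unshuffleSign, Finset.mul_sum, ← prod_neg_one_zpow, Finset.prod_filter,
    ← Finset.prod_mul_distrib]
  refine Finset.prod_congr rfl fun a ha => ?_
  have hai : a ≠ i := by rintro rfl; exact hi ha
  have h1 : (if i < a then (-1 : K) ^ (r * n a) else 1) =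
      ∏ b ∈ Sᶜ with b < a, if b = i then (-1 : K) ^ (r * n a) else 1 := by
    rw [Finset.prod_ite_eq']
    simp [hi]
  rw [h1, ← Finset.prod_mul_distrib]
  refine Finset.prod_congr rfl fun b hb => ?_
  rw [Function.update_of_ne hai]
  by_cases hbi : b = i
  · subst hbi
    rw [Function.update_self, if_pos rfl, ← zpow_add₀ (by simp)]
    congr 1
    ring
  · rw [Function.update_of_ne hbi, if_neg hbi, mul_one]

theorem sub_update_notMem {α : Type*} {m : ℕ} (S : Finset (Fin m)) (ξ : Fin m → α) (i : Fin m)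
    (hi : i ∉ S) (x : α) : sub S (Function.update ξ i x) = sub S ξ := by
  funext a
  simp only [sub]
  rw [Function.update_of_ne]
  intro h
  exact hi (h ▸ Finset.orderEmbOfFin_mem S rfl a)

theorem sub_update_mem {α : Type*} {m : ℕ} (S : Finset (Fin m)) (ξ : Fin m → α) (i : Fin m)
    (a : Fin S.card) (ha : S.orderEmbOfFin rfl a = i) (x : α) :
    sub S (Function.update ξ i x) = Function.update (sub S ξ) a x := by
  subst ha
  funext b
  by_cases hb : b = a
  · subst hb; simp [sub]
  · rw [Function.update_of_ne hb]
    simp only [sub]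
    rw [Function.update_of_ne]
    exact fun h => hb ((S.orderEmbOfFin rfl).injective h)

theorem sum_sub_lt {m : ℕ} (S : Finset (Fin m)) (n : Fin m → ℤ) (i : Fin m)
    (a : Fin S.card) (ha : S.orderEmbOfFin rfl a = i) :
    ∑ b with b < a, sub S n b = ∑ j ∈ S with j < i, n j := by
  subst ha
  rw [Finset.sum_filter, Finset.sum_filter,
    ← sum_sub S (fun j => if j < S.orderEmbOfFin rfl a then n j else 0)]
  simp [sub]

variable {A : Type*} [Ring A] [Algebra K A] (𝒜 : ℤ → Submodule K A)
  [Module A L]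
  [Module A Q] [IsScalarTower K A Q]

theorem apply_sub_smul {ℒ : ℤ → Submodule K L} {e : ℤ} {f : Cochain K L Q}
    (hf : ∀ k, f k ∈ gradedLinear 𝒜 ℒ e k) {m : ℕ} (S : Finset (Fin m)) (n : Fin m → ℤ)
    (ξ : Fin m → L) (h : ∀ i, ξ i ∈ ℒ (n i)) (r : ℤ) (a : A) (ha : a ∈ 𝒜 r) (i : Fin m)
    (hi : i ∈ S) :
    f S.card (sub S (Function.update ξ i (a • ξ i))) =
      (-1 : K) ^ (r * (e + ∑ j ∈ S with j < i, n j)) • a • f S.card (sub S ξ) := by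
  obtain ⟨b, hb⟩ : ∃ b, S.orderEmbOfFin rfl b = i := by
    have : i ∈ Set.range (S.orderEmbOfFin rfl) := by simpa using hi
    exact this
  rw [sub_update_mem S ξ i b hb, ← sum_sub_lt S n i b hb,
    ← hf _ (sub S n) (sub S ξ) (mem_sub S h) r a ha b]
  simp only [sub, hb]

end Symmetry

/-! ### Forms -/

section Forms

variable {K A L P : Type*} [Field K] [Ring A] [Algebra K A] (𝒜 : ℤ → Submodule K A)
  [AddCommGroup L] [Module K L] [Module A L] (ℒ : ℤ → Submodule K L)
  [AddCommGroup P] [Module K P] [Module A P] [IsScalarTower K A P] (ℳ : ℤ → Submodule K P)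

/-- The degree `e` part of `Sym_A(L, P) = ⨁_k Sym_A^k(L, P)`: finite families of graded
`A`-multilinear, graded symmetric maps `L^k → P` of degree `e`. -/
def symForm (e : ℤ) : Submodule K (Cochain K L P) :=
  finiteCochains K L P ⊓ Submodule.pi Set.univ fun k =>
    degreeMaps ℒ ℳ e k ⊓ gradedSymmetric ℒ k ⊓ gradedLinear 𝒜 ℒ e k

/-- `Sym_A(L, P)`, the space of graded symmetric `P`-valued forms on `L`. -/
def Sym : Submodule K (Cochain K L P) := ⨆ e, symForm 𝒜 ℒ ℳ e

/-- A homogeneous form as an element of `Sym_A(L, P)`. -/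
def Sym.of {e : ℤ} (Ω : symForm 𝒜 ℒ ℳ e) : Sym 𝒜 ℒ ℳ :=
  Submodule.inclusion (le_iSup (symForm 𝒜 ℒ ℳ) e) Ω

/-- The product `ω Ω` of an `A`-valued and a `P`-valued form, where `Ω` has degree `e`:
`(ω Ω)(ξ) = ∑_σ α(σ, ξ) (-1)^{e |ξ_S|} ω(ξ_S) Ω(ξ_{Sᶜ})`, summed over unshuffles. -/
def mulCochain [DirectSum.Decomposition ℒ] (e : ℤ) (ω : Cochain K L A) (Ω : Cochain K L P) :
    Cochain K L P :=
  cup ℒ (fun _ _ => (Algebra.lsmul K K P).toLinearMap) e ω Ω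

theorem mulCochain_mem [DirectSum.Decomposition ℒ] [IsScalarTower K A L] [SetLike.GradedSMul 𝒜 ℒ]
    [SetLike.GradedSMul 𝒜 ℳ] [GradedCommutative 𝒜] {e e' : ℤ} {ω : Cochain K L A}
    {Ω : Cochain K L P} (hω : ω ∈ symForm 𝒜 ℒ 𝒜 e) (hΩ : Ω ∈ symForm 𝒜 ℒ ℳ e') :
    mulCochain ℒ e' ω Ω ∈ symForm 𝒜 ℒ ℳ (e + e') := by
  simp only [symForm, Submodule.mem_inf, Submodule.mem_pi, Set.mem_univ, true_imp_iff] at hω hΩ ⊢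
  refine ⟨cup_finite _ _ _ _ _ hω.1 hΩ.1, fun m => ⟨⟨?_, cup_gradedSymmetric _ _ _ _ _
    (fun k => (hω.2 k).1.2) (fun k => (hΩ.2 k).1.2) m⟩, ?_⟩⟩
  · intro n ξ h
    rw [mulCochain, cup_apply ℒ _ _ _ _ n ξ h]
    refine Submodule.sum_mem _ fun S _ => Submodule.smul_mem _ _ ?_
    have h1 := (hω.2 S.card).1.1 (sub S n) (sub S ξ) (mem_sub S h)
    have h2 := (hΩ.2 Sᶜ.card).1.1 (sub Sᶜ n) (sub Sᶜ ξ) (mem_sub Sᶜ h)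
    rw [sum_sub] at h1 h2
    have h3 := SetLike.GradedSMul.smul_mem h1 h2
    rw [vadd_eq_add] at h3
    have h4 : e + ∑ i ∈ S, n i + (e' + ∑ i ∈ Sᶜ, n i) = e + e' + ∑ i, n i := by
      rw [← Finset.sum_add_sum_compl S n]; ring
    rw [h4] at h3
    exact h3
  · intro n ξ h r a ha i
    have h' : ∀ j, Function.update ξ i (a • ξ i) j ∈ ℒ (Function.update n i (n i + r) j) := by
      intro j
      by_cases hj : j = i
      · subst hj
        have := SetLike.GradedSMul.smul_mem ha (h j)
        rw [vadd_eq_add, add_comm] at this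
        simpa using this
      · simpa [Function.update_of_ne hj] using h j
    rw [mulCochain, cup_apply ℒ _ _ _ _ _ _ h', cup_apply ℒ _ _ _ _ n ξ h, Finset.smul_sum,
      Finset.smul_sum]
    refine Finset.sum_congr rfl fun S _ => ?_
    change _ • (ω S.card _ • Ω Sᶜ.card _) = _ • a • _ • (ω S.card _ • Ω Sᶜ.card _)
    have hlt : ∑ j with j < i, n j = ∑ j ∈ S with j < i, n j + ∑ j ∈ Sᶜ with j < i, n j := by
      simp only [Finset.sum_filter]
      exact (Finset.sum_add_sum_compl S _).symm
    by_cases hi : i ∈ S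
    · have hi' : i ∉ Sᶜ := by simpa using hi
      have hsum : ∑ j ∈ S, Function.update n i (n i + r) j = ∑ j ∈ S, n j + r := by
        rw [Finset.sum_update_of_mem hi, ← Finset.add_sum_erase S n hi, Finset.erase_eq]
        ring
      rw [sub_update_notMem _ _ _ hi', apply_sub_smul 𝒜 (fun k => (hω.2 k).2) S n ξ h r a ha i hi,
        unshuffleSign_update_mem _ _ _ hi, hsum, smul_assoc, smul_assoc, smul_smul,
        smul_comm a (_ : K), smul_smul, smul_smul]
      congr 1
      rw [hlt, mul_add e', zpow_add₀ (by simp), mul_comm e' r]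
      have : r * (e + e' + (∑ j ∈ S with j < i, n j + ∑ j ∈ Sᶜ with j < i, n j)) =
        r * ∑ j ∈ Sᶜ with j < i, n j + r * e' + r * (e + ∑ j ∈ S with j < i, n j) := by ring
      rw [this, zpow_add₀ (by simp), zpow_add₀ (by simp)]
      ring
    · have hi' : i ∈ Sᶜ := by simpa using hi
      have hsum : ∑ j ∈ S, Function.update n i (n i + r) j = ∑ j ∈ S, n j := by
        refine Finset.sum_congr rfl fun j hj => ?_
        rw [Function.update_of_ne]
        rintro rfl; exact hi hj
      have h1 := (hω.2 S.card).1.1 (sub S n) (sub S ξ) (mem_sub S h)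
      rw [sum_sub] at h1
      have hsplit : ∑ j ∈ S, n j = ∑ j ∈ S with j < i, n j + ∑ j ∈ S with i < j, n j := by
        rw [Finset.sum_filter, Finset.sum_filter, ← Finset.sum_add_distrib]
        refine Finset.sum_congr rfl fun j hj => ?_
        rcases lt_trichotomy j i with hj' | rfl | hj'
        · simp [hj', hj'.le.not_gt]
        · exact absurd hj hi
        · simp [hj', hj'.le.not_gt]
      rw [sub_update_notMem _ _ _ hi,
        apply_sub_smul 𝒜 (fun k => (hΩ.2 k).2) Sᶜ n ξ h r a ha i hi',
        unshuffleSign_update_notMem _ _ _ hi, hsum, smul_comm (ω S.card _) (_ : K),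
        ← smul_assoc (ω S.card _) a, smul_eq_mul, GradedCommutative.comm _ _ _ _ h1 ha,
        smul_comm a (_ : K), smul_assoc, smul_smul, smul_smul, smul_smul, mul_smul a]
      congr 1
      rw [hlt, mul_assoc, mul_assoc]
      have h2 : r * (e + e' + (∑ j ∈ S with j < i, n j + ∑ j ∈ Sᶜ with j < i, n j)) =
        r * e + r * e' + r * ∑ j ∈ S with j < i, n j + r * ∑ j ∈ Sᶜ with j < i, n j := by ring
      have h3 : r * (e' + ∑ j ∈ Sᶜ with j < i, n j) =
        r * e' + r * ∑ j ∈ Sᶜ with j < i, n j := by ring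
      have h4 : (e + ∑ j ∈ S, n j) * r =
        r * e + r * ∑ j ∈ S with j < i, n j + r * ∑ j ∈ S with i < j, n j := by
        rw [hsplit]; ring
      rw [h2, h3, h4]
      simp only [zpow_add₀ (show (-1 : K) ≠ 0 by simp)]
      have h5 := neg_one_zpow_mul_self (K := K) (r * ∑ j ∈ S with i < j, n j)
      generalize (-1 : K) ^ (r * ∑ j ∈ S with i < j, n j) = x at *
      linear_combination (unshuffleSign K n S * (-1) ^ (e' * ∑ j ∈ S, n j) * (-1) ^ (r * e) *
        (-1) ^ (r * e') * (-1) ^ (r * ∑ j ∈ S with j < i, n j) *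
        (-1) ^ (r * ∑ j ∈ Sᶜ with j < i, n j)) * h5

theorem mulCochain_add_left [DirectSum.Decomposition ℒ] (e : ℤ) (ω ω' : Cochain K L A)
    (Ω : Cochain K L P) :
    mulCochain ℒ e (ω + ω') Ω = mulCochain ℒ e ω Ω + mulCochain ℒ e ω' Ω := by
  funext m
  refine ext_homogeneous ℒ fun n ξ h => ?_
  simp only [mulCochain, Pi.add_apply, add_apply, cup_apply ℒ _ _ _ _ n ξ h, map_add,
    LinearMap.add_apply, smul_add, Finset.sum_add_distrib]

theorem mulCochain_add_right [DirectSum.Decomposition ℒ] (e : ℤ) (ω : Cochain K L A)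
    (Ω Ω' : Cochain K L P) :
    mulCochain ℒ e ω (Ω + Ω') = mulCochain ℒ e ω Ω + mulCochain ℒ e ω Ω' := by
  funext m
  refine ext_homogeneous ℒ fun n ξ h => ?_
  simp only [mulCochain, Pi.add_apply, add_apply, cup_apply ℒ _ _ _ _ n ξ h, map_add,
    smul_add, Finset.sum_add_distrib]

theorem mulCochain_smul_left [DirectSum.Decomposition ℒ] (e : ℤ) (c : K) (ω : Cochain K L A)
    (Ω : Cochain K L P) : mulCochain ℒ e (c • ω) Ω = c • mulCochain ℒ e ω Ω := by
  funext m
  refine ext_homogeneous ℒ fun n ξ h => ?_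
  simp only [mulCochain, Pi.smul_apply, smul_apply, cup_apply ℒ _ _ _ _ n ξ h, map_smul,
    LinearMap.smul_apply, Finset.smul_sum, smul_comm c]

theorem mulCochain_smul_right [DirectSum.Decomposition ℒ] (e : ℤ) (c : K) (ω : Cochain K L A)
    (Ω : Cochain K L P) : mulCochain ℒ e ω (c • Ω) = c • mulCochain ℒ e ω Ω := by
  funext m
  refine ext_homogeneous ℒ fun n ξ h => ?_
  simp only [mulCochain, Pi.smul_apply, smul_apply, cup_apply ℒ _ _ _ _ n ξ h, map_smul,
    Finset.smul_sum, smul_comm c]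

/-- The product of homogeneous forms. -/
def mulForm [DirectSum.Decomposition ℒ] [IsScalarTower K A L] [SetLike.GradedSMul 𝒜 ℒ]
    [SetLike.GradedSMul 𝒜 ℳ] [GradedCommutative 𝒜] {e e' : ℤ} (ω : symForm 𝒜 ℒ 𝒜 e)
    (Ω : symForm 𝒜 ℒ ℳ e') : symForm 𝒜 ℒ ℳ (e + e') :=
  ⟨mulCochain ℒ e' ω.1 Ω.1, mulCochain_mem 𝒜 ℒ ℳ ω.2 Ω.2⟩

end Forms

/-! ### Multiderivations and derivation valued forms -/

section Pairs

variable {K A L P : Type*} [Field K] [Ring A] [Algebra K A] (𝒜 : ℤ → Submodule K A)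
  [AddCommGroup L] [Module K L] [Module A L] [IsScalarTower K A L] (ℒ : ℤ → Submodule K L)
  [AddCommGroup P] [Module K P] [Module A P] [IsScalarTower K A P] (ℳ : ℤ → Submodule K P)

/-- `K`-linear endomorphisms of degree `d`. -/
def endDegree (d : ℤ) : Submodule K (Module.End K P) where
  carrier := {φ | ∀ (j : ℤ) (p : P), p ∈ ℳ j → φ p ∈ ℳ (j + d)}
  zero_mem' := fun _ _ _ => Submodule.zero_mem _
  add_mem' := fun hφ hψ j p hp => Submodule.add_mem _ (hφ j p hp) (hψ j p hp)
  smul_mem' := fun c _ hφ j p hp => Submodule.smul_mem _ c (hφ j p hp)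

/-- The degree `d` part of `Der^• L = ⨁_k Der^k L`: pairs `(X, σ)` of finite families, where the
member `X k : L^k → L` is the component of `X` with `k` entries and the member
`σ k : L^k → Der A` is the symbol of `X (k + 1)` (the component `X 0 ∈ L` has no symbol). -/
def multiDer (d : ℤ) : Submodule K (Cochain K L L × Cochain K L (Module.End K A)) where
  carrier := {x |
    x.1 ∈ finiteCochains K L L ∧ x.2 ∈ finiteCochains K L (Module.End K A) ∧
    (∀ k, x.1 k ∈ degreeMaps ℒ ℒ d k ⊓ gradedSymmetric ℒ k) ∧
    (∀ k, x.2 k ∈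
      degreeMaps ℒ (endDegree 𝒜) d k ⊓ gradedSymmetric ℒ k ⊓ gradedLinear 𝒜 ℒ d k) ∧
    (∀ (k : ℕ) (n : Fin k → ℤ) (ξ : Fin k → L), (∀ i, ξ i ∈ ℒ (n i)) →
      ∀ (r : ℤ) (a : A), a ∈ 𝒜 r → ∀ b : A,
        x.2 k ξ (a * b) = x.2 k ξ a * b + (-1 : K) ^ ((d + ∑ i, n i) * r) • (a * x.2 k ξ b)) ∧
    (∀ (k : ℕ) (n : Fin k → ℤ) (ξ : Fin k → L), (∀ i, ξ i ∈ ℒ (n i)) →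
      ∀ (r : ℤ) (a : A), a ∈ 𝒜 r → ∀ ζ : L,
        x.1 (k + 1) (Fin.snoc ξ (a • ζ)) = x.2 k ξ a • ζ +
          (-1 : K) ^ ((d + ∑ i, n i) * r) • a • x.1 (k + 1) (Fin.snoc ξ ζ))}
  zero_mem' := by
    refine ⟨zero_mem _, zero_mem _, fun k => zero_mem _, fun k => zero_mem _, ?_, ?_⟩ <;>
      intros <;> simp
  add_mem' := by
    rintro x y ⟨h1, h2, h3, h4, h5, h6⟩ ⟨g1, g2, g3, g4, g5, g6⟩
    refine ⟨add_mem h1 g1, add_mem h2 g2, fun k => add_mem (h3 k) (g3 k),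
      fun k => add_mem (h4 k) (g4 k), ?_, ?_⟩
    · intro k n ξ h r a ha b
      simp only [Prod.snd_add, Pi.add_apply, add_apply, LinearMap.add_apply,
        h5 k n ξ h r a ha b, g5 k n ξ h r a ha b, add_mul, mul_add, smul_add]
      abel
    · intro k n ξ h r a ha ζ
      simp only [Prod.snd_add, Prod.fst_add, Pi.add_apply, add_apply, LinearMap.add_apply,
        h6 k n ξ h r a ha ζ, g6 k n ξ h r a ha ζ, add_smul, smul_add]
      abel
  smul_mem' := by
    rintro c x ⟨h1, h2, h3, h4, h5, h6⟩
    refine ⟨Submodule.smul_mem _ c h1, Submodule.smul_mem _ c h2,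
      fun k => Submodule.smul_mem _ c (h3 k), fun k => Submodule.smul_mem _ c (h4 k), ?_, ?_⟩
    · intro k n ξ h r a ha b
      simp only [Prod.smul_snd, Pi.smul_apply, smul_apply, LinearMap.smul_apply,
        h5 k n ξ h r a ha b, smul_add, smul_mul_assoc, mul_smul_comm, smul_comm c]
    · intro k n ξ h r a ha ζ
      simp only [Prod.smul_snd, Prod.smul_fst, Pi.smul_apply, smul_apply, LinearMap.smul_apply,
        h6 k n ξ h r a ha ζ, smul_add, smul_assoc, smul_comm c]

/-- The degree `d` part of `𝓛(P) = ⨁_k 𝓛^k(P)`: pairs `(𝕏, ∇)` of a multiderivation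
`𝕏 = (X, σ)` of `L` and a graded symmetric, graded `A`-multilinear form `∇` with values in
`Der^L P` such that the symbol of `∇(ξ)` is `σ(ξ)`. The member `∇ k : L^k → Der^L P` belongs to
the component of `𝕏` with `k + 1` entries. -/
def leftPairs (d : ℤ) : Submodule K
    ((Cochain K L L × Cochain K L (Module.End K A)) × Cochain K L (Module.End K P)) where
  carrier := {x | x.1 ∈ multiDer 𝒜 ℒ d ∧ x.2 ∈ finiteCochains K L (Module.End K P) ∧
    (∀ k, x.2 k ∈
      degreeMaps ℒ (endDegree ℳ) d k ⊓ gradedSymmetric ℒ k ⊓ gradedLinear 𝒜 ℒ d k) ∧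
    (∀ (k : ℕ) (n : Fin k → ℤ) (ξ : Fin k → L), (∀ i, ξ i ∈ ℒ (n i)) →
      ∀ (r : ℤ) (a : A), a ∈ 𝒜 r → ∀ p : P,
        x.2 k ξ (a • p) =
          x.1.2 k ξ a • p + (-1 : K) ^ ((d + ∑ i, n i) * r) • a • x.2 k ξ p)}
  zero_mem' := by
    refine ⟨zero_mem _, zero_mem _, fun k => zero_mem _, ?_⟩
    intros
    simp
  add_mem' := by
    rintro x y ⟨h1, h2, h3, h4⟩ ⟨g1, g2, g3, g4⟩
    refine ⟨add_mem h1 g1, add_mem h2 g2, fun k => add_mem (h3 k) (g3 k), ?_⟩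
    intro k n ξ h r a ha p
    simp only [Prod.snd_add, Prod.fst_add, Pi.add_apply, add_apply, LinearMap.add_apply,
      h4 k n ξ h r a ha p, g4 k n ξ h r a ha p, add_smul, smul_add]
    abel
  smul_mem' := by
    rintro c x ⟨h1, h2, h3, h4⟩
    refine ⟨Submodule.smul_mem _ c h1, Submodule.smul_mem _ c h2,
      fun k => Submodule.smul_mem _ c (h3 k), ?_⟩
    intro k n ξ h r a ha p
    simp only [Prod.smul_snd, Prod.smul_fst, Pi.smul_apply, smul_apply, LinearMap.smul_apply,
      h4 k n ξ h r a ha p, smul_add, smul_assoc, smul_comm c]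

/-- The degree `d` part of `𝓛^k(P)`: the multiderivation has `k` entries, its symbol and the
form `∇` have `k - 1` entries (both are absent if `k = 0`). -/
def leftPairsWeight (k : ℕ) (d : ℤ) : Submodule K
    ((Cochain K L L × Cochain K L (Module.End K A)) × Cochain K L (Module.End K P)) :=
  leftPairs 𝒜 ℒ ℳ d ⊓
    ((weight K L L k).prod (weight K L (Module.End K A) (k - 1))).prod
      (weight K L (Module.End K P) (k - 1))

variable [DirectSum.Decomposition ℒ]

/-- The graded commutator
`[∇, ∇'](ξ) = ∑_σ α(σ, ξ) (-1)^{d' |ξ_S|} [∇(ξ_S), ∇'(ξ_{Sᶜ})]` of endomorphism valued forms of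
degrees `d` and `d'`. -/
def cupCommutator (d d' : ℤ) (φ ψ : Cochain K L (Module.End K P)) :
    Cochain K L (Module.End K P) :=
  cup ℒ (fun s s' => LinearMap.mul K (Module.End K P) -
    (-1 : K) ^ ((d + s) * (d' + s')) • (LinearMap.mul K (Module.End K P)).flip) d' φ ψ

/-- `∇'' = ∇ ∘ X' - (-1)^{d d'} ∇' ∘ X + [∇, ∇']`. -/
def connBracket (d d' : ℤ) (X X' : Cochain K L L) (φ φ' : Cochain K L (Module.End K P)) :
    Cochain K L (Module.End K P) :=
  gerst ℒ φ X' - (-1 : K) ^ (d * d') • gerst ℒ φ' X + cupCommutator ℒ d d' φ φ'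

/-- The bracket `[𝕏, 𝕏']` of multiderivations of degrees `d` and `d'`. -/
def multiDerBracket (d d' : ℤ) (x y : Cochain K L L × Cochain K L (Module.End K A)) :
    Cochain K L L × Cochain K L (Module.End K A) :=
  (gerst ℒ x.1 y.1 - (-1 : K) ^ (d * d') • gerst ℒ y.1 x.1,
    connBracket ℒ d d' x.1 y.1 x.2 y.2)

/-- The bracket of elements of `𝓛(P)` of degrees `d` and `d'`. -/
def leftBracket (d d' : ℤ)
    (x y : (Cochain K L L × Cochain K L (Module.End K A)) × Cochain K L (Module.End K P)) :
    (Cochain K L L × Cochain K L (Module.End K A)) × Cochain K L (Module.End K P) :=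
  (multiDerBracket ℒ d d' x.1 y.1, connBracket ℒ d d' x.1.1 y.1.1 x.2 y.2)

/-- `∇ ∘ Ω - (-1)^{d e} Ω ∘ X` for forms `∇` (of degree `d`) and `Ω` (of degree `e`), where
`(∇ ∘ Ω)(ξ) = ∑_σ α(σ, ξ) (-1)^{e |ξ_S|} ∇(ξ_S)(Ω(ξ_{Sᶜ}))`. -/
def chevalleyEilenberg (d e : ℤ) (X : Cochain K L L) (φ : Cochain K L (Module.End K P))
    (Ω : Cochain K L P) : Cochain K L P :=
  cup ℒ (fun _ _ => LinearMap.id) e φ Ω - (-1 : K) ^ (d * e) • gerst ℒ Ω X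

/-- The operator `η(𝕏)` for a multiderivation `𝕏 = (X, σ)` of degree `d`, on forms `ω` of
degree `e`: `η(𝕏)(ω) = σ ∘ ω - (-1)^{d e} ω ∘ X`. -/
def eta (d e : ℤ) (x : Cochain K L L × Cochain K L (Module.End K A)) (ω : Cochain K L A) :
    Cochain K L A :=
  chevalleyEilenberg ℒ d e x.1 x.2 ω

end Pairs

/-! ### Module derivations of `Sym_A(L, P)` -/

section Derivations

variable {K A L P : Type*} [Field K] [Ring A] [Algebra K A] (𝒜 : ℤ → Submodule K A)
  [GradedAlgebra 𝒜] [GradedCommutative 𝒜]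
  [AddCommGroup L] [Module K L] [Module A L] [IsScalarTower K A L] (ℒ : ℤ → Submodule K L)
  [DirectSum.Decomposition ℒ] [SetLike.GradedSMul 𝒜 ℒ]
  [AddCommGroup P] [Module K P] [Module A P] [IsScalarTower K A P] (ℳ : ℤ → Submodule K P)
  [SetLike.GradedSMul 𝒜 ℳ]

/-- `D` has degree `d` and takes `ℓ`-forms to `(ℓ + s)`-forms. -/
def HasBidegree (d s : ℤ) (D : Module.End K (Sym 𝒜 ℒ ℳ)) : Prop :=
  (∀ (e : ℤ) (Ω : symForm 𝒜 ℒ ℳ e),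
    (D (Sym.of 𝒜 ℒ ℳ Ω) : Cochain K L P) ∈ symForm 𝒜 ℒ ℳ (e + d)) ∧
  ∀ (l : ℕ) (Ω : Sym 𝒜 ℒ ℳ), (Ω : Cochain K L P) ∈ weight K L P l →
    (D Ω : Cochain K L P) ∈ weight K L P (l + s)

/-- The Leibniz rule `D(ω Ω) = τ(ω) Ω + (-1)^{d |ω|} ω D(Ω)` for an operator `D` of degree `d`. -/
def Leibniz (d : ℤ) (D : Module.End K (Sym 𝒜 ℒ ℳ)) (τ : Module.End K (Sym 𝒜 ℒ 𝒜)) : Prop :=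
  ∀ (e e' : ℤ) (ω : symForm 𝒜 ℒ 𝒜 e) (Ω : symForm 𝒜 ℒ ℳ e'),
    (D (Sym.of 𝒜 ℒ ℳ (mulForm 𝒜 ℒ ℳ ω Ω)) : Cochain K L P) =
      mulCochain ℒ e' (τ (Sym.of 𝒜 ℒ 𝒜 ω) : Cochain K L A) Ω +
        (-1 : K) ^ (d * e) •
          mulCochain ℒ (e' + d) (ω : Cochain K L A) (D (Sym.of 𝒜 ℒ ℳ Ω) : Cochain K L P)

variable {𝒜 ℒ ℳ}

theorem HasBidegree.zero {d s : ℤ} : HasBidegree 𝒜 ℒ ℳ d s 0 :=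
  ⟨fun _ _ => zero_mem _, fun _ _ _ => zero_mem _⟩

theorem HasBidegree.add {d s : ℤ} {D D' : Module.End K (Sym 𝒜 ℒ ℳ)}
    (h : HasBidegree 𝒜 ℒ ℳ d s D) (h' : HasBidegree 𝒜 ℒ ℳ d s D') :
    HasBidegree 𝒜 ℒ ℳ d s (D + D') :=
  ⟨fun e Ω => add_mem (h.1 e Ω) (h'.1 e Ω), fun l Ω hΩ => add_mem (h.2 l Ω hΩ) (h'.2 l Ω hΩ)⟩

theorem HasBidegree.smul {d s : ℤ} (c : K) {D : Module.End K (Sym 𝒜 ℒ ℳ)}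
    (h : HasBidegree 𝒜 ℒ ℳ d s D) : HasBidegree 𝒜 ℒ ℳ d s (c • D) :=
  ⟨fun e Ω => Submodule.smul_mem _ c (h.1 e Ω),
    fun l Ω hΩ => Submodule.smul_mem _ c (h.2 l Ω hΩ)⟩

theorem Leibniz.zero {d : ℤ} : Leibniz 𝒜 ℒ ℳ d 0 0 := by
  intro e e' ω Ω
  have h1 := mulCochain_smul_left ℒ e' (0 : K) (0 : Cochain K L A) (Ω : Cochain K L P)
  have h2 := mulCochain_smul_right ℒ (e' + d) (0 : K) (ω : Cochain K L A) (0 : Cochain K L P)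
  simp only [zero_smul] at h1 h2
  simp [h1, h2]

theorem Leibniz.add {d : ℤ} {D D' : Module.End K (Sym 𝒜 ℒ ℳ)} {τ τ' : Module.End K (Sym 𝒜 ℒ 𝒜)}
    (h : Leibniz 𝒜 ℒ ℳ d D τ) (h' : Leibniz 𝒜 ℒ ℳ d D' τ') :
    Leibniz 𝒜 ℒ ℳ d (D + D') (τ + τ') := by
  intro e e' ω Ω
  simp only [LinearMap.add_apply, Submodule.coe_add, mulCochain_add_left, mulCochain_add_right,
    h e e' ω Ω, h' e e' ω Ω, smul_add]
  abel

theorem Leibniz.smul {d : ℤ} (c : K) {D : Module.End K (Sym 𝒜 ℒ ℳ)}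
    {τ : Module.End K (Sym 𝒜 ℒ 𝒜)} (h : Leibniz 𝒜 ℒ ℳ d D τ) :
    Leibniz 𝒜 ℒ ℳ d (c • D) (c • τ) := by
  intro e e' ω Ω
  simp only [LinearMap.smul_apply, Submodule.coe_smul, mulCochain_smul_left,
    mulCochain_smul_right, h e e' ω Ω, smul_add, smul_comm c]

variable (𝒜 ℒ ℳ)

/-- The `Sym_A(L, A)`-module derivations `(D, τ)` of `Sym_A(L, P)` of degree `d` which take
`ℓ`-forms to `(ℓ + s)`-forms; the symbol `τ` is a derivation of the algebra `Sym_A(L, A)`. -/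
def modDerShift (d s : ℤ) :
    Submodule K (Module.End K (Sym 𝒜 ℒ ℳ) × Module.End K (Sym 𝒜 ℒ 𝒜)) where
  carrier := {x | HasBidegree 𝒜 ℒ ℳ d s x.1 ∧ HasBidegree 𝒜 ℒ 𝒜 d s x.2 ∧
    Leibniz 𝒜 ℒ 𝒜 d x.2 x.2 ∧ Leibniz 𝒜 ℒ ℳ d x.1 x.2}
  zero_mem' := ⟨.zero, .zero, .zero, .zero⟩
  add_mem' := fun h g => ⟨h.1.add g.1, h.2.1.add g.2.1, h.2.2.1.add g.2.2.1, h.2.2.2.add g.2.2.2⟩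
  smul_mem' := fun c _ h => ⟨h.1.smul c, h.2.1.smul c, h.2.2.1.smul c, h.2.2.2.smul c⟩

/-- The degree `d` part of the bigraded space of `Sym_A(L, A)`-module derivations of
`Sym_A(L, P)`: finite sums of derivations which shift the number of entries of forms by an
arbitrary integer `s`. -/
def modDer (d : ℤ) : Submodule K (Module.End K (Sym 𝒜 ℒ ℳ) × Module.End K (Sym 𝒜 ℒ 𝒜)) :=
  ⨆ s : ℤ, modDerShift 𝒜 ℒ ℳ d s

end Derivations

/-- The graded commutator `([D, D'], [τ, τ'])` of module derivations of degrees `d` and `d'`. -/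
def modDerBracket {K V W : Type*} [Field K] [AddCommGroup V] [Module K V] [AddCommGroup W]
    [Module K W] (d d' : ℤ) (x y : Module.End K V × Module.End K W) :
    Module.End K V × Module.End K W :=
  x * y - (-1 : K) ^ (d * d') • (y * x)

/-! ### Graded Lie algebras -/

section GradedLie

variable {K V W : Type*} [Field K] [AddCommGroup V] [Module K V] [AddCommGroup W] [Module K W]

/-- The family `⨁_d g d` is a graded Lie algebra, with bracket `br i j x y = [x, y]` for
`x ∈ g i` and `y ∈ g j`. -/
structure IsGradedLie (g : ℤ → Submodule K V) (br : ℤ → ℤ → V → V → V) : Prop where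
  mem : ∀ {i j : ℤ} {x y : V}, x ∈ g i → y ∈ g j → br i j x y ∈ g (i + j)
  add_left : ∀ {i j : ℤ} {x x' y : V}, x ∈ g i → x' ∈ g i → y ∈ g j →
    br i j (x + x') y = br i j x y + br i j x' y
  add_right : ∀ {i j : ℤ} {x y y' : V}, x ∈ g i → y ∈ g j → y' ∈ g j →
    br i j x (y + y') = br i j x y + br i j x y'
  smul_left : ∀ {i j : ℤ} {x y : V} (c : K), x ∈ g i → y ∈ g j →
    br i j (c • x) y = c • br i j x y
  smul_right : ∀ {i j : ℤ} {x y : V} (c : K), x ∈ g i → y ∈ g j →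
    br i j x (c • y) = c • br i j x y
  skew : ∀ {i j : ℤ} {x y : V}, x ∈ g i → y ∈ g j →
    br i j x y = -((-1 : K) ^ (i * j) • br j i y x)
  jacobi : ∀ {i j k : ℤ} {x y z : V}, x ∈ g i → y ∈ g j → z ∈ g k →
    br i (j + k) x (br j k y z) =
      br (i + j) k (br i j x y) z + (-1 : K) ^ (i * j) • br j (i + k) y (br i k x z)

/-- A degree preserving linear map, given by its components `φ d : g d → h d`, that preserves
the brackets. -/
def IsGradedLieHom {g : ℤ → Submodule K V} {brV : ℤ → ℤ → V → V → V}
    {h : ℤ → Submodule K W} {brW : ℤ → ℤ → W → W → W} (hg : IsGradedLie g brV)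
    (_ : IsGradedLie h brW) (φ : (d : ℤ) → g d →ₗ[K] h d) : Prop :=
  ∀ (i j : ℤ) (x : g i) (y : g j),
    (φ (i + j) ⟨brV i j x y, hg.mem x.2 y.2⟩ : W) = brW i j (φ i x) (φ j y)

end GradedLie

end

end GradedLR

open GradedLR

namespace GradedLR

set_option linter.unusedSectionVars false

/-! Every sign identity is checked on lists of homogeneous elements paired with their degrees. On
such a list the sum over subsets `S` with Koszul signs becomes `unshuffleSum`, a recursion on the
list: the head joins the first part, or it joins the second part at the cost of the sign for passing
the first. Graded cocommutativity (`unshuffleSum_comm`) and coassociativity (`unshuffleSum_assoc`)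
of unshuffling follow by induction on the list. After that, a sign identity is a regrouping of a
threefold unshuffle together with a comparison of parities.

Three identities carry the algebra: products along compatible bilinear maps are associative
(`cup_assoc`), composition with `X` is a derivation of products (`cup_gerst`), and composition is a
graded right pre-Lie product (`gerst_gerst`). Together they give `ceOp_commutator`: the operators `Ω
↦ φ ∪ Ω ∓ Ω ∘ X` represent the bracket, for every bilinear action of `End P`. For the evaluation
action on `P` this says that `η^L` preserves brackets. For left multiplication on `End P` it gives
the Jacobi identity of the `∇`-component, because `∇''` is the graded antisymmetrisation of such an
operator (`connBracket_eq`). The `X`-component is the commutator of a pre-Lie product, and the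
`σ`-component is the case `P = A` of the `∇`-component.

Closure under the bracket and `A`-linearity of the operator rest on one cancellation. Neither `φ ∪
Ω` nor `Ω ∘ X` is `A`-linear, but both fail by the same sum of terms `σ(ξ_S)(a) Ω(…)`, up to the
sign in the definition (`ev_cup_smul`, `ev_gerst_smul`).

For the isomorphism, finitely generated projective `L` has homogeneous generators `b i` and
one-forms `θ i` which expand every element (`exists_isDualBasis`). The Euler identity `∑ ± θ i · Ω(b
i, …) = k Ω` for `k`-forms (`IsDualBasis.euler`) then shows, in characteristic zero, that a module
derivation vanishes as soon as it kills `P` and its symbol kills every `θ i`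
(`IsDualBasis.eq_zero_of_leibniz`).

Injectivity: the operator on forms without entries returns `∇` and `σ`, and the symbol on `θ i`
returns `θ i (X)`, hence `X`. Surjectivity: given `(D, τ)`, read off `∇` and `σ` from forms without
entries, put `X = ∑ ± (σ ∘ θ i - τ (θ i)) b i`, and compare the resulting operators with `(D, τ)` on
generators (`isMultiDer_dualSum`, `gerst_dualSum`, `exists_leftPairOp_eq`). -/

theorem neg_one_zpow_mul (K : Type*) [Field K] (x y : ℤ) :
    (-1 : K) ^ x * (-1 : K) ^ y = (-1 : K) ^ (x + y) :=
  (zpow_add₀ (by simp) x y).symm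

/-! ### Sums over unshuffles of lists -/

section Lists

variable {K L M Q : Type*} [Field K] [AddCommGroup M] [Module K M] [AddCommGroup Q] [Module K Q]

/-- The total degree of a list of elements with prescribed degrees. -/
def degSum (l : List (ℤ × L)) : ℤ := (l.map Prod.fst).sum

@[simp] theorem degSum_nil : degSum ([] : List (ℤ × L)) = 0 := rfl

@[simp] theorem degSum_cons (h : ℤ × L) (l : List (ℤ × L)) : degSum (h :: l) = h.1 + degSum l := by
  simp [degSum]

@[simp] theorem degSum_append (s t : List (ℤ × L)) : degSum (s ++ t) = degSum s + degSum t := by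
  simp [degSum]

theorem degSum_perm {s t : List (ℤ × L)} (h : s.Perm t) : degSum s = degSum t :=
  (h.map _).sum_eq

section Homog

variable [AddCommGroup L] [Module K L]

/-- All members of the list are homogeneous of the prescribed degrees. -/
def Homog (ℒ : ℤ → Submodule K L) (l : List (ℤ × L)) : Prop := ∀ h ∈ l, h.2 ∈ ℒ h.1

theorem Homog.nil (ℒ : ℤ → Submodule K L) : Homog ℒ [] := by simp [Homog]

@[simp] theorem homog_cons {ℒ : ℤ → Submodule K L} {h : ℤ × L} {l : List (ℤ × L)} :
    Homog ℒ (h :: l) ↔ h.2 ∈ ℒ h.1 ∧ Homog ℒ l := by simp [Homog]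

@[simp] theorem homog_append {ℒ : ℤ → Submodule K L} {s t : List (ℤ × L)} :
    Homog ℒ (s ++ t) ↔ Homog ℒ s ∧ Homog ℒ t := by
  simp only [Homog, List.mem_append, or_imp, forall_and]

theorem Homog.perm {ℒ : ℤ → Submodule K L} {s t : List (ℤ × L)} (ht : Homog ℒ t)
    (h : s.Perm t) : Homog ℒ s := fun x hx => ht x (h.mem_iff.1 hx)

end Homog

/-- The sum of `F s t`, with Koszul signs, over the unshuffles `(s, t)` of a list. -/
def unshuffleSum (K : Type*) [Field K] [Module K Q] :
    List (ℤ × L) → (List (ℤ × L) → List (ℤ × L) → Q) → Q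
  | [], F => F [] []
  | a :: l, F => unshuffleSum K l (fun s t => F (a :: s) t) +
      unshuffleSum K l (fun s t => (-1 : K) ^ (a.1 * degSum s) • F s (a :: t))

variable (F G : List (ℤ × L) → List (ℤ × L) → Q) (l : List (ℤ × L))

theorem unshuffleSum_nil : unshuffleSum K [] F = F [] [] := rfl

theorem unshuffleSum_cons (a : ℤ × L) : unshuffleSum K (a :: l) F =
    unshuffleSum K l (fun s t => F (a :: s) t) +
      unshuffleSum K l (fun s t => (-1 : K) ^ (a.1 * degSum s) • F s (a :: t)) := rfl

variable {F G l} in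
-- Knowing that `s ++ t` permutes `l` is what allows homogeneity and total degree to pass from a
-- list to its two parts.
theorem unshuffleSum_congr (h : ∀ s t, (s ++ t).Perm l → F s t = G s t) :
    unshuffleSum K l F = unshuffleSum K l G := by
  induction l generalizing F G with
  | nil => exact h [] [] (List.Perm.refl _)
  | cons a l ih =>
    rw [unshuffleSum_cons, unshuffleSum_cons]
    congr 1
    · exact ih fun s t hst => h _ _ (hst.cons a)
    · refine ih fun s t hst => ?_
      rw [h s (a :: t) (List.perm_middle.trans (hst.cons a))]

theorem unshuffleSum_map (φ : Q →ₗ[K] M) :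
    φ (unshuffleSum K l F) = unshuffleSum K l fun s t => φ (F s t) := by
  induction l generalizing F with
  | nil => rfl
  | cons a l ih => simp only [unshuffleSum_cons, map_add, ih, map_smul]

theorem unshuffleSum_add : unshuffleSum K l (fun s t => F s t + G s t) =
    unshuffleSum K l F + unshuffleSum K l G := by
  induction l generalizing F G with
  | nil => rfl
  | cons a l ih =>
    simp only [unshuffleSum_cons, ih, smul_add]
    abel

theorem unshuffleSum_smul (c : K) : unshuffleSum K l (fun s t => c • F s t) =
    c • unshuffleSum K l F :=
  (unshuffleSum_map (K := K) F l (c • LinearMap.id)).symm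

theorem unshuffleSum_neg : unshuffleSum K l (fun s t => -F s t) = -unshuffleSum K l F :=
  (unshuffleSum_map (K := K) F l (-LinearMap.id)).symm

theorem unshuffleSum_sub : unshuffleSum K l (fun s t => F s t - G s t) =
    unshuffleSum K l F - unshuffleSum K l G := by
  simp only [sub_eq_add_neg, unshuffleSum_add, unshuffleSum_neg]

theorem unshuffleSum_zero : unshuffleSum K l (fun _ _ => (0 : Q)) = 0 := by
  simpa using unshuffleSum_smul (K := K) (fun _ _ => (0 : Q)) l 0

theorem unshuffleSum_sum {ι : Type*} (I : Finset ι) (F : ι → List (ℤ × L) → List (ℤ × L) → Q) :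
    unshuffleSum K l (fun s t => ∑ i ∈ I, F i s t) = ∑ i ∈ I, unshuffleSum K l (F i) := by
  classical
  induction I using Finset.induction_on with
  | empty => simp [unshuffleSum_zero]
  | insert a I ha ih => simp only [Finset.sum_insert ha, unshuffleSum_add, ih]

variable {F l} in
theorem unshuffleSum_mem {S : Submodule K Q} (h : ∀ s t, (s ++ t).Perm l → F s t ∈ S) :
    unshuffleSum K l F ∈ S := by
  induction l generalizing F with
  | nil => exact h [] [] (List.Perm.refl _)
  | cons a l ih =>
    exact S.add_mem (ih fun s t hst => h _ _ (hst.cons a))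
      (ih fun s t hst => S.smul_mem _ (h s (a :: t) (List.perm_middle.trans (hst.cons a))))

/-- Unshuffling is graded cocommutative. -/
theorem unshuffleSum_comm : unshuffleSum K l F =
    unshuffleSum K l fun s t => (-1 : K) ^ (degSum s * degSum t) • F t s := by
  induction l generalizing F with
  | nil => simp [unshuffleSum_nil]
  | cons a l ih =>
    -- Exchanging the parts turns "head in the first part" into "head in the second part", so the
    -- two summands have to be matched crosswise.
    rw [unshuffleSum_cons, unshuffleSum_cons, add_comm, ih, ih (fun s t => F (a :: s) t)]
    congr 1 <;> refine unshuffleSum_congr fun s t _ => ?_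
    · simp only [smul_smul, neg_one_zpow_mul, degSum_cons]
      congr 1
      exact neg_one_zpow_congr (by grind)
    · simp only [smul_smul, neg_one_zpow_mul, degSum_cons]
      congr 1
      exact neg_one_zpow_congr (by grind)

/-- Unshuffling is coassociative. -/
theorem unshuffleSum_assoc (F : List (ℤ × L) → List (ℤ × L) → List (ℤ × L) → Q) :
    unshuffleSum K l (fun w t => unshuffleSum K w fun u v => F u v t) =
      unshuffleSum K l fun u w => unshuffleSum K w fun v t => F u v t := by
  induction l generalizing F with
  | nil => rfl
  | cons a l ih =>
    simp only [unshuffleSum_cons, unshuffleSum_add, ih, ← unshuffleSum_smul, smul_add]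
    rw [add_assoc]
    congr 2
    -- Only the summand with `a` in the third part remains; its sign splits because the degree of
    -- `w` is the sum of those of `u` and `v`.
    rw [← ih fun u v t => (-1 : K) ^ (a.1 * degSum u) • (-1 : K) ^ (a.1 * degSum v) • F u v (a :: t)]
    refine unshuffleSum_congr fun w t _ => unshuffleSum_congr fun u v huv => ?_
    rw [smul_smul, neg_one_zpow_mul, ← degSum_perm huv, degSum_append, mul_add]

/-- Interchange of the first two parts of a threefold unshuffle. -/
theorem unshuffleSum_left_comm (F : List (ℤ × L) → List (ℤ × L) → List (ℤ × L) → Q) :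
    unshuffleSum K l (fun u w => unshuffleSum K w fun v t => F u v t) =
      unshuffleSum K l fun u w => unshuffleSum K w fun v t =>
        (-1 : K) ^ (degSum u * degSum v) • F v u t := by
  rw [← unshuffleSum_assoc, ← unshuffleSum_assoc]
  exact unshuffleSum_congr fun w t _ => unshuffleSum_comm _ _

end Lists

/-! ### Evaluation of multilinear maps on lists -/

section Eval

variable {K L M N Q : Type*} [Field K] [AddCommGroup L] [Module K L] [AddCommGroup M] [Module K M]
  [AddCommGroup N] [Module K N] [AddCommGroup Q] [Module K Q]

/-- Both lists of indices are sorted, free of duplicates, and have the elements of `S` as members,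
so they coincide. -/
theorem ofFn_sub {α : Type*} {m : ℕ} (S : Finset (Fin m)) (x : Fin m → α) :
    List.ofFn (sub S x) = ((List.finRange m).filter (· ∈ S)).map x := by
  have h : List.ofFn (S.orderEmbOfFin rfl) = (List.finRange m).filter (· ∈ S) := by
    refine List.Perm.eq_of_pairwise (le := (· ≤ ·)) (fun _ _ _ _ => le_antisymm) ?_ ?_ ?_
    · exact (List.sortedLE_ofFn_iff.2 (S.orderEmbOfFin rfl).monotone).pairwise
    · exact (List.pairwise_le_finRange m).filter _
    · rw [List.perm_ext_iff_of_nodup]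
      · intro a
        have := S.range_orderEmbOfFin rfl
        simp [List.mem_ofFn, ← Set.mem_range, this]
      · exact List.nodup_ofFn.2 (S.orderEmbOfFin rfl).injective
      · exact (List.nodup_finRange m).filter _
  rw [← h, List.map_ofFn]
  rfl

theorem degSum_sub {m : ℕ} (S : Finset (Fin m)) (x : Fin m → ℤ × L) :
    degSum (List.ofFn (sub S x)) = ∑ i ∈ S, (x i).1 := by
  rw [degSum, List.map_ofFn, List.sum_ofFn]
  exact sum_sub S fun i => (x i).1

/-- Subsets of `Fin (m + 1)` split according to whether they contain `0`, which is the choice made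
for the head of the list. If `0 ∈ S` no new pair is counted, since nothing precedes `0`; if `0 ∉ S`
each `i ∈ S` passes `0`, which gives the sign in the recursion of `unshuffleSum`. -/
theorem sum_unshuffleSign {m : ℕ} (x : Fin m → ℤ × L)
    (F : List (ℤ × L) → List (ℤ × L) → Q) :
    ∑ S, unshuffleSign K (fun i => (x i).1) S • F (List.ofFn (sub S x)) (List.ofFn (sub Sᶜ x)) =
      unshuffleSum K (List.ofFn x) F := by
  simp only [ofFn_sub]
  induction m generalizing F with
  | zero =>
    simp [unshuffleSign_eq, unshuffleSum_nil]
  | succ m ih =>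
    have hu : (Finset.univ : Finset (Finset (Fin (m + 1)))) =
        (insert 0 (Finset.univ.map (Fin.succEmb m))).powerset := by
      rw [← Finset.powerset_univ, Fin.univ_succ, Finset.cons_eq_insert]; rfl
    have h0 : (0 : Fin (m + 1)) ∉ Finset.univ.map (Fin.succEmb m) := by
      simp
    have hm : (Finset.univ.map (Fin.succEmb m)).powerset =
        (Finset.univ : Finset (Finset (Fin m))).map (Finset.mapEmbedding (Fin.succEmb m)).toEmbedding := by
      ext T
      simp only [Finset.mem_powerset, Finset.mem_map, Finset.mem_univ, true_and,
        RelEmbedding.coe_toEmbedding, Finset.mapEmbedding_apply]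
      rw [Finset.subset_map_iff]
      simp [eq_comm]
    rw [hu, Finset.sum_powerset_insert h0, hm, Finset.sum_map, Finset.sum_map, List.ofFn_succ,
      unshuffleSum_cons, ← ih, ← ih, add_comm]
    have hfil : ∀ (p : Fin (m + 1) → Bool), (List.finRange (m + 1)).filter p =
        if p 0 then 0 :: ((List.finRange m).filter (fun i => p i.succ)).map Fin.succ
        else ((List.finRange m).filter (fun i => p i.succ)).map Fin.succ := by
      intro p
      rw [List.finRange_succ, List.filter_cons, List.filter_map]
      rfl
    congr 1 <;> refine Finset.sum_congr rfl fun S _ => ?_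
    · congr 1
      · simp only [unshuffleSign_eq, Fintype.prod_prod_type, Fin.prod_univ_succ]
        simp [Fin.succ_lt_succ_iff]
      · simp only [hfil]
        simp [Function.comp_def]
    · rw [smul_smul]
      congr 1
      · simp only [unshuffleSign_eq, Fintype.prod_prod_type, Fin.prod_univ_succ]
        simp [Fin.succ_lt_succ_iff]
        -- Separates the factors of the pairs `(i, 0)` from those of the pairs of positive indices.
        have e : ∀ i, (if i ∈ S then (-1 : K) ^ ((x i.succ).1 * (x 0).1) *
              ∏ j, (if i ∈ S ∧ j ∉ S ∧ j < i then (-1 : K) ^ ((x i.succ).1 * (x j.succ).1) else 1)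
            else ∏ j, (if i ∈ S ∧ j ∉ S ∧ j < i then (-1 : K) ^ ((x i.succ).1 * (x j.succ).1)
              else 1)) = (if i ∈ S then (-1 : K) ^ ((x i.succ).1 * (x 0).1) else 1) *
              ∏ j, (if i ∈ S ∧ j ∉ S ∧ j < i then (-1 : K) ^ ((x i.succ).1 * (x j.succ).1)
                else 1) := fun i => by split_ifs <;> simp
        have h2 := degSum_sub S fun i => x i.succ
        rw [ofFn_sub] at h2
        rw [Finset.prod_congr rfl fun i _ => e i, Finset.prod_mul_distrib, mul_comm, h2,
          ← Finset.prod_filter, Finset.filter_mem_eq_inter, Finset.univ_inter, prod_neg_one_zpow,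
          ← Finset.sum_mul, mul_comm (x 0).1]
      · simp only [hfil]
        simp [Function.comp_def]

/-- The value of a family of multilinear maps on a list. -/
def ev (f : Cochain K L Q) (l : List (ℤ × L)) : Q := f l.length fun i => (l.get i).2

theorem ev_ofFn (f : Cochain K L Q) {m : ℕ} (n : Fin m → ℤ) (ξ : Fin m → L) :
    ev f (List.ofFn fun i => (n i, ξ i)) = f m ξ := by
  have : ∀ (k : ℕ) (h : k = m), f k (fun i => ξ (Fin.cast h i)) = f m ξ := by
    rintro k rfl; rfl
  rw [← this _ (List.length_ofFn (f := fun i => (n i, ξ i))), ev]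
  congr 1
  funext i
  simp [Fin.cast]

theorem homog_ofFn {ℒ : ℤ → Submodule K L} {m : ℕ} {n : Fin m → ℤ} {ξ : Fin m → L} :
    Homog ℒ (List.ofFn fun i => (n i, ξ i)) ↔ ∀ i, ξ i ∈ ℒ (n i) := by
  simp [Homog, List.mem_ofFn]

/-- Two families of multilinear maps agree if they agree on lists of homogeneous elements. -/
theorem ext_ev (ℒ : ℤ → Submodule K L) [DirectSum.Decomposition ℒ] {f g : Cochain K L Q}
    (h : ∀ l, Homog ℒ l → ev f l = ev g l) : f = g := by
  funext m
  refine ext_homogeneous ℒ fun n ξ hξ => ?_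
  rw [← ev_ofFn f n, ← ev_ofFn g n]
  exact h _ (homog_ofFn.2 hξ)

theorem ev_add (f g : Cochain K L Q) (l : List (ℤ × L)) : ev (f + g) l = ev f l + ev g l := rfl

theorem ev_sub (f g : Cochain K L Q) (l : List (ℤ × L)) : ev (f - g) l = ev f l - ev g l := rfl

theorem ev_smul (c : K) (f : Cochain K L Q) (l : List (ℤ × L)) : ev (c • f) l = c • ev f l := rfl

theorem ev_zero (l : List (ℤ × L)) : ev (0 : Cochain K L Q) l = 0 := rfl

theorem ev_sum {ι : Type*} (I : Finset ι) (f : ι → Cochain K L Q) (l : List (ℤ × L)) :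
    ev (∑ i ∈ I, f i) l = ∑ i ∈ I, ev (f i) l := by
  classical
  induction I using Finset.induction_on with
  | empty => simp [ev_zero]
  | insert a I ha ih => simp only [Finset.sum_insert ha, ev_add, ih]

/-- `x ↦ f (x, l)` as a linear map. -/
def evHead (f : Cochain K L Q) (l : List (ℤ × L)) : L →ₗ[K] Q where
  toFun x := f (l.length + 1) (Fin.cons x fun i => (l.get i).2)
  map_add' x y := by simp [MultilinearMap.cons_add]
  map_smul' c x := by simp [MultilinearMap.cons_smul]

/-- The label `n` is arbitrary because `ev` ignores degrees; later it is chosen so that the extended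
list is homogeneous. -/
theorem evHead_apply (f : Cochain K L Q) (l : List (ℤ × L)) (n : ℤ) (x : L) :
    evHead f l x = ev f ((n, x) :: l) := by
  simp only [evHead, ev, LinearMap.coe_mk, AddHom.coe_mk, List.length_cons]
  congr 1
  funext i
  refine Fin.cases ?_ (fun i => ?_) i <;> simp

theorem ev_cons (f : Cochain K L Q) (l : List (ℤ × L)) (h : ℤ × L) :
    ev f (h :: l) = evHead f l h.2 := (evHead_apply f l h.1 h.2).symm

/-- The condition `DegreeMaps` in terms of lists. -/
theorem ev_mem_of_degreeMaps {ℒ : ℤ → Submodule K L} {𝒬 : ℤ → Submodule K Q} {d : ℤ}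
    {f : Cochain K L Q} (hf : ∀ k, f k ∈ degreeMaps ℒ 𝒬 d k) {l : List (ℤ × L)}
    (hl : Homog ℒ l) : ev f l ∈ 𝒬 (d + degSum l) := by
  have := hf l.length (fun i => (l.get i).1) (fun i => (l.get i).2) fun i => hl _ (l.get_mem i)
  rw [← List.sum_ofFn] at this
  rwa [show List.ofFn (fun i => (l.get i).1) = l.map Prod.fst by
    rw [← List.ofFn_get l, List.map_ofFn]; simp [Function.comp_def]] at this

theorem degreeMaps_of_ev_mem {ℒ : ℤ → Submodule K L} {𝒬 : ℤ → Submodule K Q} {d : ℤ}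
    {f : Cochain K L Q} (h : ∀ l, Homog ℒ l → ev f l ∈ 𝒬 (d + degSum l)) (k : ℕ) :
    f k ∈ degreeMaps ℒ 𝒬 d k := by
  intro n ξ hξ
  have := h _ (homog_ofFn.2 hξ)
  rwa [ev_ofFn, degSum, List.map_ofFn, List.sum_ofFn] at this

variable (ℒ : ℤ → Submodule K L) [DirectSum.Decomposition ℒ]

/-- Together with `ev_gerst` this replaces sums over subsets by recursive sums over lists, in which
cocommutativity and coassociativity are available. -/
theorem ev_cup (B : ℤ → ℤ → M →ₗ[K] N →ₗ[K] Q) (e : ℤ) (f : Cochain K L M) (g : Cochain K L N)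
    {l : List (ℤ × L)} (hl : Homog ℒ l) :
    ev (cup ℒ B e f g) l = unshuffleSum K l fun s t =>
      (-1 : K) ^ (e * degSum s) • B (degSum s) (degSum t) (ev f s) (ev g t) := by
  obtain ⟨m, x, rfl⟩ : ∃ (m : ℕ) (x : Fin m → ℤ × L), l = List.ofFn x :=
    ⟨_, l.get, (List.ofFn_get l).symm⟩
  have hx : ∀ i, (x i).2 ∈ ℒ (x i).1 := fun i => hl _ (List.mem_ofFn.2 ⟨i, rfl⟩)
  rw [← sum_unshuffleSign]
  refine (ev_ofFn _ (fun i => (x i).1) (fun i => (x i).2)).trans ?_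
  rw [cup_apply ℒ _ _ _ _ _ _ hx]
  refine Finset.sum_congr rfl fun S _ => ?_
  rw [mul_smul, degSum_sub, degSum_sub]
  rw [← ev_ofFn f (sub S fun i => (x i).1) (sub S fun i => (x i).2),
    ← ev_ofFn g (sub Sᶜ fun i => (x i).1) (sub Sᶜ fun i => (x i).2)]
  rfl

theorem ev_gerst (f : Cochain K L Q) (X : Cochain K L L) {l : List (ℤ × L)} (hl : Homog ℒ l) :
    ev (gerst ℒ f X) l = unshuffleSum K l fun s t => evHead f t (ev X s) := by
  obtain ⟨m, x, rfl⟩ : ∃ (m : ℕ) (x : Fin m → ℤ × L), l = List.ofFn x :=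
    ⟨_, l.get, (List.ofFn_get l).symm⟩
  have hx : ∀ i, (x i).2 ∈ ℒ (x i).1 := fun i => hl _ (List.mem_ofFn.2 ⟨i, rfl⟩)
  rw [← sum_unshuffleSign]
  refine (ev_ofFn _ (fun i => (x i).1) (fun i => (x i).2)).trans ?_
  rw [gerst_apply ℒ _ _ _ _ hx]
  refine Finset.sum_congr rfl fun S _ => ?_
  congr 1
  rw [show ev X (List.ofFn (sub S x)) = X S.card (sub S fun i => (x i).2) from
    ev_ofFn X (sub S fun i => (x i).1) (sub S fun i => (x i).2), evHead_apply _ _ 0]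
  have := ev_ofFn f (Fin.cons 0 (sub Sᶜ fun i => (x i).1))
    (Fin.cons (X S.card (sub S fun i => (x i).2)) (sub Sᶜ fun i => (x i).2))
  rw [← this, List.ofFn_succ]
  rfl

end Eval

/-! ### Graded symmetry on lists, and symmetry and finiteness of compositions. -/

section Symm

variable {K L M N Q : Type*} [Field K] [AddCommGroup L] [Module K L] [AddCommGroup M] [Module K M]
  [AddCommGroup N] [Module K N] [AddCommGroup Q] [Module K Q]

theorem linearMap_ext_homogeneous (ℒ : ℤ → Submodule K L) [DirectSum.Decomposition ℒ]
    {φ ψ : L →ₗ[K] Q} (h : ∀ n, ∀ x ∈ ℒ n, φ x = ψ x) : φ = ψ := by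
  ext x
  refine DirectSum.Decomposition.inductionOn ℒ (by simp) (fun y => h _ _ y.2) ?_ x
  intro a b ha hb
  rw [map_add, map_add, ha, hb]

/-- The entries in question sit at the neighbouring positions `p.length` and `p.length + 1`; the
rest identifies the transposed list entry by entry. -/
theorem ev_swap {ℒ : ℤ → Submodule K L} {f : Cochain K L Q} (hf : ∀ k, f k ∈ gradedSymmetric ℒ k)
    {p q : List (ℤ × L)} {a b : ℤ × L} (hl : Homog ℒ (p ++ a :: b :: q)) :
    ev f (p ++ b :: a :: q) = (-1 : K) ^ (a.1 * b.1) • ev f (p ++ a :: b :: q) := by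
  set l := p ++ a :: b :: q with hl'
  have hlen : l.length = p.length + (q.length + 2) := by simp [hl']
  let i : Fin l.length := ⟨p.length, by omega⟩
  let j : Fin l.length := ⟨p.length + 1, by omega⟩
  have hi : l.get i = a := by simp [i, hl']
  have hj : l.get j = b := by simp [j, hl', List.getElem_append_right]
  have e := hf l.length (fun k => (l.get k).1) (fun k => (l.get k).2)
    (fun k => hl _ (l.get_mem k)) i j rfl
  beta_reduce at e
  rw [hi, hj] at e
  rw [show ev f l = f l.length (fun k => (l.get k).2) from rfl, ← e]
  refine Eq.trans ?_ (ev_ofFn f (fun k => (l.get (Equiv.swap i j k)).1)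
    ((fun k => (l.get k).2) ∘ Equiv.swap i j))
  congr 1
  apply List.ext_getElem
  · simp [hlen, add_assoc]
  intro n h1 h2
  simp only [List.getElem_ofFn, Function.comp_apply, Prod.mk.eta]
  rcases lt_trichotomy n p.length with h | h | h
  · rw [Equiv.swap_apply_of_ne_of_ne, List.getElem_append_left h]
    · simp [hl', List.getElem_append_left h]
    · simp [i, h.ne]
    · simp only [j, ne_eq, Fin.mk.injEq]; omega
  · subst h
    rw [show (⟨p.length, by omega⟩ : Fin l.length) = i from rfl, Equiv.swap_apply_left, hj]
    simp
  · obtain ⟨k, rfl⟩ := Nat.exists_eq_add_of_lt h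
    rcases k with _ | k
    · rw [show (⟨p.length + 0 + 1, by omega⟩ : Fin l.length) = j from rfl,
        Equiv.swap_apply_right, hi]
      simp [List.getElem_append_right]
    · rw [Equiv.swap_apply_of_ne_of_ne]
      · simp [hl', List.getElem_append_right, add_assoc]
      · simp only [i, ne_eq, Fin.mk.injEq]; omega
      · simp only [j, ne_eq, Fin.mk.injEq]; omega

/-- Each entry of `p` that `h` passes contributes one neighbour swap. The induction removes entries
from the end of `p`, the ones adjacent to `h`. -/
theorem ev_move {ℒ : ℤ → Submodule K L} {f : Cochain K L Q} (hf : ∀ k, f k ∈ gradedSymmetric ℒ k)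
    {p q : List (ℤ × L)} {h : ℤ × L} (hl : Homog ℒ (h :: (p ++ q))) :
    ev f (p ++ h :: q) = (-1 : K) ^ (h.1 * degSum p) • ev f (h :: (p ++ q)) := by
  induction p using List.reverseRecOn generalizing q with
  | nil => simp
  | append_singleton p c ih =>
    simp only [List.append_assoc, List.cons_append, List.nil_append] at hl ⊢
    have hl' : Homog ℒ (p ++ h :: c :: q) := by
      simp only [homog_cons, homog_append] at hl ⊢; tauto
    rw [ev_swap hf hl', ih hl, smul_smul, neg_one_zpow_mul]
    congr 2
    simp; ring

theorem ev_swap_head {ℒ : ℤ → Submodule K L} {f : Cochain K L Q}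
    (hf : ∀ k, f k ∈ gradedSymmetric ℒ k) {q : List (ℤ × L)} {a b : ℤ × L}
    (ha : a.2 ∈ ℒ a.1) (hb : b.2 ∈ ℒ b.1) (hq : Homog ℒ q) :
    ev f (b :: a :: q) = (-1 : K) ^ (a.1 * b.1) • ev f (a :: b :: q) :=
  ev_swap hf (p := []) (by simp [ha, hb, hq])

/-- Interchange of the arguments of a family of multilinear maps with values in linear maps. -/
def flipMulti {k : ℕ} (T : N →ₗ[K] MultilinearMap K (fun _ : Fin k => L) Q) :
    MultilinearMap K (fun _ : Fin k => L) (N →ₗ[K] Q) where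
  toFun ξ :=
    { toFun := fun x => T x ξ
      map_add' := fun x y => by simp
      map_smul' := fun c x => by simp }
  map_update_add' ξ i x y := by ext; simp
  map_update_smul' ξ i c x := by ext; simp

@[simp] theorem flipMulti_apply {k : ℕ} (T : N →ₗ[K] MultilinearMap K (fun _ : Fin k => L) Q)
    (ξ : Fin k → L) (x : N) : flipMulti T ξ x = T x ξ := rfl

/-- The family `f` with its first argument split off. -/
def headCochain (f : Cochain K L Q) : Cochain K L (L →ₗ[K] Q) :=
  fun k => flipMulti (f (k + 1)).curryLeft

variable (ℒ : ℤ → Submodule K L) [DirectSum.Decomposition ℒ]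

/-- A composition is a product of `X` with the family of maps `x ↦ f (x, …)` along evaluation, so
symmetry, finiteness and additivity in `X` are inherited from `cup`. The exponent `0` reflects that
the composition carries no sign besides the Koszul sign. -/
theorem gerst_eq_cup (f : Cochain K L Q) (X : Cochain K L L) :
    gerst ℒ f X = cup ℒ (fun _ _ => LinearMap.id.flip) 0 X (headCochain f) := by
  funext m
  refine ext_homogeneous ℒ fun n ξ h => ?_
  rw [gerst_apply ℒ _ _ n ξ h, cup_apply ℒ _ _ _ _ n ξ h]
  simp [headCochain]

theorem headCochain_gradedSymmetric {f : Cochain K L Q} (hf : ∀ k, f k ∈ gradedSymmetric ℒ k)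
    (k : ℕ) : headCochain f k ∈ gradedSymmetric ℒ k := by
  intro n ξ h i j hij
  refine linearMap_ext_homogeneous ℒ fun m x hx => ?_
  have := hf (k + 1) (Fin.cons m n) (Fin.cons x ξ) (fun a => Fin.cases hx h a) i.succ j.succ
    (by simp [hij])
  simp only [Fin.cons_succ] at this
  simp only [headCochain, flipMulti_apply, MultilinearMap.curryLeft_apply, LinearMap.smul_apply,
    ← this]
  congr 1
  funext a
  refine Fin.cases ?_ (fun a => ?_) a
  · simp [Equiv.swap_apply_of_ne_of_ne (Fin.succ_ne_zero i).symm (Fin.succ_ne_zero j).symm]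
  · simp only [Fin.cons_succ, Function.comp_apply]
    rw [← (Fin.succ_injective k).map_swap]
    simp

theorem gerst_gradedSymmetric {f : Cochain K L Q} {X : Cochain K L L}
    (hf : ∀ k, f k ∈ gradedSymmetric ℒ k) (hX : ∀ k, X k ∈ gradedSymmetric ℒ k) (m : ℕ) :
    gerst ℒ f X m ∈ gradedSymmetric ℒ m := by
  rw [gerst_eq_cup]
  exact cup_gradedSymmetric ℒ _ _ _ _ hX (headCochain_gradedSymmetric ℒ hf) m

theorem headCochain_finite {f : Cochain K L Q} (hf : f ∈ finiteCochains K L Q) :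
    headCochain f ∈ finiteCochains K L (L →ₗ[K] Q) := by
  obtain ⟨N, hN⟩ := hf
  refine ⟨N, fun k hk => ?_⟩
  ext ξ x
  simp [headCochain, hN (k + 1) (by omega)]

theorem gerst_finite {f : Cochain K L Q} {X : Cochain K L L}
    (hf : f ∈ finiteCochains K L Q) (hX : X ∈ finiteCochains K L L) :
    gerst ℒ f X ∈ finiteCochains K L Q := by
  rw [gerst_eq_cup]
  exact cup_finite ℒ _ _ _ _ hX (headCochain_finite hf)

variable {ℒ}

theorem gradedSymmetric_weight_zero {f : MultilinearMap K (fun _ : Fin 0 => L) Q} :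
    f ∈ gradedSymmetric ℒ 0 := fun _ _ _ i => i.elim0

end Symm

/-! ### Identities between products and compositions -/

section Identities

variable {K L M N Q R E : Type*} [Field K] [AddCommGroup L] [Module K L] [AddCommGroup M]
  [Module K M] [AddCommGroup N] [Module K N] [AddCommGroup Q] [Module K Q] [AddCommGroup R]
  [Module K R] [AddCommGroup E] [Module K E]
  (ℒ : ℤ → Submodule K L) [DirectSum.Decomposition ℒ]

section Linear

variable (B : ℤ → ℤ → M →ₗ[K] N →ₗ[K] Q) (e : ℤ) (c : K)

theorem cup_add_left (f f' : Cochain K L M) (g : Cochain K L N) :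
    cup ℒ B e (f + f') g = cup ℒ B e f g + cup ℒ B e f' g :=
  ext_ev ℒ fun l hl => by
    simp only [ev_cup _ _ _ _ _ hl, ev_add, map_add, LinearMap.add_apply, smul_add,
      unshuffleSum_add]

theorem cup_add_right (f : Cochain K L M) (g g' : Cochain K L N) :
    cup ℒ B e f (g + g') = cup ℒ B e f g + cup ℒ B e f g' :=
  ext_ev ℒ fun l hl => by
    simp only [ev_cup _ _ _ _ _ hl, ev_add, map_add, smul_add, unshuffleSum_add]

theorem cup_smul_left (f : Cochain K L M) (g : Cochain K L N) :
    cup ℒ B e (c • f) g = c • cup ℒ B e f g :=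
  ext_ev ℒ fun l hl => by
    simp only [ev_cup _ _ _ _ _ hl, ev_smul, map_smul, LinearMap.smul_apply, smul_comm _ c,
      unshuffleSum_smul]

theorem cup_smul_right (f : Cochain K L M) (g : Cochain K L N) :
    cup ℒ B e f (c • g) = c • cup ℒ B e f g :=
  ext_ev ℒ fun l hl => by
    simp only [ev_cup _ _ _ _ _ hl, ev_smul, map_smul, smul_comm _ c, unshuffleSum_smul]

theorem cup_sub_left (f f' : Cochain K L M) (g : Cochain K L N) :
    cup ℒ B e (f - f') g = cup ℒ B e f g - cup ℒ B e f' g := by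
  rw [sub_eq_add_neg, ← neg_one_smul K f', cup_add_left, cup_smul_left, neg_one_smul,
    sub_eq_add_neg]

theorem cup_sub_right (f : Cochain K L M) (g g' : Cochain K L N) :
    cup ℒ B e f (g - g') = cup ℒ B e f g - cup ℒ B e f g' := by
  rw [sub_eq_add_neg, ← neg_one_smul K g', cup_add_right, cup_smul_right, neg_one_smul,
    sub_eq_add_neg]

theorem gerst_add_left (f f' : Cochain K L Q) (X : Cochain K L L) :
    gerst ℒ (f + f') X = gerst ℒ f X + gerst ℒ f' X :=
  ext_ev ℒ fun l hl => by
    simp only [ev_add, ev_gerst _ _ _ hl, ← unshuffleSum_add]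
    rfl

theorem gerst_smul_left (f : Cochain K L Q) (X : Cochain K L L) :
    gerst ℒ (c • f) X = c • gerst ℒ f X :=
  ext_ev ℒ fun l hl => by
    simp only [ev_smul, ev_gerst _ _ _ hl, ← unshuffleSum_smul]
    rfl

theorem gerst_add_right (f : Cochain K L Q) (X X' : Cochain K L L) :
    gerst ℒ f (X + X') = gerst ℒ f X + gerst ℒ f X' := by
  simp only [gerst_eq_cup, cup_add_left]

theorem gerst_smul_right (f : Cochain K L Q) (X : Cochain K L L) :
    gerst ℒ f (c • X) = c • gerst ℒ f X := by
  simp only [gerst_eq_cup, cup_smul_left]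

theorem gerst_sub_left (f f' : Cochain K L Q) (X : Cochain K L L) :
    gerst ℒ (f - f') X = gerst ℒ f X - gerst ℒ f' X := by
  rw [sub_eq_add_neg, ← neg_one_smul K f', gerst_add_left, gerst_smul_left, neg_one_smul,
    sub_eq_add_neg]

theorem gerst_sub_right (f : Cochain K L Q) (X X' : Cochain K L L) :
    gerst ℒ f (X - X') = gerst ℒ f X - gerst ℒ f X' := by
  simp only [gerst_eq_cup, cup_sub_left]

end Linear

/-- Products along bilinear maps that commute with each other are associative. -/
theorem cup_assoc (B₁ : M →ₗ[K] Q →ₗ[K] R) (B₂ : N →ₗ[K] E →ₗ[K] Q)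
    {O : Type*} [AddCommGroup O] [Module K O] (B₃ : O →ₗ[K] E →ₗ[K] R) (B₄ : M →ₗ[K] N →ₗ[K] O)
    (hB : ∀ x y z, B₁ x (B₂ y z) = B₃ (B₄ x y) z) (e e' : ℤ)
    (f : Cochain K L M) (g : Cochain K L N) (h : Cochain K L E) :
    cup ℒ (fun _ _ => B₁) (e + e') f (cup ℒ (fun _ _ => B₂) e g h) =
      cup ℒ (fun _ _ => B₃) e (cup ℒ (fun _ _ => B₄) e' f g) h := by
  refine ext_ev ℒ fun l hl => ?_
  rw [ev_cup _ _ _ _ _ hl, ev_cup _ _ _ _ _ hl]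
  have h1 : ∀ s t : List (ℤ × L), (s ++ t).Perm l →
      (-1 : K) ^ (e * degSum s) • B₃ (ev (cup ℒ (fun _ _ => B₄) e' f g) s) (ev h t) =
      unshuffleSum K s fun u v => (-1 : K) ^ (e * degSum u + e * degSum v + e' * degSum u) •
        B₃ (B₄ (ev f u) (ev g v)) (ev h t) := fun s t hst => by
    have hs := (homog_append.1 (hl.perm hst)).1
    rw [ev_cup _ _ _ _ _ hs, ← LinearMap.flip_apply, unshuffleSum_map, ← unshuffleSum_smul]
    refine unshuffleSum_congr fun u v huv => ?_
    rw [map_smul, smul_smul, neg_one_zpow_mul, LinearMap.flip_apply, ← degSum_perm huv,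
      degSum_append]
    congr 2
    ring
  rw [unshuffleSum_congr h1, unshuffleSum_assoc]
  refine unshuffleSum_congr fun s t hst => ?_
  have ht := (homog_append.1 (hl.perm hst)).2
  rw [ev_cup _ _ _ _ _ ht, unshuffleSum_map, ← unshuffleSum_smul]
  refine unshuffleSum_congr fun u v huv => ?_
  rw [map_smul, smul_smul, neg_one_zpow_mul, hB]
  congr 2
  ring

/-- Composition with `X` is a derivation of products. -/
theorem cup_gerst (B : M →ₗ[K] N →ₗ[K] Q) {d : ℤ} (e : ℤ) (f : Cochain K L M) (g : Cochain K L N)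
    {X : Cochain K L L} (hX : ∀ k, X k ∈ degreeMaps ℒ ℒ d k) :
    gerst ℒ (cup ℒ (fun _ _ => B) e f g) X =
      (-1 : K) ^ (d * e) • cup ℒ (fun _ _ => B) e (gerst ℒ f X) g +
        cup ℒ (fun _ _ => B) (e + d) f (gerst ℒ g X) := by
  refine ext_ev ℒ fun l hl => ?_
  rw [ev_gerst _ _ _ hl, ev_add, ev_smul, ev_cup _ _ _ _ _ hl, ev_cup _ _ _ _ _ hl]
  -- The value of `X` is the head of the list that the product is evaluated on, so it becomes an
  -- argument either of `f` or of `g`.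
  have h1 : ∀ s t : List (ℤ × L), (s ++ t).Perm l →
      evHead (cup ℒ (fun _ _ => B) e f g) t (ev X s) =
      (unshuffleSum K t fun u v => (-1 : K) ^ (e * (d + degSum s + degSum u)) •
        B (evHead f u (ev X s)) (ev g v)) +
      unshuffleSum K t fun u v => (-1 : K) ^ ((d + degSum s) * degSum u + e * degSum u) •
        B (ev f u) (evHead g v (ev X s)) := fun s t hst => by
    obtain ⟨hs, ht⟩ := homog_append.1 (hl.perm hst)
    have hXs := ev_mem_of_degreeMaps hX hs
    rw [evHead_apply _ _ (d + degSum s), ev_cup _ _ _ _ _ (homog_cons.2 ⟨hXs, ht⟩),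
      unshuffleSum_cons]
    simp only [degSum_cons, smul_smul, neg_one_zpow_mul, ← evHead_apply]
  rw [unshuffleSum_congr h1, unshuffleSum_add]
  congr 1
  · rw [← unshuffleSum_assoc, ← unshuffleSum_smul]
    refine unshuffleSum_congr fun w t hst => ?_
    rw [ev_gerst _ _ _ (homog_append.1 (hl.perm hst)).1, ← LinearMap.flip_apply, unshuffleSum_map,
      ← unshuffleSum_smul, ← unshuffleSum_smul]
    refine unshuffleSum_congr fun u v huv => ?_
    rw [LinearMap.flip_apply, smul_smul, neg_one_zpow_mul, ← degSum_perm huv, degSum_append]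
    congr 2
    ring
  -- Here the arguments of `f` must be brought in front of those of `X`, so that `X` and `g` group
  -- together.
  · rw [unshuffleSum_left_comm]
    refine unshuffleSum_congr fun w t hst => ?_
    rw [ev_gerst _ _ _ (homog_append.1 (hl.perm hst)).2, unshuffleSum_map,
      ← unshuffleSum_smul]
    refine unshuffleSum_congr fun u v huv => ?_
    rw [smul_smul, neg_one_zpow_mul]
    congr 1
    exact neg_one_zpow_congr (by grind)

/-- The value of `Y` is either an argument of the inner `X`, which yields `f ∘ (X ∘ Y)`, or it
stands next to the value of `X` among the arguments of `f`. The latter terms are symmetric in `X`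
and `Y` up to sign when `f` is. The integer `d` occurs only in a degree label. -/
theorem ev_gerst_gerst (d : ℤ) {d' : ℤ} (f : Cochain K L Q) (X : Cochain K L L)
    {Y : Cochain K L L} (hY : ∀ k, Y k ∈ degreeMaps ℒ ℒ d' k)
    {l : List (ℤ × L)} (hl : Homog ℒ l) :
    ev (gerst ℒ (gerst ℒ f X) Y) l = ev (gerst ℒ f (gerst ℒ X Y)) l +
      unshuffleSum K l fun s w => unshuffleSum K w fun u v =>
        (-1 : K) ^ ((d' + degSum s) * degSum u) •
          ev f ((d + degSum u, ev X u) :: (d' + degSum s, ev Y s) :: v) := by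
  rw [ev_gerst _ _ _ hl, ev_gerst _ _ _ hl]
  have h1 : ∀ s t : List (ℤ × L), (s ++ t).Perm l →
      evHead (gerst ℒ f X) t (ev Y s) =
      (unshuffleSum K t fun u v => evHead f v (evHead X u (ev Y s))) +
      unshuffleSum K t fun u v => (-1 : K) ^ ((d' + degSum s) * degSum u) •
          ev f ((d + degSum u, ev X u) :: (d' + degSum s, ev Y s) :: v) := fun s t hst => by
    obtain ⟨hs, ht⟩ := homog_append.1 (hl.perm hst)
    have hXs := ev_mem_of_degreeMaps hY hs
    rw [evHead_apply _ _ (d' + degSum s), ev_gerst _ _ _ (homog_cons.2 ⟨hXs, ht⟩),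
      unshuffleSum_cons]
    congr 1
    · simp only [← evHead_apply]
    · refine unshuffleSum_congr fun u v huv => ?_
      rw [evHead_apply _ _ (d + degSum u)]
  rw [unshuffleSum_congr h1, unshuffleSum_add]
  congr 1
  rw [← unshuffleSum_assoc]
  refine unshuffleSum_congr fun w t hst => ?_
  rw [ev_gerst _ _ _ (homog_append.1 (hl.perm hst)).1, unshuffleSum_map]

/-- The graded right pre-Lie identity. -/
theorem gerst_gerst {d d' : ℤ} {f : Cochain K L Q} (hf : ∀ k, f k ∈ gradedSymmetric ℒ k)
    {X Y : Cochain K L L}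
    (hX : ∀ k, X k ∈ degreeMaps ℒ ℒ d k) (hY : ∀ k, Y k ∈ degreeMaps ℒ ℒ d' k) :
    gerst ℒ (gerst ℒ f X) Y - (-1 : K) ^ (d * d') • gerst ℒ (gerst ℒ f Y) X =
      gerst ℒ f (gerst ℒ X Y - (-1 : K) ^ (d * d') • gerst ℒ Y X) := by
  refine ext_ev ℒ fun l hl => ?_
  rw [gerst_sub_right, gerst_smul_right, ev_sub, ev_sub, ev_smul, ev_smul,
    ev_gerst_gerst ℒ d f X hY hl, ev_gerst_gerst ℒ d' f Y hX hl, smul_add, add_sub_add_comm,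
    add_eq_left, sub_eq_zero, unshuffleSum_left_comm, ← unshuffleSum_smul]
  refine unshuffleSum_congr fun s w hsw => ?_
  obtain ⟨hs, hw⟩ := homog_append.1 (hl.perm hsw)
  rw [← unshuffleSum_smul]
  refine unshuffleSum_congr fun u v huv => ?_
  obtain ⟨hu, hv⟩ := homog_append.1 (hw.perm huv)
  -- What is left are the terms with both values as arguments of `f`; they match after exchanging
  -- these two arguments.
  rw [ev_swap_head (a := (d' + degSum u, ev Y u)) (b := (d + degSum s, ev X s)) hf
    (ev_mem_of_degreeMaps hY hu) (ev_mem_of_degreeMaps hX hs) hv]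
  simp only [smul_smul, neg_one_zpow_mul]
  congr 1
  exact neg_one_zpow_congr (by grind)

end Identities

/-! ### The operators `Ω ↦ φ ∪ Ω ∓ Ω ∘ X` and their commutators. -/

section Operators

variable {K A L P M E : Type*} [Field K] [Ring A] [Algebra K A]
  [AddCommGroup L] [Module K L] (ℒ : ℤ → Submodule K L) [DirectSum.Decomposition ℒ]
  [AddCommGroup P] [Module K P] [Module A P] [IsScalarTower K A P]
  [AddCommGroup M] [Module K M] [AddCommGroup E] [Module K E]

/-- The Leibniz rule `h` for values gives two threefold sums. In the first, `φ` and `ω` are already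
adjacent and regroup by coassociativity; in the second, the arguments of `φ` and `ω` must be
interchanged, whence the sign `(-1) ^ (d * e)`. -/
theorem cup_mulCochain {φ : Cochain K L (Module.End K P)} {σ : Cochain K L (Module.End K A)}
    {ω : Cochain K L A} {Ω : Cochain K L P} {d e : ℤ} (e' : ℤ)
    (h : ∀ s t, Homog ℒ s → Homog ℒ t → ∀ p, ev φ s (ev ω t • p) = ev σ s (ev ω t) • p +
      (-1 : K) ^ ((d + degSum s) * (e + degSum t)) • ev ω t • ev φ s p) :
    cup ℒ (fun _ _ => LinearMap.id) (e + e') φ (mulCochain ℒ e' ω Ω) =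
      mulCochain ℒ e' (cup ℒ (fun _ _ => LinearMap.id) e σ ω) Ω +
        (-1 : K) ^ (d * e) •
          mulCochain ℒ (e' + d) ω (cup ℒ (fun _ _ => LinearMap.id) e' φ Ω) := by
  refine ext_ev ℒ fun l hl => ?_
  simp only [mulCochain]
  rw [ev_add, ev_smul, ev_cup _ _ _ _ _ hl, ev_cup _ _ _ _ _ hl, ev_cup _ _ _ _ _ hl]
  have h1 : ∀ s w : List (ℤ × L), (s ++ w).Perm l →
      (-1 : K) ^ ((e + e') * degSum s) • (ev φ s)
        (ev (cup ℒ (fun _ _ => (Algebra.lsmul K K P).toLinearMap) e' ω Ω) w) =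
      (unshuffleSum K w fun t u => (-1 : K) ^ ((e + e') * degSum s + e' * degSum t) •
        ev σ s (ev ω t) • ev Ω u) +
      unshuffleSum K w fun t u => (-1 : K) ^ ((e + e') * degSum s + e' * degSum t +
        (d + degSum s) * (e + degSum t)) • ev ω t • ev φ s (ev Ω u) := fun s w hsw => by
    obtain ⟨hs, hw⟩ := homog_append.1 (hl.perm hsw)
    rw [ev_cup _ _ _ _ _ hw, unshuffleSum_map, ← unshuffleSum_smul, ← unshuffleSum_add]
    refine unshuffleSum_congr fun t u htu => ?_
    have ht := (homog_append.1 (hw.perm htu)).1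
    rw [map_smul, smul_smul, neg_one_zpow_mul]
    change _ • ev φ s (ev ω t • ev Ω u) = _
    rw [h s t hs ht, smul_add, smul_smul _ _ (ev ω t • _), neg_one_zpow_mul]
  change unshuffleSum K l (fun s w => (-1 : K) ^ ((e + e') * degSum s) • (ev φ s)
        (ev (cup ℒ (fun _ _ => (Algebra.lsmul K K P).toLinearMap) e' ω Ω) w)) = _
  rw [unshuffleSum_congr h1, unshuffleSum_add]
  congr 1
  · rw [← unshuffleSum_assoc]
    refine unshuffleSum_congr fun w u hwu => ?_
    rw [ev_cup _ _ _ _ _ (homog_append.1 (hl.perm hwu)).1, ← LinearMap.flip_apply,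
      unshuffleSum_map, ← unshuffleSum_smul]
    refine unshuffleSum_congr fun s t hst => ?_
    rw [map_smul, smul_smul, neg_one_zpow_mul, ← degSum_perm hst, degSum_append]
    change _ = _ • ev σ s (ev ω t) • ev Ω u
    congr 2
    ring
  · rw [unshuffleSum_left_comm, ← unshuffleSum_smul]
    refine unshuffleSum_congr fun t w htw => ?_
    rw [ev_cup _ _ _ _ _ (homog_append.1 (hl.perm htw)).2, unshuffleSum_map,
      ← unshuffleSum_smul, ← unshuffleSum_smul]
    refine unshuffleSum_congr fun s u hsu => ?_
    rw [map_smul]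
    simp only [smul_smul, neg_one_zpow_mul]
    change _ = _ • ev ω t • ev φ s (ev Ω u)
    congr 1
    exact neg_one_zpow_congr (by grind)

/-- The operator `Ω ↦ φ ∪ Ω - (-1)^{d e} Ω ∘ X`, where the product is taken along a bilinear map
`B` and `Ω` has degree `e`. -/
def ceOp (B : E →ₗ[K] M →ₗ[K] M) (d e : ℤ) (X : Cochain K L L) (φ : Cochain K L E)
    (Ω : Cochain K L M) : Cochain K L M :=
  cup ℒ (fun _ _ => B) e φ Ω - (-1 : K) ^ (d * e) • gerst ℒ Ω X

theorem chevalleyEilenberg_eq (d e : ℤ) (X : Cochain K L L) (φ : Cochain K L (Module.End K P)) :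
    chevalleyEilenberg ℒ d e X φ = ceOp ℒ (M := P) LinearMap.id d e X φ := rfl

/-- Both summands of the operator obey the Leibniz rule separately: `cup_mulCochain` covers the one
with `φ`, `cup_gerst` the one with `X`. -/
theorem chevalleyEilenberg_mulCochain {X : Cochain K L L} {φ : Cochain K L (Module.End K P)}
    {σ : Cochain K L (Module.End K A)} {ω : Cochain K L A} {Ω : Cochain K L P} {d e : ℤ} (e' : ℤ)
    (hX : ∀ k, X k ∈ degreeMaps ℒ ℒ d k)
    (h : ∀ s t, Homog ℒ s → Homog ℒ t → ∀ p, ev φ s (ev ω t • p) = ev σ s (ev ω t) • p +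
      (-1 : K) ^ ((d + degSum s) * (e + degSum t)) • ev ω t • ev φ s p) :
    chevalleyEilenberg ℒ d (e + e') X φ (mulCochain ℒ e' ω Ω) =
      mulCochain ℒ e' (chevalleyEilenberg ℒ d e X σ ω) Ω +
        (-1 : K) ^ (d * e) • mulCochain ℒ (e' + d) ω (chevalleyEilenberg ℒ d e' X φ Ω) := by
  rw [chevalleyEilenberg, cup_mulCochain ℒ e' h]
  simp only [chevalleyEilenberg, mulCochain, cup_gerst ℒ _ _ _ _ hX, cup_sub_left, cup_sub_right,
    cup_smul_left, cup_smul_right, smul_add, smul_sub, smul_smul, neg_one_zpow_mul]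
  rw [neg_one_zpow_congr (x := d * (e + e') + d * e') (y := d * e) (by grind),
    neg_one_zpow_congr (x := d * (e + e')) (y := d * e + d * e') (by grind)]
  abel

/-- By graded cocommutativity, the second halves of the pointwise commutators add up to the product
in the opposite order. -/
theorem cupCommutator_eq (d d' : ℤ) (φ ψ : Cochain K L (Module.End K P)) :
    cupCommutator ℒ d d' φ ψ = cup ℒ (fun _ _ => LinearMap.mul K (Module.End K P)) d' φ ψ -
      (-1 : K) ^ (d * d') • cup ℒ (fun _ _ => LinearMap.mul K (Module.End K P)) d ψ φ := by
  refine ext_ev ℒ fun l hl => ?_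
  rw [cupCommutator, ev_sub, ev_smul, ev_cup _ _ _ _ _ hl, ev_cup _ _ _ _ _ hl,
    ev_cup _ _ _ _ _ hl]
  simp only [LinearMap.sub_apply, LinearMap.smul_apply, smul_sub, unshuffleSum_sub]
  congr 1
  rw [unshuffleSum_comm, ← unshuffleSum_smul]
  refine unshuffleSum_congr fun s t _ => ?_
  simp only [smul_smul, neg_one_zpow_mul, LinearMap.flip_apply]
  congr 1
  exact neg_one_zpow_congr (by grind)

/-- Long sign identities are finished by splitting exponents into products of two degrees and
letting each such sign be `1` or `-1`; the remaining claims contain no powers. -/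
theorem neg_one_zpow_eq_or (K : Type*) [Field K] (x : ℤ) :
    (-1 : K) ^ x = 1 ∨ (-1 : K) ^ x = -1 := by
  rcases Int.even_or_odd x with h | h
  · exact Or.inl h.neg_one_zpow
  · exact Or.inr h.neg_one_zpow

/-- In this form the bracket of connections is built from operators whose commutators are given by
`ceOp_commutator`, which is how the Jacobi identity is obtained. -/
theorem connBracket_eq (d d' : ℤ) (X X' : Cochain K L L) (φ φ' : Cochain K L (Module.End K P)) :
    connBracket ℒ d d' X X' φ φ' = ceOp ℒ (LinearMap.mul K (Module.End K P)) d d' X φ φ' -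
      (-1 : K) ^ (d * d') • ceOp ℒ (LinearMap.mul K (Module.End K P)) d' d X' φ' φ := by
  rw [connBracket, cupCommutator_eq, ceOp, ceOp, mul_comm d' d, smul_sub, smul_smul,
    neg_one_zpow_mul_self, one_smul]
  abel

theorem ceOp_sub (B : E →ₗ[K] M →ₗ[K] M) (d e : ℤ) (X : Cochain K L L) (φ : Cochain K L E)
    (Ω Ω' : Cochain K L M) :
    ceOp ℒ B d e X φ (Ω - Ω') = ceOp ℒ B d e X φ Ω - ceOp ℒ B d e X φ Ω' := by
  simp only [ceOp, cup_sub_right, gerst_sub_left, smul_sub]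
  abel

theorem ceOp_smul (B : E →ₗ[K] M →ₗ[K] M) (d e : ℤ) (X : Cochain K L L) (φ : Cochain K L E)
    (c : K) (Ω : Cochain K L M) :
    ceOp ℒ B d e X φ (c • Ω) = c • ceOp ℒ B d e X φ Ω := by
  simp only [ceOp, cup_smul_right, gerst_smul_left, smul_sub, smul_comm c]

/-- The operators `ceOp` represent the bracket. -/
theorem ceOp_commutator (B : Module.End K P →ₗ[K] M →ₗ[K] M)
    (hB : ∀ x y m, B x (B y m) = B (x * y) m) {d d' : ℤ} (e : ℤ) {X X' : Cochain K L L}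
    (φ φ' : Cochain K L (Module.End K P)) {Ω : Cochain K L M}
    (hX : ∀ k, X k ∈ degreeMaps ℒ ℒ d k) (hX' : ∀ k, X' k ∈ degreeMaps ℒ ℒ d' k)
    (hΩ : ∀ k, Ω k ∈ gradedSymmetric ℒ k) :
    ceOp ℒ B d (e + d') X φ (ceOp ℒ B d' e X' φ' Ω) -
      (-1 : K) ^ (d * d') • ceOp ℒ B d' (e + d) X' φ' (ceOp ℒ B d e X φ Ω) =
    ceOp ℒ B (d + d') e (gerst ℒ X X' - (-1 : K) ^ (d * d') • gerst ℒ X' X)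
      (connBracket ℒ d d' X X' φ φ') Ω := by
  -- Associativity produces the commutator of `φ` and `φ'`, the pre-Lie identity the bracket of `X`
  -- and `X'`, and `cup_gerst` the terms `φ ∘ X'` and `φ' ∘ X`; the mixed terms with one product and
  -- one composition on `Ω` cancel.
  have h1 := cup_assoc ℒ B B B (LinearMap.mul K _) hB e d' φ φ' Ω
  have h2 := cup_assoc ℒ B B B (LinearMap.mul K _) hB e d φ' φ Ω
  have h3 := gerst_gerst ℒ hΩ hX hX'
  simp only [connBracket, cupCommutator_eq]
  simp only [ceOp, ← h3, cup_sub_left, cup_sub_right, cup_smul_left, cup_smul_right,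
    cup_add_left, gerst_sub_left, gerst_smul_left, h1, h2, cup_gerst ℒ B _ _ _ hX,
    cup_gerst ℒ B _ _ _ hX', mul_add, add_mul, mul_comm d' d]
  simp only [zpow_add₀ (show (-1 : K) ≠ 0 by simp)]
  rcases neg_one_zpow_eq_or K (d * d') with h | h <;>
  rcases neg_one_zpow_eq_or K (d * e) with h' | h' <;>
  rcases neg_one_zpow_eq_or K (d' * e) with h'' | h'' <;>
  rw [h, h', h''] <;> module

end Operators

/-! ### Skew symmetry and Jacobi identity. -/

section Jacobi

variable {K A L P : Type*} [Field K] [Ring A] [Algebra K A]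
  [AddCommGroup L] [Module K L] (ℒ : ℤ → Submodule K L) [DirectSum.Decomposition ℒ]
  [AddCommGroup P] [Module K P] [Module A P] [IsScalarTower K A P]

/-- The bracket of families of multilinear maps. -/
def gerstBracket (d d' : ℤ) (X Y : Cochain K L L) : Cochain K L L :=
  gerst ℒ X Y - (-1 : K) ^ (d * d') • gerst ℒ Y X

theorem gerstBracket_skew (d d' : ℤ) (X Y : Cochain K L L) :
    gerstBracket ℒ d d' X Y = -((-1 : K) ^ (d * d') • gerstBracket ℒ d' d Y X) := by
  rw [gerstBracket, gerstBracket, mul_comm d' d]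
  rcases neg_one_zpow_eq_or K (d * d') with h | h <;> rw [h] <;> module

theorem connBracket_skew (d d' : ℤ) (X Y : Cochain K L L) (φ ψ : Cochain K L (Module.End K P)) :
    connBracket ℒ d d' X Y φ ψ = -((-1 : K) ^ (d * d') • connBracket ℒ d' d Y X ψ φ) := by
  rw [connBracket_eq, connBracket_eq, mul_comm d' d]
  rcases neg_one_zpow_eq_or K (d * d') with h | h <;> rw [h] <;> module

/-- The commutator of a graded pre-Lie product satisfies the Jacobi identity: three instances of the
pre-Lie identity, one with each of `X`, `Y`, `Z` as the outer map. -/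
theorem gerstBracket_jacobi {i j k : ℤ} {X Y Z : Cochain K L L}
    (hX : ∀ n, X n ∈ degreeMaps ℒ ℒ i n) (hY : ∀ n, Y n ∈ degreeMaps ℒ ℒ j n)
    (hZ : ∀ n, Z n ∈ degreeMaps ℒ ℒ k n) (sX : ∀ n, X n ∈ gradedSymmetric ℒ n)
    (sY : ∀ n, Y n ∈ gradedSymmetric ℒ n) (sZ : ∀ n, Z n ∈ gradedSymmetric ℒ n) :
    gerstBracket ℒ i (j + k) X (gerstBracket ℒ j k Y Z) =
      gerstBracket ℒ (i + j) k (gerstBracket ℒ i j X Y) Z +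
        (-1 : K) ^ (i * j) • gerstBracket ℒ j (i + k) Y (gerstBracket ℒ i k X Z) := by
  have h1 := gerst_gerst ℒ sX hY hZ
  have h2 := gerst_gerst ℒ sZ hX hY
  have h3 := gerst_gerst ℒ sY hX hZ
  simp only [gerstBracket]
  rw [← h1, ← h2, ← h3]
  simp only [gerst_sub_left, gerst_smul_left, mul_add, add_mul, mul_comm j i,
    zpow_add₀ (show (-1 : K) ≠ 0 by simp)]
  rcases neg_one_zpow_eq_or K (i * j) with h | h <;>
  rcases neg_one_zpow_eq_or K (i * k) with h' | h' <;>
  rcases neg_one_zpow_eq_or K (j * k) with h'' | h'' <;>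
  rw [h, h', h''] <;> module

/-- Writing `D_X` for the operator of `(X, φ)` on `End P`-valued forms, and similarly for the
others, all brackets become differences of `D`-terms. The identity then follows from the three
relations expressing `[D_Y, D_Z] φ`, `[D_X, D_Y] χ` and `[D_X, D_Z] ψ` as operators of brackets. -/
theorem connBracket_jacobi {i j k : ℤ} {X Y Z : Cochain K L L}
    {φ ψ χ : Cochain K L (Module.End K P)}
    (hX : ∀ n, X n ∈ degreeMaps ℒ ℒ i n) (hY : ∀ n, Y n ∈ degreeMaps ℒ ℒ j n)
    (hZ : ∀ n, Z n ∈ degreeMaps ℒ ℒ k n) (sφ : ∀ n, φ n ∈ gradedSymmetric ℒ n)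
    (sψ : ∀ n, ψ n ∈ gradedSymmetric ℒ n) (sχ : ∀ n, χ n ∈ gradedSymmetric ℒ n) :
    connBracket ℒ i (j + k) X (gerstBracket ℒ j k Y Z) φ (connBracket ℒ j k Y Z ψ χ) =
      connBracket ℒ (i + j) k (gerstBracket ℒ i j X Y) Z (connBracket ℒ i j X Y φ ψ) χ +
        (-1 : K) ^ (i * j) • connBracket ℒ j (i + k) Y (gerstBracket ℒ i k X Z) ψ
          (connBracket ℒ i k X Z φ χ) := by
  have hB : ∀ x y m : Module.End K P, LinearMap.mul K _ x (LinearMap.mul K _ y m) =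
    LinearMap.mul K _ (x * y) m := fun x y m => by simp [mul_assoc]
  have h1 := ceOp_commutator ℒ _ hB i ψ χ hY hZ sφ
  have h2 := ceOp_commutator ℒ _ hB k φ ψ hX hY sχ
  have h3 := ceOp_commutator ℒ _ hB j φ χ hX hZ sψ
  rw [connBracket_eq ℒ i (j + k), connBracket_eq ℒ (i + j) k, connBracket_eq ℒ j (i + k)]
  simp only [gerstBracket]
  rw [← h1, ← h2, ← h3, connBracket_eq ℒ j k, connBracket_eq ℒ i j, connBracket_eq ℒ i k]
  simp only [ceOp_sub, ceOp_smul, mul_add, add_mul, mul_comm j i, add_comm k j, add_comm j i,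
    add_comm k i, zpow_add₀ (show (-1 : K) ≠ 0 by simp)]
  rcases neg_one_zpow_eq_or K (i * j) with h | h <;>
  rcases neg_one_zpow_eq_or K (i * k) with h' | h' <;>
  rcases neg_one_zpow_eq_or K (j * k) with h'' | h'' <;>
  rw [h, h', h''] <;> module

end Jacobi

/-! ### Linearity over `A` in the first argument. -/

section Linearity

variable {K A L P M Q : Type*} [Field K] [Ring A] [Algebra K A] (𝒜 : ℤ → Submodule K A)
  [AddCommGroup L] [Module K L] [Module A L] [IsScalarTower K A L] (ℒ : ℤ → Submodule K L)
  [DirectSum.Decomposition ℒ]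
  [AddCommGroup P] [Module K P] [Module A P] [IsScalarTower K A P] (ℳ : ℤ → Submodule K P)
  [AddCommGroup M] [Module K M] [Module A M] [IsScalarTower K A M]

/-- Graded `A`-linearity of degree `d` in the first argument. -/
def HeadLinear (d : ℤ) (f : Cochain K L M) : Prop :=
  ∀ (r : ℤ) (a : A), a ∈ 𝒜 r → ∀ (h : ℤ × L) (l : List (ℤ × L)), Homog ℒ (h :: l) →
    ev f ((r + h.1, a • h.2) :: l) = (-1 : K) ^ (r * d) • a • ev f (h :: l)

variable {𝒜 ℒ} in
theorem headLinear_of_gradedLinear {d : ℤ} {f : Cochain K L M}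
    (hf : ∀ k, f k ∈ gradedLinear 𝒜 ℒ d k) : HeadLinear 𝒜 ℒ d f := by
  intro r a ha h l hl
  have := hf (h :: l).length (fun i => ((h :: l).get i).1) (fun i => ((h :: l).get i).2)
    (fun i => hl _ ((h :: l).get_mem i)) r a ha 0
  have e : ∑ j : Fin (h :: l).length with j < 0, ((h :: l).get j).1 = 0 := by
    rw [Finset.sum_filter]
    exact Finset.sum_eq_zero fun i _ => if_neg (by simp)
  rw [e, add_zero] at this
  refine Eq.trans ?_ this
  simp only [ev]
  congr 1
  funext i
  refine Fin.cases ?_ (fun i => ?_) i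
  · simp
  · rw [Function.update_of_ne (by simp [Fin.ext_iff])]; simp

variable {𝒜 ℒ} in
-- Symmetry carries linearity from one slot to the next: swap the entry with its left neighbour,
-- apply the previous case, and swap back. The two swap signs differ by the degree of `a` times that
-- of the neighbour, which is the extra summand in the exponent.
theorem gradedLinear_of_headLinear [SetLike.GradedSMul 𝒜 ℒ] {d : ℤ} {f : Cochain K L M}
    (hs : ∀ k, f k ∈ gradedSymmetric ℒ k) (hf : HeadLinear 𝒜 ℒ d f) (k : ℕ) :
    f k ∈ gradedLinear 𝒜 ℒ d k := by
  intro n ξ h r a ha i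
  have hsm : ∀ i, a • ξ i ∈ ℒ (r + n i) := fun i => SetLike.GradedSMul.smul_mem ha (h i)
  obtain ⟨m, rfl⟩ : ∃ m, k = m + 1 := ⟨k - 1, by have := i.2; omega⟩
  induction i using Fin.induction generalizing n ξ with
  | zero =>
    have e : ∑ j : Fin (m + 1) with j < 0, n j = 0 := by
      rw [Finset.sum_filter]
      exact Finset.sum_eq_zero fun i _ => if_neg (by simp)
    have := hf r a ha (n 0, ξ 0) (List.ofFn fun i : Fin m => (n i.succ, ξ i.succ))
      (homog_cons.2 ⟨h 0, homog_ofFn.2 fun i => h i.succ⟩)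
    rw [e, add_zero]
    rw [show ((n 0, ξ 0) :: List.ofFn fun i : Fin m => (n i.succ, ξ i.succ)) =
      List.ofFn fun i : Fin (m + 1) => (n i, ξ i) by rw [List.ofFn_succ], ev_ofFn] at this
    rw [← this, ← ev_ofFn f (Function.update n 0 (r + n 0)), List.ofFn_succ]
    simp
  | succ j ih =>
    set w := Equiv.swap j.castSucc j.succ with hw
    have hne : j.castSucc ≠ j.succ := by simp [Fin.ext_iff]
    -- `h1` swaps the tuple containing `a • ξ`, where the entry has degree `r + n`; `h2` swaps the
    -- original tuple.
    have h1 := hs (m + 1) (Function.update n j.succ (r + n j.succ))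
      (Function.update ξ j.succ (a • ξ j.succ))
      (fun b => by
        by_cases hb : b = j.succ
        · subst hb; simpa using hsm _
        · simpa [Function.update_of_ne hb] using h b) j.castSucc j.succ (by simp)
    have h2 := hs (m + 1) n ξ h j.castSucc j.succ (by simp)
    have h3 := ih (n ∘ w) (ξ ∘ w) (fun b => h _) (fun b => hsm _)
    rw [← hw] at h1 h2
    rw [h2] at h3
    have e1 : Function.update ξ j.succ (a • ξ j.succ) ∘ w =
        Function.update (ξ ∘ w) j.castSucc (a • (ξ ∘ w) j.castSucc) := by
      funext b
      by_cases hb : b = j.castSucc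
      · subst hb; simp [hw]
      · rw [Function.update_of_ne hb, Function.comp_apply, Function.update_of_ne]; rfl
        intro hb'
        apply hb
        rw [← w.injective.eq_iff, hb', hw, Equiv.swap_apply_left]
    rw [e1, h3, Function.update_self, Function.update_of_ne hne] at h1
    have e2 : ∑ b with b < j.castSucc, (n ∘ w) b = ∑ b with b < j.castSucc, n b := by
      refine Finset.sum_congr rfl fun b hb => ?_
      have hb : b < j.castSucc := by simpa using hb
      rw [Function.comp_apply, hw, Equiv.swap_apply_of_ne_of_ne hb.ne
        (hb.trans (by simp [Fin.lt_def])).ne]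
    have e3 : ∑ b with b < j.succ, n b = n j.castSucc + ∑ b with b < j.castSucc, n b := by
      have : (Finset.univ.filter fun b => b < j.succ) =
          insert j.castSucc (Finset.univ.filter fun b => b < j.castSucc) := by
        ext b; simp [Fin.lt_def, Fin.ext_iff]; omega
      rw [this, Finset.sum_insert (by simp)]
    have h4 := congrArg (fun x => (-1 : K) ^ (n j.castSucc * (r + n j.succ)) • x) h1
    simp only [smul_smul, neg_one_zpow_mul_self, one_smul] at h4
    rw [← h4, e2, e3, smul_comm a, smul_smul, neg_one_zpow_mul, neg_one_zpow_mul]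
    congr 1
    exact neg_one_zpow_congr (by grind)

end Linearity

/-! ### The operators preserve `A`-linearity. -/

section Closure

variable {K A L P M E Q : Type*} [Field K] [Ring A] [Algebra K A] {𝒜 : ℤ → Submodule K A}
  [AddCommGroup L] [Module K L] [Module A L] [IsScalarTower K A L] {ℒ : ℤ → Submodule K L}
  [DirectSum.Decomposition ℒ] [SetLike.GradedSMul 𝒜 ℒ]
  [AddCommGroup P] [Module K P] [Module A P] [IsScalarTower K A P] {ℳ : ℤ → Submodule K P}
  [AddCommGroup M] [Module K M] [Module A M] [IsScalarTower K A M]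
  [AddCommGroup E] [Module K E] [Module A E] [IsScalarTower K A E]

variable (𝒜 ℒ) in
/-- `X` satisfies the Leibniz rule with symbol `σ` in its first argument. -/
def HeadLeibniz (d : ℤ) (X : Cochain K L L) (σ : Cochain K L (Module.End K A)) : Prop :=
  ∀ (r : ℤ) (a : A), a ∈ 𝒜 r → ∀ (h : ℤ × L) (l : List (ℤ × L)), Homog ℒ (h :: l) →
    ev X ((r + h.1, a • h.2) :: l) = (-1 : K) ^ (r * d) • a • ev X (h :: l) +
      (-1 : K) ^ ((r + h.1) * degSum l) • ev σ l a • h.2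

variable (𝒜 ℒ) in
/-- The values of `φ` act on `M` along `B` as graded derivations with symbols the values
of `σ`. -/
def HasSymbol (B : E →ₗ[K] M →ₗ[K] M) (d : ℤ) (φ : Cochain K L E)
    (σ : Cochain K L (Module.End K A)) : Prop :=
  ∀ (l : List (ℤ × L)), Homog ℒ l → ∀ (r : ℤ) (a : A), a ∈ 𝒜 r → ∀ m : M,
    B (ev φ l) (a • m) = ev σ l a • m + (-1 : K) ^ ((d + degSum l) * r) • a • B (ev φ l) m

theorem homog_smul {r : ℤ} {a : A} (ha : a ∈ 𝒜 r) {h : ℤ × L} {l : List (ℤ × L)}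
    (hl : Homog ℒ (h :: l)) : Homog ℒ ((r + h.1, a • h.2) :: l) := by
  rw [homog_cons] at hl ⊢
  exact ⟨SetLike.GradedSMul.smul_mem ha hl.1, hl.2⟩

theorem unshuffleSum_ringSMul (a : A) (F : List (ℤ × L) → List (ℤ × L) → M)
    (l : List (ℤ × L)) :
    unshuffleSum K l (fun s t => a • F s t) = a • unshuffleSum K l F :=
  (unshuffleSum_map F l (Algebra.lsmul K K M a)).symm

theorem HeadLinear.evHead {e : ℤ} {Ω : Cochain K L M} (hΩ : HeadLinear 𝒜 ℒ e Ω) {r n : ℤ} {a : A}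
    (ha : a ∈ 𝒜 r) {x : L} (hx : x ∈ ℒ n) {t : List (ℤ × L)} (ht : Homog ℒ t) :
    evHead Ω t (a • x) = (-1 : K) ^ (r * e) • a • evHead Ω t x := by
  rw [evHead_apply _ _ (r + n), evHead_apply _ _ n]
  exact hΩ r a ha (n, x) t (homog_cons.2 ⟨hx, ht⟩)

/-- The failure of `Ω ∘ X` to be `A`-linear. -/
theorem ev_gerst_smul {d e : ℤ} {X : Cochain K L L} {σ : Cochain K L (Module.End K A)}
    {Ω : Cochain K L M} (hX : ∀ k, X k ∈ degreeMaps ℒ ℒ d k) (hXσ : HeadLeibniz 𝒜 ℒ d X σ)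
    (hσ : ∀ k, σ k ∈ degreeMaps ℒ (endDegree 𝒜) d k) (hs : ∀ k, Ω k ∈ gradedSymmetric ℒ k)
    (hΩ : HeadLinear 𝒜 ℒ e Ω) {r : ℤ} {a : A} (ha : a ∈ 𝒜 r) {h : ℤ × L} {l : List (ℤ × L)}
    (hl : Homog ℒ (h :: l)) :
    ev (gerst ℒ Ω X) ((r + h.1, a • h.2) :: l) =
      (-1 : K) ^ (r * (d + e)) • a • ev (gerst ℒ Ω X) (h :: l) +
      unshuffleSum K l fun s t => (-1 : K) ^ ((r + h.1) * degSum s + (d + degSum s + r) * e) •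
        ev σ s a • ev Ω (h :: t) := by
  obtain ⟨hh, hl'⟩ := homog_cons.1 hl
  rw [ev_gerst _ _ _ hl, ev_gerst _ _ _ (homog_smul ha hl), unshuffleSum_cons, unshuffleSum_cons,
    smul_add, smul_add, add_right_comm, ← unshuffleSum_ringSMul,
      ← unshuffleSum_ringSMul, ← unshuffleSum_ringSMul, ← unshuffleSum_ringSMul]
  -- With `h` among the arguments of `X`, the Leibniz rule of `X` creates the error term; with `h`
  -- outside, the value of `X` is swapped past it and nothing is lost.
  congr 1
  · rw [← unshuffleSum_add]
    refine unshuffleSum_congr fun s t hst => ?_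
    obtain ⟨hs', ht⟩ := homog_append.1 (hl'.perm hst)
    have h2 := ev_mem_of_degreeMaps hσ hs' r a ha
    have h3 := ev_mem_of_degreeMaps hX (homog_cons.2 ⟨hh, hs'⟩)
    rw [hXσ r a ha h s (homog_cons.2 ⟨hh, hs'⟩), map_add, map_smul, hΩ.evHead ha h3 ht,
      map_smul, hΩ.evHead h2 hh ht, ← ev_cons, smul_smul, smul_smul, neg_one_zpow_mul, neg_one_zpow_mul]
    congr 2
    · rw [mul_add]
    · congr 1
      ring
  · refine unshuffleSum_congr fun s t hst => ?_
    obtain ⟨hs', ht⟩ := homog_append.1 (hl'.perm hst)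
    have h3 := ev_mem_of_degreeMaps hX hs'
    rw [evHead_apply _ _ (d + degSum s), evHead_apply _ _ (d + degSum s),
      ev_swap_head hs (a := (r + h.1, a • h.2)) (SetLike.GradedSMul.smul_mem ha hh) h3 ht,
      hΩ r a ha h _ (by simp [hh, h3, ht]), ev_swap_head hs (a := h) hh h3 ht, smul_comm a (_ : K),
      smul_comm a (_ : K)]
    simp only [smul_smul, neg_one_zpow_mul]
    congr 1
    exact neg_one_zpow_congr (by grind)

/-- The error arises when `h` is an argument of `Ω`: then `a` leaves `Ω` and the derivation `φ(ξ_S)`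
acts on it. It is the error of `ev_gerst_smul` up to the sign `(-1) ^ (d * e)`. -/
theorem ev_cup_smul {B : E →ₗ[K] M →ₗ[K] M} (hB : ∀ (a : A) x m, B (a • x) m = a • B x m)
    {d e : ℤ} {σ : Cochain K L (Module.End K A)} {φ : Cochain K L E}
    {Ω : Cochain K L M} (hφ : HeadLinear 𝒜 ℒ d φ) (hφσ : HasSymbol 𝒜 ℒ B d φ σ)
    (hΩ : HeadLinear 𝒜 ℒ e Ω) {r : ℤ} {a : A} (ha : a ∈ 𝒜 r) {h : ℤ × L} {l : List (ℤ × L)}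
    (hl : Homog ℒ (h :: l)) :
    ev (cup ℒ (fun _ _ => B) e φ Ω) ((r + h.1, a • h.2) :: l) =
      (-1 : K) ^ (r * (d + e)) • a • ev (cup ℒ (fun _ _ => B) e φ Ω) (h :: l) +
      unshuffleSum K l fun s t => (-1 : K) ^ ((r + h.1) * degSum s + (degSum s + r) * e) •
        ev σ s a • ev Ω (h :: t) := by
  obtain ⟨hh, hl'⟩ := homog_cons.1 hl
  rw [ev_cup _ _ _ _ _ hl, ev_cup _ _ _ _ _ (homog_smul ha hl), unshuffleSum_cons,
    unshuffleSum_cons, smul_add, smul_add, add_assoc, ← unshuffleSum_ringSMul,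
    ← unshuffleSum_ringSMul, ← unshuffleSum_ringSMul, ← unshuffleSum_ringSMul]
  congr 1
  · refine unshuffleSum_congr fun s t hst => ?_
    obtain ⟨hs', ht⟩ := homog_append.1 (hl'.perm hst)
    rw [hφ r a ha h s (homog_cons.2 ⟨hh, hs'⟩), map_smul, LinearMap.smul_apply, hB, smul_comm a (_ : K)]
    simp only [smul_smul, neg_one_zpow_mul, degSum_cons]
    congr 1
    exact neg_one_zpow_congr (by grind)
  · rw [← unshuffleSum_add]
    refine unshuffleSum_congr fun s t hst => ?_
    obtain ⟨hs', ht⟩ := homog_append.1 (hl'.perm hst)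
    rw [hΩ r a ha h t (homog_cons.2 ⟨hh, ht⟩), map_smul, hφσ s hs' r a ha, add_comm (ev σ s a • _)]
    simp only [smul_add, smul_comm a (_ : K), smul_smul, neg_one_zpow_mul]
    congr 2
    · exact neg_one_zpow_congr (by grind)
    · exact neg_one_zpow_congr (by grind)
-- Neither of the two summands is `A`-linear; the definition of the operator carries precisely the
-- sign for which their errors cancel.
theorem HeadLinear.ceOp {B : E →ₗ[K] M →ₗ[K] M} (hB : ∀ (a : A) x m, B (a • x) m = a • B x m)
    {d e : ℤ} {X : Cochain K L L} {σ : Cochain K L (Module.End K A)} {φ : Cochain K L E}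
    {Ω : Cochain K L M} (hX : ∀ k, X k ∈ degreeMaps ℒ ℒ d k) (hXσ : HeadLeibniz 𝒜 ℒ d X σ)
    (hσ : ∀ k, σ k ∈ degreeMaps ℒ (endDegree 𝒜) d k) (hφ : HeadLinear 𝒜 ℒ d φ)
    (hφσ : HasSymbol 𝒜 ℒ B d φ σ) (hs : ∀ k, Ω k ∈ gradedSymmetric ℒ k)
    (hΩ : HeadLinear 𝒜 ℒ e Ω) : HeadLinear 𝒜 ℒ (d + e) (ceOp ℒ B d e X φ Ω) := by
  intro r a ha h l hl
  rw [GradedLR.ceOp, ev_sub, ev_smul, ev_sub, ev_smul, ev_cup_smul hB hφ hφσ hΩ ha hl, ev_gerst_smul hX hXσ hσ hs hΩ ha hl,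
    smul_add, ← unshuffleSum_smul, smul_sub, smul_sub, smul_comm a, smul_comm ((-1 : K) ^ (d * e)),
    add_sub_add_comm, add_eq_left, sub_eq_zero]
  refine unshuffleSum_congr fun s t hst => ?_
  rw [smul_smul, neg_one_zpow_mul]
  congr 1
  exact neg_one_zpow_congr (by grind)

end Closure

/-! ### Symbols and Leibniz rules of brackets. -/

section Closure

variable {K A L P M E Q : Type*} [Field K] [Ring A] [Algebra K A] {𝒜 : ℤ → Submodule K A}
  [AddCommGroup L] [Module K L] [Module A L] [IsScalarTower K A L] {ℒ : ℤ → Submodule K L}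
  [DirectSum.Decomposition ℒ] [SetLike.GradedSMul 𝒜 ℒ]
  [AddCommGroup P] [Module K P] [Module A P] [IsScalarTower K A P] {ℳ : ℤ → Submodule K P}
  [AddCommGroup M] [Module K M] [Module A M] [IsScalarTower K A M]
  [AddCommGroup E] [Module K E] [AddCommGroup Q] [Module K Q]

theorem zpow_smul_congr {x y : ℤ} {v w : Q} (h : Even (x - y)) (hv : v = w) :
    (-1 : K) ^ x • v = (-1 : K) ^ y • w := by rw [neg_one_zpow_congr h, hv]

theorem unshuffleSum_apply (F : List (ℤ × L) → List (ℤ × L) → M →ₗ[K] Q) (l : List (ℤ × L))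
    (x : M) : unshuffleSum K l F x = unshuffleSum K l fun s t => F s t x :=
  unshuffleSum_map F l (LinearMap.applyₗ x)

theorem unshuffleSum_smul_right (F : List (ℤ × L) → List (ℤ × L) → A) (l : List (ℤ × L))
    (x : M) : unshuffleSum K l F • x = unshuffleSum K l fun s t => F s t • x :=
  unshuffleSum_map F l ((LinearMap.toSpanSingleton A M x).restrictScalars K)

theorem HasSymbol.add {B : E →ₗ[K] M →ₗ[K] M} {d : ℤ} {φ φ' : Cochain K L E}
    {σ σ' : Cochain K L (Module.End K A)} (h : HasSymbol 𝒜 ℒ B d φ σ)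
    (h' : HasSymbol 𝒜 ℒ B d φ' σ') : HasSymbol 𝒜 ℒ B d (φ + φ') (σ + σ') := by
  intro l hl r a ha m
  simp only [ev_add, map_add, LinearMap.add_apply, h l hl r a ha m, h' l hl r a ha m, add_smul,
    smul_add]
  abel

theorem HasSymbol.smul {B : E →ₗ[K] M →ₗ[K] M} {d : ℤ} {φ : Cochain K L E}
    {σ : Cochain K L (Module.End K A)} (c : K) (h : HasSymbol 𝒜 ℒ B d φ σ) :
    HasSymbol 𝒜 ℒ B d (c • φ) (c • σ) := by
  intro l hl r a ha m
  simp only [ev_smul, map_smul, LinearMap.smul_apply, h l hl r a ha m, smul_assoc,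
    smul_add, smul_comm c]

theorem HasSymbol.sub {B : E →ₗ[K] M →ₗ[K] M} {d : ℤ} {φ φ' : Cochain K L E}
    {σ σ' : Cochain K L (Module.End K A)} (h : HasSymbol 𝒜 ℒ B d φ σ)
    (h' : HasSymbol 𝒜 ℒ B d φ' σ') : HasSymbol 𝒜 ℒ B d (φ - φ') (σ - σ') := by
  rw [sub_eq_add_neg, sub_eq_add_neg, ← neg_one_smul K φ', ← neg_one_smul K σ']
  exact h.add (h'.smul _)

theorem HasSymbol.gerst {d d' : ℤ} {φ : Cochain K L (Module.End K M)}
    {σ : Cochain K L (Module.End K A)} {X : Cochain K L L}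
    (hX : ∀ k, X k ∈ degreeMaps ℒ ℒ d' k) (h : HasSymbol 𝒜 ℒ LinearMap.id d φ σ) :
    HasSymbol 𝒜 ℒ LinearMap.id (d + d') (gerst ℒ φ X) (gerst ℒ σ X) := by
  intro l hl r a ha m
  simp only [LinearMap.id_apply, ev_gerst _ _ _ hl, unshuffleSum_apply, unshuffleSum_smul_right,
    ← unshuffleSum_ringSMul, ← unshuffleSum_add]
  refine unshuffleSum_congr fun s t hst => ?_
  obtain ⟨hs, ht⟩ := homog_append.1 (hl.perm hst)
  have hXs : Homog ℒ ((d' + degSum s, ev X s) :: t) :=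
    homog_cons.2 ⟨ev_mem_of_degreeMaps hX hs, ht⟩
  have h1 := h _ hXs r a ha m
  simp only [LinearMap.id_apply, evHead_apply _ _ (d' + degSum s)] at h1 ⊢
  rw [h1, degSum_cons, ← degSum_perm hst, degSum_append]
  simp only [add_assoc]

/-- The graded commutator of linear maps of degrees `D` and `D'`. -/
abbrev gradedCommutator (K M : Type*) [Field K] [AddCommGroup M] [Module K M] (D D' : ℤ) :
    Module.End K M →ₗ[K] Module.End K M →ₗ[K] Module.End K M :=
  LinearMap.mul K (Module.End K M) - (-1 : K) ^ (D * D') • (LinearMap.mul K (Module.End K M)).flip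

theorem gradedCommutator_apply (D D' : ℤ) (φ φ' : Module.End K Q) (x : Q) :
    gradedCommutator K Q D D' φ φ' x = φ (φ' x) - (-1 : K) ^ (D * D') • φ' (φ x) := rfl

/-- The commutator of two derivations is a derivation: the mixed terms `σ a • φ' m` and `σ' a • φ m`
cancel. The hypotheses `g` and `g'` are the Leibniz rules for the scalars `σ' a` and `σ a`, of
degrees `r + D'` and `r + D`. -/
theorem gradedCommutator_smul {D D' r : ℤ} {a : A} {φ φ' : Module.End K M} {σ σ' : Module.End K A}
    (h : ∀ m, φ (a • m) = σ a • m + (-1 : K) ^ (D * r) • a • φ m)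
    (h' : ∀ m, φ' (a • m) = σ' a • m + (-1 : K) ^ (D' * r) • a • φ' m)
    (g : ∀ m, φ (σ' a • m) = σ (σ' a) • m + (-1 : K) ^ (D * (r + D')) • σ' a • φ m)
    (g' : ∀ m, φ' (σ a • m) = σ' (σ a) • m + (-1 : K) ^ (D' * (r + D)) • σ a • φ' m) (m : M) :
    gradedCommutator K M D D' φ φ' (a • m) = gradedCommutator K A D D' σ σ' a • m +
      (-1 : K) ^ ((D + D') * r) • a • gradedCommutator K M D D' φ φ' m := by
  rw [gradedCommutator_apply, gradedCommutator_apply, gradedCommutator_apply]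
  simp only [h, h', g, g', map_add, map_smul, sub_smul, smul_assoc, mul_add, add_mul,
    mul_comm D' D, smul_sub, smul_comm a (_ : K), zpow_add₀ (show (-1 : K) ≠ 0 by simp)]
  rcases neg_one_zpow_eq_or K (D * D') with e | e <;>
  rcases neg_one_zpow_eq_or K (D * r) with e' | e' <;>
  rcases neg_one_zpow_eq_or K (D' * r) with e'' | e'' <;>
  simp only [e, e', e'', one_smul, neg_smul, mul_one, mul_neg, neg_neg] <;> abel

theorem HasSymbol.cupCommutator {d d' : ℤ} {φ φ' : Cochain K L (Module.End K M)}
    {σ σ' : Cochain K L (Module.End K A)}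
    (hσ : ∀ k, σ k ∈ degreeMaps ℒ (endDegree 𝒜) d k)
    (hσ' : ∀ k, σ' k ∈ degreeMaps ℒ (endDegree 𝒜) d' k)
    (h : HasSymbol 𝒜 ℒ LinearMap.id d φ σ) (h' : HasSymbol 𝒜 ℒ LinearMap.id d' φ' σ') :
    HasSymbol 𝒜 ℒ LinearMap.id (d + d') (cupCommutator ℒ d d' φ φ')
      (cupCommutator ℒ d d' σ σ') := by
  intro l hl r a ha m
  simp only [LinearMap.id_apply, GradedLR.cupCommutator, ev_cup _ _ _ _ _ hl, unshuffleSum_apply,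
    unshuffleSum_smul_right, ← unshuffleSum_ringSMul, ← unshuffleSum_add]
  refine unshuffleSum_congr fun s t hst => ?_
  obtain ⟨hs, ht⟩ := homog_append.1 (hl.perm hst)
  have key := gradedCommutator_smul (h s hs r a ha) (h' t ht r a ha)
    (h s hs _ _ (ev_mem_of_degreeMaps hσ' ht r a ha))
    (h' t ht _ _ (ev_mem_of_degreeMaps hσ hs r a ha)) m
  simp only [LinearMap.id_apply] at key
  rw [LinearMap.smul_apply, key, LinearMap.smul_apply, LinearMap.smul_apply, smul_add, smul_assoc,
    smul_comm a (_ : K), smul_comm ((-1 : K) ^ (d' * degSum s)) ((-1 : K) ^ _),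
    ← degSum_perm hst, degSum_append]
  congr 4
  ring

theorem HasSymbol.connBracket {d d' : ℤ} {φ φ' : Cochain K L (Module.End K M)}
    {σ σ' : Cochain K L (Module.End K A)} {X X' : Cochain K L L}
    (hX : ∀ k, X k ∈ degreeMaps ℒ ℒ d k) (hX' : ∀ k, X' k ∈ degreeMaps ℒ ℒ d' k)
    (hσ : ∀ k, σ k ∈ degreeMaps ℒ (endDegree 𝒜) d k)
    (hσ' : ∀ k, σ' k ∈ degreeMaps ℒ (endDegree 𝒜) d' k)
    (h : HasSymbol 𝒜 ℒ LinearMap.id d φ σ) (h' : HasSymbol 𝒜 ℒ LinearMap.id d' φ' σ') :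
    HasSymbol 𝒜 ℒ LinearMap.id (d + d') (connBracket ℒ d d' X X' φ φ')
      (connBracket ℒ d d' X X' σ σ') := by
  have h1 := h'.gerst hX
  rw [add_comm d' d] at h1
  exact ((h.gerst hX').sub (h1.smul _)).add (h.cupCommutator hσ hσ' h')

theorem HeadLeibniz.evHead {d : ℤ} {X : Cochain K L L} {σ : Cochain K L (Module.End K A)}
    (h : HeadLeibniz 𝒜 ℒ d X σ) {r n : ℤ} {a : A} (ha : a ∈ 𝒜 r) {x : L} (hx : x ∈ ℒ n)
    {t : List (ℤ × L)} (ht : Homog ℒ t) :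
    evHead X t (a • x) = (-1 : K) ^ (r * d) • a • evHead X t x +
      (-1 : K) ^ ((r + n) * degSum t) • ev σ t a • x := by
  rw [evHead_apply _ _ (r + n), evHead_apply _ _ n]
  exact h r a ha (n, x) t (homog_cons.2 ⟨hx, ht⟩)

/-- The failure of `X ∘ X'` to be `A`-linear. -/
theorem ev_gerst_headLeibniz {d d' : ℤ} {X X' : Cochain K L L}
    {σ σ' : Cochain K L (Module.End K A)}
    (hX' : ∀ k, X' k ∈ degreeMaps ℒ ℒ d' k) (hs : ∀ k, X k ∈ gradedSymmetric ℒ k)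
    (hXσ : HeadLeibniz 𝒜 ℒ d X σ) (hXσ' : HeadLeibniz 𝒜 ℒ d' X' σ')
    (hσ' : ∀ k, σ' k ∈ degreeMaps ℒ (endDegree 𝒜) d' k)
    {r : ℤ} {a : A} (ha : a ∈ 𝒜 r) {h : ℤ × L} {l : List (ℤ × L)} (hl : Homog ℒ (h :: l)) :
    ev (gerst ℒ X X') ((r + h.1, a • h.2) :: l) =
      (-1 : K) ^ (r * (d + d')) • a • ev (gerst ℒ X X') (h :: l) +
      (-1 : K) ^ ((r + h.1) * degSum l) • ev (gerst ℒ σ X' +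
        cup ℒ (fun _ _ => LinearMap.mul K (Module.End K A)) d' σ σ') l a • h.2 +
      (unshuffleSum K l fun s t => (-1 : K) ^ ((r + h.1) * degSum s + (degSum s + r) * d') •
        ev σ s a • ev X' (h :: t)) +
      (-1 : K) ^ (d * d') • unshuffleSum K l fun s t =>
        (-1 : K) ^ ((r + h.1) * degSum s + (degSum s + r) * d) • ev σ' s a • ev X (h :: t) := by
  obtain ⟨hh, hl'⟩ := homog_cons.1 hl
  -- Case of `h` among the arguments of `X'`: the Leibniz rule of `X'` followed by that of `X` gives
  -- four terms, the last with the product of both symbols.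
  have h1 : ∀ s t : List (ℤ × L), (s ++ t).Perm l →
      evHead X t (ev X' ((r + h.1, a • h.2) :: s)) =
        (-1 : K) ^ (r * (d + d')) • a • evHead X t (ev X' (h :: s)) +
        (-1 : K) ^ (r * d' + (r + d' + h.1 + degSum s) * degSum t) • ev σ t a • ev X' (h :: s) +
        (-1 : K) ^ (d * d') • (-1 : K) ^ ((r + h.1) * degSum s + (degSum s + r) * d) •
          ev σ' s a • ev X (h :: t) +
        (-1 : K) ^ ((r + h.1) * degSum l + (d' + degSum s) * degSum t) •
          ev σ t (ev σ' s a) • h.2 := fun s t hst => by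
    obtain ⟨hs', ht⟩ := homog_append.1 (hl'.perm hst)
    have h3 := ev_mem_of_degreeMaps hX' (homog_cons.2 ⟨hh, hs'⟩)
    have h2 := ev_mem_of_degreeMaps hσ' hs' r a ha
    rw [hXσ' r a ha h s (homog_cons.2 ⟨hh, hs'⟩), map_add, map_smul, hXσ.evHead ha h3 ht, map_smul,
      hXσ.evHead h2 hh ht, ← degSum_perm hst, degSum_append, ← ev_cons]
    simp only [smul_add, smul_smul _ _ (_ : L), neg_one_zpow_mul, degSum_cons]
    simp only [add_assoc]
    refine congrArg₂ (· + ·) ?_ (congrArg₂ (· + ·) ?_ (congrArg₂ (· + ·) ?_ ?_)) <;>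
    exact zpow_smul_congr (by grind) rfl
  -- Case of `h` outside the arguments of `X'`: only the outer rule is applied, with symbol
  -- evaluated on the value of `X'`.
  have h2 : ∀ s t : List (ℤ × L), (s ++ t).Perm l →
      (-1 : K) ^ ((r + h.1) * degSum s) • evHead X ((r + h.1, a • h.2) :: t) (ev X' s) =
        (-1 : K) ^ (r * (d + d')) • a • (-1 : K) ^ (h.1 * degSum s) •
          evHead X (h :: t) (ev X' s) +
        (-1 : K) ^ ((r + h.1) * degSum l) • evHead σ t (ev X' s) a • h.2 := fun s t hst => by
    obtain ⟨hs', ht⟩ := homog_append.1 (hl'.perm hst)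
    have h3 := ev_mem_of_degreeMaps hX' hs'
    have h4 : Homog ℒ ((d' + degSum s, ev X' s) :: t) := homog_cons.2 ⟨h3, ht⟩
    rw [evHead_apply _ _ (d' + degSum s), evHead_apply _ _ (d' + degSum s),
      evHead_apply _ _ (d' + degSum s),
      ev_swap_head hs (a := (r + h.1, a • h.2)) (SetLike.GradedSMul.smul_mem ha hh) h3 ht,
      hXσ r a ha h _ (homog_cons.2 ⟨hh, h4⟩), ev_swap_head hs (a := h) hh h3 ht,
      ← degSum_perm hst, degSum_append]
    simp only [smul_add, smul_comm a (_ : K), smul_smul _ _ (_ : L), neg_one_zpow_mul, degSum_cons]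
    refine congrArg₂ (· + ·) ?_ ?_ <;> exact zpow_smul_congr (by grind) rfl
  -- Exchanging the parts puts this term into the shape of the other mixed term with the roles of
  -- `X` and `X'` interchanged, so that the two cancel in the bracket.
  have hA : (unshuffleSum K l fun s t =>
      (-1 : K) ^ (r * d' + (r + d' + h.1 + degSum s) * degSum t) • ev σ t a • ev X' (h :: s)) =
      unshuffleSum K l fun s t => (-1 : K) ^ ((r + h.1) * degSum s + (degSum s + r) * d') •
        ev σ s a • ev X' (h :: t) := by
    rw [unshuffleSum_comm]
    refine unshuffleSum_congr fun s t _ => ?_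
    rw [smul_smul, neg_one_zpow_mul]
    congr 1
    exact neg_one_zpow_congr (by grind)
  have hC : (unshuffleSum K l fun s t =>
      (-1 : K) ^ ((r + h.1) * degSum l + (d' + degSum s) * degSum t) •
        ev σ t (ev σ' s a) • h.2) =
      (-1 : K) ^ ((r + h.1) * degSum l) • unshuffleSum K l fun s t =>
        (-1 : K) ^ (d' * degSum s) • ev σ s (ev σ' t a) • h.2 := by
    rw [unshuffleSum_comm, ← unshuffleSum_smul]
    refine unshuffleSum_congr fun s t _ => ?_
    simp only [smul_smul _ _ (_ : L), neg_one_zpow_mul]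
    congr 1
    exact neg_one_zpow_congr (by grind)
  have hD : ev (gerst ℒ σ X' + cup ℒ (fun _ _ => LinearMap.mul K (Module.End K A)) d' σ σ') l a • h.2
      = unshuffleSum K l (fun s t => evHead σ t (ev X' s) a • h.2) +
        unshuffleSum K l fun s t => (-1 : K) ^ (d' * degSum s) • ev σ s (ev σ' t a) • h.2 := by
    rw [ev_add, LinearMap.add_apply, add_smul, ev_gerst _ _ _ hl', ev_cup _ _ _ _ _ hl',
      unshuffleSum_apply, unshuffleSum_apply, unshuffleSum_smul_right, unshuffleSum_smul_right]
    congr 1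
    refine unshuffleSum_congr fun s t _ => ?_
    rw [LinearMap.smul_apply, smul_assoc]
    rfl
  rw [ev_gerst _ _ _ hl, ev_gerst _ _ _ (homog_smul ha hl), unshuffleSum_cons, unshuffleSum_cons,
    unshuffleSum_congr h1, unshuffleSum_congr h2, hD]
  simp only [unshuffleSum_add, hA, hC, smul_add, unshuffleSum_smul, unshuffleSum_ringSMul]
  abel

/-- The bracket of multiderivations satisfies the Leibniz rule. -/
theorem HeadLeibniz.gerstBracket {d d' : ℤ} {X X' : Cochain K L L}
    {σ σ' : Cochain K L (Module.End K A)}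
    (hX : ∀ k, X k ∈ degreeMaps ℒ ℒ d k) (hX' : ∀ k, X' k ∈ degreeMaps ℒ ℒ d' k)
    (hs : ∀ k, X k ∈ gradedSymmetric ℒ k) (hs' : ∀ k, X' k ∈ gradedSymmetric ℒ k)
    (hXσ : HeadLeibniz 𝒜 ℒ d X σ) (hXσ' : HeadLeibniz 𝒜 ℒ d' X' σ')
    (hσ : ∀ k, σ k ∈ degreeMaps ℒ (endDegree 𝒜) d k)
    (hσ' : ∀ k, σ' k ∈ degreeMaps ℒ (endDegree 𝒜) d' k) :
    HeadLeibniz 𝒜 ℒ (d + d') (gerstBracket ℒ d d' X X') (connBracket ℒ d d' X X' σ σ') := by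
  intro r a ha h l hl
  rw [GradedLR.gerstBracket, GradedLR.connBracket, cupCommutator_eq]
  simp only [ev_sub, ev_smul, ev_add, ev_gerst_headLeibniz hX' hs hXσ hXσ' hσ' ha hl,
    ev_gerst_headLeibniz hX hs' hXσ' hXσ hσ ha hl, LinearMap.add_apply, LinearMap.sub_apply,
    LinearMap.smul_apply, add_smul, sub_smul, smul_assoc, smul_add, smul_sub, smul_comm a (_ : K),
    mul_comm d' d, add_comm d' d]
  rcases neg_one_zpow_eq_or K (d * d') with e | e <;>
  simp only [e, one_smul, neg_smul, smul_neg] <;> abel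

end Closure

/-! ### Membership in the spaces of pairs in terms of lists. -/

section Pairs

variable {K A L P M E Q : Type*} [Field K] [Ring A] [Algebra K A] {𝒜 : ℤ → Submodule K A}
  [GradedAlgebra 𝒜]
  [AddCommGroup L] [Module K L] [Module A L] [IsScalarTower K A L] {ℒ : ℤ → Submodule K L}
  [DirectSum.Decomposition ℒ] [SetLike.GradedSMul 𝒜 ℒ]
  [AddCommGroup P] [Module K P] [Module A P] [IsScalarTower K A P] {ℳ : ℤ → Submodule K P}
  [SetLike.GradedSMul 𝒜 ℳ]
  [AddCommGroup Q] [Module K Q]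

theorem sum_get_fst (l : List (ℤ × L)) : ∑ i, (l.get i).1 = degSum l := by
  rw [degSum, ← List.sum_ofFn]
  congr 1
  conv_rhs => rw [← List.ofFn_get l, List.map_ofFn]
  rfl

theorem degSum_ofFn {m : ℕ} (n : Fin m → ℤ) (ξ : Fin m → L) :
    degSum (List.ofFn fun i => (n i, ξ i)) = ∑ i, n i := by
  rw [degSum, List.map_ofFn, List.sum_ofFn]
  rfl

theorem homog_get {l : List (ℤ × L)} (hl : Homog ℒ l) (i : Fin l.length) :
    (l.get i).2 ∈ ℒ (l.get i).1 := hl _ (l.get_mem i)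

theorem ev_concat (f : Cochain K L Q) {m : ℕ} (n : Fin m → ℤ) (ξ : Fin m → L) (h : ℤ × L) :
    ev f ((List.ofFn fun i => (n i, ξ i)) ++ [h]) = f (m + 1) (Fin.snoc ξ h.2) := by
  rw [← ev_ofFn f (Fin.snoc n h.1 : Fin (m + 1) → ℤ), List.ofFn_succ']
  simp

variable (𝒜 ℒ ℳ) in
/-- A connection of degree `d` with symbol `σ`. -/
structure IsConnection (d : ℤ) (σ : Cochain K L (Module.End K A))
    (φ : Cochain K L (Module.End K P)) : Prop where
  finite : φ ∈ finiteCochains K L (Module.End K P)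
  degree : ∀ k, φ k ∈ degreeMaps ℒ (endDegree ℳ) d k
  symm : ∀ k, φ k ∈ gradedSymmetric ℒ k
  linear : HeadLinear 𝒜 ℒ d φ
  symbol : HasSymbol 𝒜 ℒ (M := P) LinearMap.id d φ σ

variable (𝒜 ℒ) in
/-- A multiderivation of degree `d` with symbol `σ`. -/
structure IsMultiDer (d : ℤ) (X : Cochain K L L) (σ : Cochain K L (Module.End K A)) : Prop where
  finite : X ∈ finiteCochains K L L
  degree : ∀ k, X k ∈ degreeMaps ℒ ℒ d k
  symm : ∀ k, X k ∈ gradedSymmetric ℒ k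
  leibniz : HeadLeibniz 𝒜 ℒ d X σ
  conn : IsConnection 𝒜 ℒ 𝒜 d σ σ

theorem isConnection_iff {d : ℤ} {σ : Cochain K L (Module.End K A)}
    {φ : Cochain K L (Module.End K P)} :
    IsConnection 𝒜 ℒ ℳ d σ φ ↔ φ ∈ finiteCochains K L (Module.End K P) ∧
    (∀ k, φ k ∈
      degreeMaps ℒ (endDegree ℳ) d k ⊓ gradedSymmetric ℒ k ⊓ gradedLinear 𝒜 ℒ d k) ∧
    (∀ (k : ℕ) (n : Fin k → ℤ) (ξ : Fin k → L), (∀ i, ξ i ∈ ℒ (n i)) →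
      ∀ (r : ℤ) (a : A), a ∈ 𝒜 r → ∀ p : P,
        φ k ξ (a • p) = σ k ξ a • p + (-1 : K) ^ ((d + ∑ i, n i) * r) • a • φ k ξ p) := by
  constructor
  · rintro ⟨h1, h2, h3, h4, h5⟩
    refine ⟨h1, fun k => ⟨⟨h2 k, h3 k⟩, gradedLinear_of_headLinear h3 h4 k⟩, ?_⟩
    intro k n ξ h r a ha p
    have := h5 _ (homog_ofFn.2 h) r a ha p
    simp only [ev_ofFn, degSum_ofFn] at this
    exact this
  · rintro ⟨h1, h2, h3⟩
    refine ⟨h1, fun k => (h2 k).1.1, fun k => (h2 k).1.2,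
      headLinear_of_gradedLinear fun k => (h2 k).2, ?_⟩
    intro l hl r a ha p
    have := h3 _ _ _ (homog_get hl) r a ha p
    rwa [sum_get_fst] at this

theorem mem_leftPairs_iff' {d : ℤ}
    {x : (Cochain K L L × Cochain K L (Module.End K A)) × Cochain K L (Module.End K P)} :
    x ∈ leftPairs 𝒜 ℒ ℳ d ↔ x.1 ∈ multiDer 𝒜 ℒ d ∧ IsConnection 𝒜 ℒ ℳ d x.1.2 x.2 := by
  rw [isConnection_iff]
  rfl

/-- The definition has its Leibniz rule in the last argument, the calculations use the first. By
symmetry the two versions differ by the sign of moving an entry through all the others. -/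
theorem mem_multiDer_iff {d : ℤ} {x : Cochain K L L × Cochain K L (Module.End K A)} :
    x ∈ multiDer 𝒜 ℒ d ↔ IsMultiDer 𝒜 ℒ d x.1 x.2 := by
  have hsn : ∀ (hs : ∀ k, x.1 k ∈ gradedSymmetric ℒ k) (l : List (ℤ × L)) (h : ℤ × L),
      Homog ℒ (h :: l) → x.1 (l.length + 1) (Fin.snoc (fun i => (l.get i).2) h.2) =
        (-1 : K) ^ (h.1 * degSum l) • ev x.1 (h :: l) := by
    intro hs l h hl
    rw [← ev_concat x.1 (fun i => (l.get i).1)]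
    have := ev_move hs (p := l) (q := []) (h := h) (by simpa using hl)
    rw [List.append_nil] at this
    rw [← this]
    congr
    exact List.ofFn_get l
  constructor
  · rintro ⟨h1, h2, h3, h4, h5, h6⟩
    refine ⟨h1, fun k => (h3 k).1, fun k => (h3 k).2, ?_, isConnection_iff.2 ⟨h2, h4, ?_⟩⟩
    · intro r a ha h l hl
      have := h6 _ _ _ (homog_get (homog_cons.1 hl).2) r a ha h.2
      rw [hsn (fun k => (h3 k).2) l h hl,
        hsn (fun k => (h3 k).2) l (r + h.1, a • h.2) (homog_smul ha hl), sum_get_fst] at this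
      -- The sign from moving the argument is its own inverse, so multiplying by it isolates the
      -- value.
      have h7 := congrArg (fun x => (-1 : K) ^ ((r + h.1) * degSum l) • x) this
      simp only [smul_smul _ _ (_ : L), neg_one_zpow_mul_self, one_smul, smul_add,
        smul_comm a (_ : K), neg_one_zpow_mul] at h7
      rw [h7, add_comm]
      refine congrArg₂ (· + ·) ?_ rfl
      exact zpow_smul_congr (by grind) rfl
    · intro k n ξ h r a ha p
      exact h5 k n ξ h r a ha p
  · rintro ⟨h1, h2, h3, h4, h5⟩
    rw [isConnection_iff] at h5
    refine ⟨h1, h5.1, fun k => ⟨h2 k, h3 k⟩, h5.2.1, h5.2.2, ?_⟩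
    intro k n ξ h r a ha ζ
    -- The last argument `ζ` need not be homogeneous in the definition, whereas signs make sense
    -- only for homogeneous entries.
    refine DirectSum.Decomposition.inductionOn ℒ ?_ ?_ ?_ ζ
    · simp only [smul_zero]
      rw [(x.1 (k + 1)).map_coord_zero (Fin.last k) (by simp)]
      simp
    · intro m ζ
      have hl : Homog ℒ ((m, (ζ : L)) :: List.ofFn fun i => (n i, ξ i)) :=
        homog_cons.2 ⟨ζ.2, homog_ofFn.2 h⟩
      have e := h4 r a ha _ _ hl
      have e1 := ev_move h3 (p := List.ofFn fun i => (n i, ξ i)) (q := [])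
        (h := (m, (ζ : L))) (by simpa using hl)
      have e2 := ev_move h3 (p := List.ofFn fun i => (n i, ξ i)) (q := [])
        (h := (r + m, a • (ζ : L))) (by simpa using homog_smul ha hl)
      rw [ev_concat, List.append_nil, degSum_ofFn] at e1 e2
      simp only at e1 e2 e
      rw [e2, e, e1, ev_ofFn, degSum_ofFn]
      simp only [smul_smul _ _ (_ : L), neg_one_zpow_mul_self, one_smul, smul_add,
        smul_comm a (_ : K), neg_one_zpow_mul]
      rw [add_comm]
      refine congrArg₂ (· + ·) rfl ?_
      exact zpow_smul_congr (by grind) rfl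
    · intro ζ ζ' e e'
      rw [smul_add, MultilinearMap.snoc_add, MultilinearMap.snoc_add, e, e']
      simp only [smul_add]
      abel

theorem mem_leftPairs_iff {d : ℤ}
    {x : (Cochain K L L × Cochain K L (Module.End K A)) × Cochain K L (Module.End K P)} :
    x ∈ leftPairs 𝒜 ℒ ℳ d ↔
      IsMultiDer 𝒜 ℒ d x.1.1 x.1.2 ∧ IsConnection 𝒜 ℒ ℳ d x.1.2 x.2 := by
  rw [mem_leftPairs_iff', mem_multiDer_iff]

end Pairs

/-! ### `𝓛(P)` is a graded Lie algebra. -/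

section Closure

variable {K A L P M E Q : Type*} [Field K] [Ring A] [Algebra K A] {𝒜 : ℤ → Submodule K A}
  [GradedAlgebra 𝒜]
  [AddCommGroup L] [Module K L] [Module A L] [IsScalarTower K A L] {ℒ : ℤ → Submodule K L}
  [DirectSum.Decomposition ℒ] [SetLike.GradedSMul 𝒜 ℒ]
  [AddCommGroup P] [Module K P] [Module A P] [IsScalarTower K A P] {ℳ : ℤ → Submodule K P}
  [SetLike.GradedSMul 𝒜 ℳ]
  [AddCommGroup M] [Module K M] [Module A M] [IsScalarTower K A M] {𝒬 : ℤ → Submodule K M}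
  [AddCommGroup E] [Module K E] [Module A E] [IsScalarTower K A E] {ℰ : ℤ → Submodule K E}

variable (𝒜 ℒ 𝒬) in
/-- Graded symmetric, graded `A`-multilinear forms of degree `d`. -/
structure IsForm (d : ℤ) (f : Cochain K L M) : Prop where
  finite : f ∈ finiteCochains K L M
  degree : ∀ k, f k ∈ degreeMaps ℒ 𝒬 d k
  symm : ∀ k, f k ∈ gradedSymmetric ℒ k
  linear : HeadLinear 𝒜 ℒ d f

theorem mem_symForm_iff {d : ℤ} {Ω : Cochain K L P} :
    Ω ∈ symForm 𝒜 ℒ ℳ d ↔ IsForm 𝒜 ℒ ℳ d Ω := by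
  simp only [symForm, Submodule.mem_inf, Submodule.mem_pi, Set.mem_univ, true_imp_iff]
  constructor
  · rintro ⟨h1, h2⟩
    exact ⟨h1, fun k => (h2 k).1.1, fun k => (h2 k).1.2,
      headLinear_of_gradedLinear fun k => (h2 k).2⟩
  · rintro ⟨h1, h2, h3, h4⟩
    exact ⟨h1, fun k => ⟨⟨h2 k, h3 k⟩, gradedLinear_of_headLinear h3 h4 k⟩⟩

theorem IsConnection.isForm {d : ℤ} {σ : Cochain K L (Module.End K A)}
    {φ : Cochain K L (Module.End K P)} (h : IsConnection 𝒜 ℒ ℳ d σ φ) :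
    IsForm 𝒜 ℒ (endDegree ℳ) d φ := ⟨h.1, h.2, h.3, h.4⟩

theorem IsForm.sub_smul {d : ℤ} {f g : Cochain K L M} (hf : IsForm 𝒜 ℒ 𝒬 d f)
    (hg : IsForm 𝒜 ℒ 𝒬 d g) (c : K) : IsForm 𝒜 ℒ 𝒬 d (f - c • g) := by
  refine ⟨sub_mem hf.1 (Submodule.smul_mem _ _ hg.1),
    fun k => sub_mem (hf.2 k) (Submodule.smul_mem _ _ (hg.2 k)),
    fun k => sub_mem (hf.3 k) (Submodule.smul_mem _ _ (hg.3 k)), ?_⟩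
  intro r a ha h l hl
  rw [ev_sub, ev_smul, hf.4 r a ha h l hl, hg.4 r a ha h l hl, ev_sub, ev_smul]
  rw [smul_sub, smul_sub, smul_comm a c, smul_comm c]

theorem gerst_degree {d e : ℤ} {f : Cochain K L M} {X : Cochain K L L}
    (hf : ∀ k, f k ∈ degreeMaps ℒ 𝒬 e k) (hX : ∀ k, X k ∈ degreeMaps ℒ ℒ d k) (k : ℕ) :
    gerst ℒ f X k ∈ degreeMaps ℒ 𝒬 (d + e) k := by
  refine degreeMaps_of_ev_mem (fun l hl => ?_) k
  rw [ev_gerst ℒ f X hl]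
  refine unshuffleSum_mem fun s t hst => ?_
  obtain ⟨hs, ht⟩ := homog_append.1 (hl.perm hst)
  rw [evHead_apply f t (d + degSum s)]
  have := ev_mem_of_degreeMaps hf (homog_cons (h := (d + degSum s, ev X s)).2
    ⟨ev_mem_of_degreeMaps hX hs, ht⟩)
  rw [← degSum_perm hst, degSum_append]
  rw [degSum_cons] at this
  convert this using 2
  ring

theorem cup_degree {B : E →ₗ[K] M →ₗ[K] M} {d e : ℤ} {f : Cochain K L E} {g : Cochain K L M}
    (hB : ∀ i j x m, x ∈ ℰ i → m ∈ 𝒬 j → B x m ∈ 𝒬 (i + j))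
    (hf : ∀ k, f k ∈ degreeMaps ℒ ℰ d k) (hg : ∀ k, g k ∈ degreeMaps ℒ 𝒬 e k) (k : ℕ) :
    cup ℒ (fun _ _ => B) e f g k ∈ degreeMaps ℒ 𝒬 (d + e) k := by
  refine degreeMaps_of_ev_mem (fun l hl => ?_) k
  rw [ev_cup ℒ _ e f g hl]
  refine unshuffleSum_mem fun s t hst => Submodule.smul_mem _ _ ?_
  obtain ⟨hs, ht⟩ := homog_append.1 (hl.perm hst)
  have := hB _ _ _ _ (ev_mem_of_degreeMaps hf hs) (ev_mem_of_degreeMaps hg ht)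
  rw [← degSum_perm hst, degSum_append]
  convert this using 2
  ring

/-- Stated for a general action `B` because it serves twice: for `P`-valued forms and, with `B` the
multiplication of `End P`, for the brackets of connections. -/
theorem IsForm.ceOp {B : E →ₗ[K] M →ₗ[K] M} (hB : ∀ (a : A) x m, B (a • x) m = a • B x m)
    (hBd : ∀ i j x m, x ∈ ℰ i → m ∈ 𝒬 j → B x m ∈ 𝒬 (i + j))
    {d e : ℤ} {X : Cochain K L L} {σ : Cochain K L (Module.End K A)} {φ : Cochain K L E}
    {Ω : Cochain K L M} (hX : IsMultiDer 𝒜 ℒ d X σ) (hφ : IsForm 𝒜 ℒ ℰ d φ)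
    (hφσ : HasSymbol 𝒜 ℒ B d φ σ) (hΩ : IsForm 𝒜 ℒ 𝒬 e Ω) :
    IsForm 𝒜 ℒ 𝒬 (d + e) (ceOp ℒ B d e X φ Ω) := by
  refine ⟨sub_mem (cup_finite _ _ _ _ _ hφ.1 hΩ.1)
    (Submodule.smul_mem _ _ (gerst_finite _ hΩ.1 hX.1)), fun k =>
    sub_mem (cup_degree hBd hφ.2 hΩ.2 k) (Submodule.smul_mem _ _ (gerst_degree hΩ.2 hX.2 k)),
    fun k => sub_mem (cup_gradedSymmetric _ _ _ _ _ hφ.3 hΩ.3 k)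
      (Submodule.smul_mem _ _ (gerst_gradedSymmetric _ hΩ.3 hX.3 k)), ?_⟩
  exact HeadLinear.ceOp hB hX.degree hX.leibniz hX.conn.degree hφ.4 hφσ hΩ.3 hΩ.4

/-- Scalars act on endomorphisms through their values, so the derivation rule on `P` passes to left
multiplication on `End P`. -/
theorem HasSymbol.mul {d : ℤ} {φ : Cochain K L (Module.End K P)}
    {σ : Cochain K L (Module.End K A)} (h : HasSymbol 𝒜 ℒ (M := P) LinearMap.id d φ σ) :
    HasSymbol 𝒜 ℒ (LinearMap.mul K (Module.End K P)) d φ σ := by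
  intro l hl r a ha m
  ext p
  exact h l hl r a ha (m p)

theorem IsConnection.connBracket {d d' : ℤ} {X X' : Cochain K L L}
    {σ σ' : Cochain K L (Module.End K A)} {φ φ' : Cochain K L (Module.End K P)}
    (hX : IsMultiDer 𝒜 ℒ d X σ) (hX' : IsMultiDer 𝒜 ℒ d' X' σ')
    (h : IsConnection 𝒜 ℒ ℳ d σ φ) (h' : IsConnection 𝒜 ℒ ℳ d' σ' φ') :
    IsConnection 𝒜 ℒ ℳ (d + d') (connBracket ℒ d d' X X' σ σ')
      (connBracket ℒ d d' X X' φ φ') := by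
  have hd : ∀ i j (x m : Module.End K P), x ∈ endDegree ℳ i → m ∈ endDegree ℳ j →
      LinearMap.mul K (Module.End K P) x m ∈ endDegree ℳ (i + j) := by
    intro i j x m hx hm n p hp
    have := hx _ _ (hm n p hp)
    rwa [add_assoc, add_comm j] at this
  -- Each half of the antisymmetrised expression is an operator applied to an `End P`-valued form,
  -- hence is itself a form; no separate linearity argument for the bracket is needed.
  have key : IsForm 𝒜 ℒ (endDegree ℳ) (d + d') (GradedLR.connBracket ℒ d d' X X' φ φ') := by
    rw [connBracket_eq]
    refine IsForm.sub_smul ?_ ?_ _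
    · exact IsForm.ceOp (fun _ _ _ => rfl) hd hX h.isForm h.symbol.mul h'.isForm
    · rw [add_comm]
      exact IsForm.ceOp (fun _ _ _ => rfl) hd hX' h'.isForm h'.symbol.mul h.isForm
  exact ⟨key.1, key.2, key.3, key.4, HasSymbol.connBracket hX.degree hX'.degree hX.conn.degree
    hX'.conn.degree h.symbol h'.symbol⟩

theorem IsMultiDer.gerstBracket {d d' : ℤ} {X X' : Cochain K L L}
    {σ σ' : Cochain K L (Module.End K A)}
    (h : IsMultiDer 𝒜 ℒ d X σ) (h' : IsMultiDer 𝒜 ℒ d' X' σ') :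
    IsMultiDer 𝒜 ℒ (d + d') (gerstBracket ℒ d d' X X')
      (connBracket ℒ d d' X X' σ σ') := by
  refine ⟨sub_mem (gerst_finite _ h.1 h'.1) (Submodule.smul_mem _ _ (gerst_finite _ h'.1 h.1)),
    fun k => ?_, fun k => sub_mem (gerst_gradedSymmetric _ h.3 h'.3 k)
      (Submodule.smul_mem _ _ (gerst_gradedSymmetric _ h'.3 h.3 k)),
    HeadLeibniz.gerstBracket h.2 h'.2 h.3 h'.3 h.4 h'.4 h.5.2 h'.5.2,
    IsConnection.connBracket h h' h.5 h'.5⟩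
  have := gerst_degree h.2 h'.2 k
  rw [add_comm] at this
  exact sub_mem this (Submodule.smul_mem _ _ (gerst_degree h'.2 h.2 k))

theorem gerstBracket_add_left (d d' : ℤ) (X X' Y : Cochain K L L) :
    gerstBracket ℒ d d' (X + X') Y = gerstBracket ℒ d d' X Y + gerstBracket ℒ d d' X' Y := by
  simp only [gerstBracket, gerst_add_left, gerst_add_right, smul_add]
  abel

theorem gerstBracket_smul_left (d d' : ℤ) (c : K) (X Y : Cochain K L L) :
    gerstBracket ℒ d d' (c • X) Y = c • gerstBracket ℒ d d' X Y := by
  simp only [gerstBracket, gerst_smul_left, gerst_smul_right, smul_sub, smul_comm c]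

theorem connBracket_add_left (d d' : ℤ) (X X' Y : Cochain K L L)
    (φ φ' ψ : Cochain K L (Module.End K P)) :
    connBracket ℒ d d' (X + X') Y (φ + φ') ψ =
      connBracket ℒ d d' X Y φ ψ + connBracket ℒ d d' X' Y φ' ψ := by
  simp only [connBracket, cupCommutator, cup_add_left, gerst_add_left, gerst_add_right, smul_add]
  abel

theorem connBracket_smul_left (d d' : ℤ) (c : K) (X Y : Cochain K L L)
    (φ ψ : Cochain K L (Module.End K P)) :
    connBracket ℒ d d' (c • X) Y (c • φ) ψ = c • connBracket ℒ d d' X Y φ ψ := by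
  simp only [connBracket, cupCommutator, cup_smul_left, gerst_smul_left, gerst_smul_right,
    smul_add, smul_sub, smul_comm c]

theorem gerstBracket_add_right (d d' : ℤ) (X Y Y' : Cochain K L L) :
    gerstBracket ℒ d d' X (Y + Y') = gerstBracket ℒ d d' X Y + gerstBracket ℒ d d' X Y' := by
  simp only [gerstBracket, gerst_add_left, gerst_add_right, smul_add]
  abel

theorem gerstBracket_smul_right (d d' : ℤ) (c : K) (X Y : Cochain K L L) :
    gerstBracket ℒ d d' X (c • Y) = c • gerstBracket ℒ d d' X Y := by
  simp only [gerstBracket, gerst_smul_left, gerst_smul_right, smul_sub, smul_comm c]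

theorem connBracket_add_right (d d' : ℤ) (X Y Y' : Cochain K L L)
    (φ ψ ψ' : Cochain K L (Module.End K P)) :
    connBracket ℒ d d' X (Y + Y') φ (ψ + ψ') =
      connBracket ℒ d d' X Y φ ψ + connBracket ℒ d d' X Y' φ ψ' := by
  simp only [connBracket, cupCommutator, cup_add_right, gerst_add_left, gerst_add_right, smul_add]
  abel

theorem connBracket_smul_right (d d' : ℤ) (c : K) (X Y : Cochain K L L)
    (φ ψ : Cochain K L (Module.End K P)) :
    connBracket ℒ d d' X (c • Y) φ (c • ψ) = c • connBracket ℒ d d' X Y φ ψ := by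
  simp only [connBracket, cupCommutator, cup_smul_right, gerst_smul_left, gerst_smul_right,
    smul_add, smul_sub, smul_comm c]

variable (𝒜 ℒ ℳ)

/-- The identities are checked for `X`, `σ` and `∇` separately; `σ` is a connection on `A` with
symbol `σ`, so it is covered by the lemmas for `∇`. -/
theorem isGradedLie_leftPairs : IsGradedLie (leftPairs 𝒜 ℒ ℳ) (leftBracket ℒ) where
  mem hx hy := by
    rw [mem_leftPairs_iff] at *
    exact ⟨hx.1.gerstBracket hy.1, IsConnection.connBracket hx.1 hy.1 hx.2 hy.2⟩
  add_left _ _ _ := Prod.ext (Prod.ext (gerstBracket_add_left _ _ _ _ _)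
    (connBracket_add_left _ _ _ _ _ _ _ _)) (connBracket_add_left _ _ _ _ _ _ _ _)
  add_right _ _ _ := Prod.ext (Prod.ext (gerstBracket_add_right _ _ _ _ _)
    (connBracket_add_right _ _ _ _ _ _ _ _)) (connBracket_add_right _ _ _ _ _ _ _ _)
  smul_left _ _ _ := Prod.ext (Prod.ext (gerstBracket_smul_left _ _ _ _ _)
    (connBracket_smul_left _ _ _ _ _ _ _)) (connBracket_smul_left _ _ _ _ _ _ _)
  smul_right _ _ _ := Prod.ext (Prod.ext (gerstBracket_smul_right _ _ _ _ _)
    (connBracket_smul_right _ _ _ _ _ _ _)) (connBracket_smul_right _ _ _ _ _ _ _)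
  skew _ _ := Prod.ext (Prod.ext (gerstBracket_skew _ _ _ _ _)
    (connBracket_skew _ _ _ _ _ _ _)) (connBracket_skew _ _ _ _ _ _ _)
  jacobi hx hy hz := by
    rw [mem_leftPairs_iff] at hx hy hz
    exact Prod.ext (Prod.ext (gerstBracket_jacobi _ hx.1.2 hy.1.2 hz.1.2 hx.1.3 hy.1.3 hz.1.3)
      (connBracket_jacobi _ hx.1.2 hy.1.2 hz.1.2 hx.1.5.3 hy.1.5.3 hz.1.5.3))
      (connBracket_jacobi _ hx.1.2 hy.1.2 hz.1.2 hx.2.3 hy.2.3 hz.2.3)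

end Closure

/-! ### The space of forms as the direct sum of its degrees. -/

section Forms

variable {K A L P : Type*} [Field K] [Ring A] [Algebra K A] (𝒜 : ℤ → Submodule K A)
  [AddCommGroup L] [Module K L] [Module A L] (ℒ : ℤ → Submodule K L)
  [DirectSum.Decomposition ℒ]
  [AddCommGroup P] [Module K P] [Module A P] [IsScalarTower K A P] (ℳ : ℤ → Submodule K P)
  [DirectSum.Decomposition ℳ]

/-- The projection of `P` to its component of degree `j`. -/
noncomputable def degreeProj (j : ℤ) : P →ₗ[K] P :=
  (ℳ j).subtype ∘ₗ DirectSum.component K ℤ (fun i => ℳ i) j ∘ₗ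
    (DirectSum.decomposeLinearEquiv ℳ).toLinearMap

theorem degreeProj_same {j : ℤ} {p : P} (hp : p ∈ ℳ j) : degreeProj ℳ j p = p :=
  DirectSum.decompose_of_mem_same ℳ hp

theorem degreeProj_ne {i j : ℤ} {p : P} (hp : p ∈ ℳ i) (h : i ≠ j) : degreeProj ℳ j p = 0 :=
  DirectSum.decompose_of_mem_ne ℳ hp h

/-- The component of degree `e` of a family of multilinear maps. -/
noncomputable def formProj (e : ℤ) : Cochain K L P →ₗ[K] Cochain K L P where
  toFun Ω k := ofHomogeneous ℒ fun n => (degreeProj ℳ (e + ∑ i, n i)).compMultilinearMap (Ω k)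
  map_add' Ω Ω' := by
    funext k
    refine ext_homogeneous ℒ fun n ξ h => ?_
    simp [ofHomogeneous_apply ℒ _ n ξ h]
  map_smul' c Ω := by
    funext k
    refine ext_homogeneous ℒ fun n ξ h => ?_
    simp [ofHomogeneous_apply ℒ _ n ξ h]

theorem formProj_apply (e : ℤ) (Ω : Cochain K L P) {k : ℕ} (n : Fin k → ℤ) (ξ : Fin k → L)
    (h : ∀ i, ξ i ∈ ℒ (n i)) :
    formProj ℒ ℳ e Ω k ξ = degreeProj ℳ (e + ∑ i, n i) (Ω k ξ) := by
  simp [formProj, ofHomogeneous_apply ℒ _ n ξ h]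

theorem formProj_weight (e l : ℤ) {Ω : Cochain K L P} (hΩ : Ω ∈ weight K L P l) :
    formProj ℒ ℳ e Ω ∈ weight K L P l := by
  intro j hj
  refine ext_homogeneous ℒ fun n ξ h => ?_
  simp [formProj_apply ℒ ℳ e Ω n ξ h, hΩ j hj]

theorem formProj_symForm_same {e : ℤ} {Ω : Cochain K L P} (hΩ : Ω ∈ symForm 𝒜 ℒ ℳ e) :
    formProj ℒ ℳ e Ω = Ω := by
  funext k
  refine ext_homogeneous ℒ fun n ξ h => ?_
  rw [formProj_apply ℒ ℳ e Ω n ξ h]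
  exact degreeProj_same ℳ ((hΩ.2 k trivial).1.1 n ξ h)

theorem formProj_symForm_ne {e e' : ℤ} (hne : e ≠ e') {Ω : Cochain K L P}
    (hΩ : Ω ∈ symForm 𝒜 ℒ ℳ e) : formProj ℒ ℳ e' Ω = 0 := by
  funext k
  refine ext_homogeneous ℒ fun n ξ h => ?_
  rw [formProj_apply ℒ ℳ e' Ω n ξ h]
  exact degreeProj_ne ℳ ((hΩ.2 k trivial).1.1 n ξ h) (by simpa using hne)

/-- The projections recover the homogeneous components of a sum, so the degrees are independent.
This allows operators to be defined degree by degree, as their signs require. -/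
theorem formProj_lsum (e : ℤ) (x : Π₀ e, symForm 𝒜 ℒ ℳ e) :
    formProj ℒ ℳ e (DFinsupp.lsum ℕ (fun e => (symForm 𝒜 ℒ ℳ e).subtype) x) = x e := by
  induction x using DFinsupp.induction with
  | h0 => simp
  | ha i b f _ _ ih =>
    rw [map_add, map_add, ih]
    simp only [DFinsupp.lsum_single, Submodule.subtype_apply, DFinsupp.coe_add, Pi.add_apply,
      Submodule.coe_add, add_left_inj]
    by_cases h : i = e
    · subst h
      rw [DFinsupp.single_eq_same, formProj_symForm_same 𝒜 ℒ ℳ b.2]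
    · rw [DFinsupp.single_eq_of_ne (Ne.symm h), formProj_symForm_ne 𝒜 ℒ ℳ h b.2]
      rfl

theorem Sym.lsum_injective :
    Function.Injective (DFinsupp.lsum ℕ (fun e => (symForm 𝒜 ℒ ℳ e).subtype)) := by
  intro x y h
  ext1 e
  exact Subtype.ext (by rw [← formProj_lsum 𝒜 ℒ ℳ e x, ← formProj_lsum 𝒜 ℒ ℳ e y, h])

/-- `Sym_A(L, P)` is the direct sum of its homogeneous components. -/
noncomputable def Sym.equiv : (Π₀ e, symForm 𝒜 ℒ ℳ e) ≃ₗ[K] Sym 𝒜 ℒ ℳ :=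
  (LinearEquiv.ofInjective _ (Sym.lsum_injective 𝒜 ℒ ℳ)).trans
    (LinearEquiv.ofEq _ _ (Submodule.iSup_eq_range_dfinsupp_lsum _).symm)

theorem Sym.equiv_coe (x : Π₀ e, symForm 𝒜 ℒ ℳ e) : (Sym.equiv 𝒜 ℒ ℳ x : Cochain K L P) =
    DFinsupp.lsum ℕ (fun e => (symForm 𝒜 ℒ ℳ e).subtype) x := rfl

theorem Sym.equiv_single {e : ℤ} (Ω : symForm 𝒜 ℒ ℳ e) :
    Sym.equiv 𝒜 ℒ ℳ (DFinsupp.single e Ω) = Sym.of 𝒜 ℒ ℳ Ω := by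
  refine Subtype.ext ?_
  rw [Sym.equiv_coe, DFinsupp.lsum_single]
  rfl

variable {W : Type*} [AddCommGroup W] [Module K W]

theorem Sym.hom_ext {f g : Sym 𝒜 ℒ ℳ →ₗ[K] W}
    (h : ∀ (e : ℤ) (Ω : symForm 𝒜 ℒ ℳ e), f (Sym.of 𝒜 ℒ ℳ Ω) = g (Sym.of 𝒜 ℒ ℳ Ω)) : f = g := by
  have : f ∘ₗ (Sym.equiv 𝒜 ℒ ℳ).toLinearMap = g ∘ₗ (Sym.equiv 𝒜 ℒ ℳ).toLinearMap := by
    refine DFinsupp.lhom_ext fun e Ω => ?_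
    simpa [Sym.equiv_single] using h e Ω
  ext x
  have := LinearMap.congr_fun this ((Sym.equiv 𝒜 ℒ ℳ).symm x)
  simpa using this

/-- The linear map on `Sym_A(L, P)` with given values on homogeneous forms. -/
noncomputable def Sym.lift (T : (e : ℤ) → symForm 𝒜 ℒ ℳ e →ₗ[K] W) : Sym 𝒜 ℒ ℳ →ₗ[K] W :=
  DFinsupp.lsum ℕ T ∘ₗ (Sym.equiv 𝒜 ℒ ℳ).symm.toLinearMap

theorem Sym.lift_of (T : (e : ℤ) → symForm 𝒜 ℒ ℳ e →ₗ[K] W) {e : ℤ} (Ω : symForm 𝒜 ℒ ℳ e) :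
    Sym.lift 𝒜 ℒ ℳ T (Sym.of 𝒜 ℒ ℳ Ω) = T e Ω := by
  rw [Sym.lift, LinearMap.comp_apply, ← Sym.equiv_single]
  simp

/-- Projection to a degree does not change the number of entries, so statements on all forms with
`l` entries reduce to those of a single degree. -/
theorem Sym.map_mem_of_weight {l : ℤ} {S : Submodule K W} {f : Sym 𝒜 ℒ ℳ →ₗ[K] W}
    (h : ∀ (e : ℤ) (Ω : symForm 𝒜 ℒ ℳ e), (Ω : Cochain K L P) ∈ weight K L P l →
      f (Sym.of 𝒜 ℒ ℳ Ω) ∈ S) {Ω : Sym 𝒜 ℒ ℳ} (hΩ : (Ω : Cochain K L P) ∈ weight K L P l) :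
    f Ω ∈ S := by
  classical
  have e1 : Ω = Sym.equiv 𝒜 ℒ ℳ ((Sym.equiv 𝒜 ℒ ℳ).symm Ω) := by simp
  have e2 : f Ω = DFinsupp.lsum ℕ (fun e => f ∘ₗ (Sym.equiv 𝒜 ℒ ℳ).toLinearMap ∘ₗ
      DFinsupp.lsingle e) ((Sym.equiv 𝒜 ℒ ℳ).symm Ω) := by
    have : f ∘ₗ (Sym.equiv 𝒜 ℒ ℳ).toLinearMap = DFinsupp.lsum ℕ
        (fun e => f ∘ₗ (Sym.equiv 𝒜 ℒ ℳ).toLinearMap ∘ₗ DFinsupp.lsingle e) :=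
      DFinsupp.lhom_ext fun e Ω => by simp
    rw [← this]
    simp
  rw [e2, DFinsupp.lsum_apply_apply, DFinsupp.sumAddHom_apply]
  refine Submodule.dfinsuppSum_mem _ _ _ fun e _ => ?_
  simp only [LinearMap.toAddMonoidHom_coe, LinearMap.comp_apply, DFinsupp.lsingle_apply,
    LinearEquiv.coe_coe, Sym.equiv_single]
  refine h e _ ?_
  rw [← formProj_lsum 𝒜 ℒ ℳ e, ← Sym.equiv_coe, LinearEquiv.apply_symm_apply]
  exact formProj_weight ℒ ℳ e l hΩ

end Forms

/-! ### Numbers of entries. -/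

section Weight

variable {K L M N Q : Type*} [Field K] [AddCommGroup L] [Module K L] [AddCommGroup M] [Module K M]
  [AddCommGroup N] [Module K N] [AddCommGroup Q] [Module K Q]
  (ℒ : ℤ → Submodule K L) [DirectSum.Decomposition ℒ]

theorem cup_weight (B : ℤ → ℤ → M →ₗ[K] N →ₗ[K] Q) (e : ℤ) {f : Cochain K L M}
    {g : Cochain K L N} {k l : ℤ} (hf : f ∈ weight K L M k) (hg : g ∈ weight K L N l) :
    cup ℒ B e f g ∈ weight K L Q (k + l) := by
  intro j hj
  refine ext_homogeneous ℒ fun n ξ h => ?_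
  rw [cup_apply ℒ B e f g n ξ h]
  refine Finset.sum_eq_zero fun S _ => ?_
  have hc := Finset.card_add_card_compl S
  rw [Fintype.card_fin] at hc
  by_cases h1 : (S.card : ℤ) = k
  · rw [hg Sᶜ.card (by omega)]
    simp
  · rw [hf S.card h1]
    simp

theorem gerst_weight {f : Cochain K L Q} {X : Cochain K L L} {k l : ℤ}
    (hf : f ∈ weight K L Q l) (hX : X ∈ weight K L L k) :
    gerst ℒ f X ∈ weight K L Q (l + k - 1) := by
  intro j hj
  refine ext_homogeneous ℒ fun n ξ h => ?_
  rw [gerst_apply ℒ f X n ξ h]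
  refine Finset.sum_eq_zero fun S _ => ?_
  have hc := Finset.card_add_card_compl S
  rw [Fintype.card_fin] at hc
  by_cases h1 : (S.card : ℤ) = k
  · rw [hf (Sᶜ.card + 1) (by push_cast; omega)]
    simp
  · rw [hX S.card h1]
    rw [MultilinearMap.map_coord_zero _ 0 (by simp)]
    simp

/-- The component with `k` entries. -/
noncomputable def part (k : ℤ) (f : Cochain K L Q) : Cochain K L Q :=
  fun j => if (j : ℤ) = k then f j else 0

theorem part_weight (k : ℤ) (f : Cochain K L Q) : part k f ∈ weight K L Q k :=
  fun _ hj => if_neg hj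

theorem part_mem {k : ℤ} {f : Cochain K L Q}
    {S : (j : ℕ) → Submodule K (MultilinearMap K (fun _ : Fin j => L) Q)} (hf : ∀ j, f j ∈ S j)
    (j : ℕ) : part k f j ∈ S j := by
  unfold part
  split_ifs
  exacts [hf j, zero_mem _]

theorem part_finite (k : ℤ) (f : Cochain K L Q) : part k f ∈ finiteCochains K L Q := by
  refine ⟨(k + 1).toNat, fun j hj => if_neg ?_⟩
  omega

theorem ev_part (k : ℤ) (f : Cochain K L Q) (l : List (ℤ × L)) :
    ev (part k f) l = if (l.length : ℤ) = k then ev f l else 0 := by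
  unfold ev part
  split_ifs <;> rfl

/-- The shift `c` accounts for symbols and connections having one entry fewer than their
multiderivation: `c = 0` is used for `X`, and `c = -1` for `σ` and `∇`. -/
theorem sum_part {f : Cochain K L Q} {m : ℕ} (hf : ∀ k, m ≤ k → f k = 0) (c : ℤ) (N : ℕ)
    (hc : ∀ j : ℕ, j < m → ∃ i < N, (j : ℤ) = i + c) :
    ∑ i ∈ Finset.range N, part (i + c) f = f := by
  funext j
  rw [Finset.sum_apply]
  by_cases hj : j < m
  · obtain ⟨i, hi, e⟩ := hc j hj
    rw [Finset.sum_eq_single i]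
    · exact if_pos e
    · intro b _ hb
      exact if_neg (by omega)
    · intro h
      exact absurd (Finset.mem_range.2 hi) h
  · rw [hf j (not_lt.1 hj)]
    refine Finset.sum_eq_zero fun i _ => ?_
    unfold part
    split_ifs
    exacts [hf j (not_lt.1 hj), rfl]

end Weight

/-! ### The map from pairs to module derivations. -/

section Operators

variable {K A L P : Type*} [Field K] [Ring A] [Algebra K A] {𝒜 : ℤ → Submodule K A}
  [GradedAlgebra 𝒜]
  [AddCommGroup L] [Module K L] [Module A L] [IsScalarTower K A L] {ℒ : ℤ → Submodule K L}
  [DirectSum.Decomposition ℒ] [SetLike.GradedSMul 𝒜 ℒ]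
  [AddCommGroup P] [Module K P] [Module A P] [IsScalarTower K A P] {ℳ : ℤ → Submodule K P}
  [DirectSum.Decomposition ℳ] [SetLike.GradedSMul 𝒜 ℳ]

theorem chevalleyEilenberg_mem {d e : ℤ} {X : Cochain K L L} {σ : Cochain K L (Module.End K A)}
    {φ : Cochain K L (Module.End K P)} {Ω : Cochain K L P} (hX : IsMultiDer 𝒜 ℒ d X σ)
    (hφ : IsConnection 𝒜 ℒ ℳ d σ φ) (hΩ : Ω ∈ symForm 𝒜 ℒ ℳ e) :
    chevalleyEilenberg ℒ d e X φ Ω ∈ symForm 𝒜 ℒ ℳ (e + d) := by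
  rw [mem_symForm_iff] at *
  rw [chevalleyEilenberg_eq, add_comm]
  refine IsForm.ceOp (fun _ _ _ => rfl) (fun i j x m hx hm => ?_) hX hφ.isForm hφ.symbol hΩ
  rw [add_comm]
  exact hx _ _ hm

theorem chevalleyEilenberg_weight {d e : ℤ} {X : Cochain K L L}
    {φ : Cochain K L (Module.End K P)} {Ω : Cochain K L P} {k l : ℤ} (hX : X ∈ weight K L L k)
    (hφ : φ ∈ weight K L _ (k - 1)) (hΩ : Ω ∈ weight K L P l) :
    chevalleyEilenberg ℒ d e X φ Ω ∈ weight K L P (l + (k - 1)) := by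
  have h1 := cup_weight ℒ (fun _ _ => LinearMap.id (R := K) (M := Module.End K P)) e hφ hΩ
  have h2 := gerst_weight ℒ hΩ hX
  rw [add_comm] at h1
  rw [add_sub_assoc] at h2
  exact sub_mem h1 (Submodule.smul_mem _ _ h2)

/-- The operator `Ω ↦ ∇ ∘ Ω - (-1)^{d e} Ω ∘ X` on `Sym_A(L, P)`. -/
noncomputable def ceEnd {d : ℤ} {X : Cochain K L L} {σ : Cochain K L (Module.End K A)}
    {φ : Cochain K L (Module.End K P)} (hX : IsMultiDer 𝒜 ℒ d X σ)
    (hφ : IsConnection 𝒜 ℒ ℳ d σ φ) : Module.End K (Sym 𝒜 ℒ ℳ) :=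
  Sym.lift 𝒜 ℒ ℳ fun e =>
    { toFun := fun Ω => Sym.of 𝒜 ℒ ℳ
        ⟨chevalleyEilenberg ℒ d e X φ Ω, chevalleyEilenberg_mem hX hφ Ω.2⟩
      map_add' := fun Ω Ω' => Subtype.ext (by
        change chevalleyEilenberg ℒ d e X φ (Ω + Ω' : Cochain K L P) =
          chevalleyEilenberg ℒ d e X φ Ω + chevalleyEilenberg ℒ d e X φ Ω'
        simp only [chevalleyEilenberg, cup_add_right, gerst_add_left, smul_add]
        abel)
      map_smul' := fun c Ω => Subtype.ext (by
        change chevalleyEilenberg ℒ d e X φ (c • Ω : Cochain K L P) =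
          c • chevalleyEilenberg ℒ d e X φ Ω
        exact ceOp_smul ℒ _ _ _ _ _ _ _) }

theorem ceEnd_of {d e : ℤ} {X : Cochain K L L} {σ : Cochain K L (Module.End K A)}
    {φ : Cochain K L (Module.End K P)} (hX : IsMultiDer 𝒜 ℒ d X σ)
    (hφ : IsConnection 𝒜 ℒ ℳ d σ φ) (Ω : symForm 𝒜 ℒ ℳ e) :
    (ceEnd hX hφ (Sym.of 𝒜 ℒ ℳ Ω) : Cochain K L P) = chevalleyEilenberg ℒ d e X φ Ω := by
  rw [ceEnd, Sym.lift_of]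
  rfl

theorem ceEnd_hasBidegree {d k : ℤ} {X : Cochain K L L} {σ : Cochain K L (Module.End K A)}
    {φ : Cochain K L (Module.End K P)} (hX : IsMultiDer 𝒜 ℒ d X σ)
    (hφ : IsConnection 𝒜 ℒ ℳ d σ φ) (hXk : X ∈ weight K L L k)
    (hφk : φ ∈ weight K L _ (k - 1)) : HasBidegree 𝒜 ℒ ℳ d (k - 1) (ceEnd hX hφ) := by
  refine ⟨fun e Ω => ?_, fun l Ω hΩ => ?_⟩
  · rw [ceEnd_of]
    exact chevalleyEilenberg_mem hX hφ Ω.2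
  · refine Sym.map_mem_of_weight 𝒜 ℒ ℳ (S := (weight K L P (l + (k - 1))).comap
      (Sym 𝒜 ℒ ℳ).subtype) (fun e Ω hΩ => ?_) hΩ
    change (ceEnd hX hφ (Sym.of 𝒜 ℒ ℳ Ω) : Cochain K L P) ∈
      weight K L P (l + (k - 1))
    rw [ceEnd_of]
    exact chevalleyEilenberg_weight hXk hφk hΩ

theorem ceEnd_leibniz [GradedCommutative 𝒜] {d : ℤ} {X : Cochain K L L}
    {σ : Cochain K L (Module.End K A)}
    {φ : Cochain K L (Module.End K P)} (hX : IsMultiDer 𝒜 ℒ d X σ)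
    (hφ : IsConnection 𝒜 ℒ ℳ d σ φ) :
    Leibniz 𝒜 ℒ ℳ d (ceEnd hX hφ) (ceEnd hX hX.conn) := by
  intro e e' ω Ω
  rw [ceEnd_of, ceEnd_of, ceEnd_of]
  refine chevalleyEilenberg_mulCochain ℒ e' hX.degree fun s t hs ht p => ?_
  have := hφ.symbol s hs (e + degSum t) (ev ω.1 t)
    (ev_mem_of_degreeMaps (mem_symForm_iff.1 ω.2).degree ht) p
  exact this

variable (𝒜 ℒ ℳ)

/-- The pair of operators defined by an element of `𝓛(P)`. -/
noncomputable def leftPairOp (d : ℤ) :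
    leftPairs 𝒜 ℒ ℳ d →ₗ[K] Module.End K (Sym 𝒜 ℒ ℳ) × Module.End K (Sym 𝒜 ℒ 𝒜) where
  toFun x := (ceEnd (mem_leftPairs_iff.1 x.2).1 (mem_leftPairs_iff.1 x.2).2,
    ceEnd (mem_leftPairs_iff.1 x.2).1 (mem_leftPairs_iff.1 x.2).1.conn)
  map_add' x y := by
    refine Prod.ext ?_ ?_ <;>
    · refine Sym.hom_ext _ _ _ fun e Ω => Subtype.ext ?_
      simp only [Prod.fst_add, Prod.snd_add, LinearMap.add_apply, Submodule.coe_add, ceEnd_of,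
        chevalleyEilenberg, cup_add_left, gerst_add_right, smul_add]
      abel
  map_smul' c x := by
    refine Prod.ext ?_ ?_ <;>
    · refine Sym.hom_ext _ _ _ fun e Ω => Subtype.ext ?_
      simp only [Prod.smul_fst, Prod.smul_snd, LinearMap.smul_apply, Submodule.coe_smul, ceEnd_of,
        chevalleyEilenberg, cup_smul_left, gerst_smul_right, smul_sub, RingHom.id_apply,
        smul_comm c]

variable {𝒜 ℒ ℳ}

theorem leftPairOp_fst {d e : ℤ} (x : leftPairs 𝒜 ℒ ℳ d) (Ω : symForm 𝒜 ℒ ℳ e) :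
    ((leftPairOp 𝒜 ℒ ℳ d x).1 (Sym.of 𝒜 ℒ ℳ Ω) : Cochain K L P) =
      chevalleyEilenberg ℒ d e x.1.1.1 x.1.2 Ω :=
  ceEnd_of (mem_leftPairs_iff.1 x.2).1 (mem_leftPairs_iff.1 x.2).2 Ω

theorem leftPairOp_snd {d e : ℤ} (x : leftPairs 𝒜 ℒ ℳ d) (ω : symForm 𝒜 ℒ 𝒜 e) :
    ((leftPairOp 𝒜 ℒ ℳ d x).2 (Sym.of 𝒜 ℒ 𝒜 ω) : Cochain K L A) =
      eta ℒ d e x.1.1 ω :=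
  ceEnd_of (mem_leftPairs_iff.1 x.2).1 (mem_leftPairs_iff.1 x.2).1.conn ω

theorem leftPairOp_mem_modDerShift [GradedCommutative 𝒜] {d : ℤ} {k : ℕ} {x : leftPairs 𝒜 ℒ ℳ d}
    (hx : x.1 ∈ leftPairsWeight 𝒜 ℒ ℳ k d) :
    leftPairOp 𝒜 ℒ ℳ d x ∈ modDerShift 𝒜 ℒ ℳ d (k - 1) := by
  obtain ⟨h1, h2⟩ := mem_leftPairs_iff.1 x.2
  exact ⟨ceEnd_hasBidegree h1 h2 hx.2.1.1 hx.2.2, ceEnd_hasBidegree h1 h1.conn hx.2.1.1 hx.2.1.2,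
    ceEnd_leibniz h1 h1.conn, ceEnd_leibniz h1 h2⟩

theorem IsConnection.part {d : ℤ} {σ : Cochain K L (Module.End K A)}
    {φ : Cochain K L (Module.End K P)} (h : IsConnection 𝒜 ℒ ℳ d σ φ) (k : ℤ) :
    IsConnection 𝒜 ℒ ℳ d (part k σ) (part k φ) := by
  refine ⟨part_finite _ _, fun j => part_mem h.2 j, fun j => part_mem h.3 j, ?_, ?_⟩
  · intro r a ha x l hl
    simp only [ev_part, List.length_cons]
    split_ifs
    · exact h.4 r a ha x l hl
    · simp
  · intro l hl r a ha p
    simp only [ev_part]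
    split_ifs
    · exact h.5 l hl r a ha p
    · simp

/-- The Leibniz rule links the component of `X` with `j + 1` entries to that of `σ` with `j`, so the
components have to be cut out with a shift of one. -/
theorem part_mem_leftPairs {d : ℤ}
    {x : (Cochain K L L × Cochain K L (Module.End K A)) × Cochain K L (Module.End K P)}
    (hx : x ∈ leftPairs 𝒜 ℒ ℳ d) (k : ℤ) :
    ((part k x.1.1, part (k - 1) x.1.2), part (k - 1) x.2) ∈ leftPairs 𝒜 ℒ ℳ d := by
  rw [mem_leftPairs_iff] at *
  obtain ⟨h1, h2⟩ := hx
  refine ⟨⟨part_finite _ _, fun j => part_mem h1.2 j, fun j => part_mem h1.3 j, ?_,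
    h1.5.part _⟩, h2.part _⟩
  intro r a ha h l hl
  simp only [ev_part, List.length_cons, Nat.cast_add, Nat.cast_one, eq_sub_iff_add_eq]
  split_ifs
  · exact h1.4 r a ha h l hl
  · simp

/-- All families are finite, so a pair is a finite sum of pairs with a fixed number of entries, each
of which maps to a derivation with a fixed shift. -/
theorem leftPairOp_mem [GradedCommutative 𝒜] {d : ℤ} (x : leftPairs 𝒜 ℒ ℳ d) :
    leftPairOp 𝒜 ℒ ℳ d x ∈ modDer 𝒜 ℒ ℳ d := by
  obtain ⟨h1, h2⟩ := mem_leftPairs_iff.1 x.2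
  obtain ⟨a, ha⟩ := h1.finite
  obtain ⟨b, hb⟩ := h1.conn.finite
  obtain ⟨c, hc⟩ := h2.finite
  let y : ℕ → leftPairs 𝒜 ℒ ℳ d := fun i => ⟨_, part_mem_leftPairs x.2 i⟩
  -- The range covers all indices in the three supports, including the index `j + 1` needed for the
  -- members `j` of `σ` and `∇`.
  have hy : x = ∑ i ∈ Finset.range (a + b + c + 1), y i := by
    refine Subtype.ext ?_
    rw [Submodule.coe_sum]
    refine Prod.ext (Prod.ext ?_ ?_) ?_
    · rw [Prod.fst_sum, Prod.fst_sum]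
      have := sum_part ha 0 (a + b + c + 1) fun j hj => ⟨j, by omega, by omega⟩
      simp only [add_zero] at this
      exact this.symm
    · rw [Prod.fst_sum, Prod.snd_sum]
      exact (sum_part hb (-1) (a + b + c + 1) fun j hj => ⟨j + 1, by omega, by omega⟩).symm
    · rw [Prod.snd_sum]
      exact (sum_part hc (-1) (a + b + c + 1) fun j hj => ⟨j + 1, by omega, by omega⟩).symm
  rw [hy, map_sum]
  refine sum_mem fun i _ => Submodule.mem_iSup_of_mem ((i : ℤ) - 1) ?_
  exact leftPairOp_mem_modDerShift
    ⟨(y i).2, ⟨part_weight _ _, part_weight _ _⟩, part_weight _ _⟩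

end Operators

/-! ### Graded commutators of pairs of operators. -/

section Commutator

variable {K V W : Type*} [Field K] [AddCommGroup V] [Module K V] [AddCommGroup W] [Module K W]
  (i j k : ℤ) (c : K) (x x' y y' z : Module.End K V × Module.End K W)

theorem modDerBracket_add_left :
    modDerBracket i j (x + x') y = modDerBracket i j x y + modDerBracket i j x' y := by
  simp only [modDerBracket, mul_add, add_mul, smul_add]
  abel

theorem modDerBracket_add_right :
    modDerBracket i j x (y + y') = modDerBracket i j x y + modDerBracket i j x y' := by
  simp only [modDerBracket, mul_add, add_mul, smul_add]
  abel

theorem modDerBracket_smul_left :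
    modDerBracket i j (c • x) y = c • modDerBracket i j x y := by
  simp only [modDerBracket, smul_mul_assoc, mul_smul_comm, smul_sub, smul_comm c]

theorem modDerBracket_smul_right :
    modDerBracket i j x (c • y) = c • modDerBracket i j x y := by
  simp only [modDerBracket, smul_mul_assoc, mul_smul_comm, smul_sub, smul_comm c]

variable {i j x} in
theorem modDerBracket_zero_left : modDerBracket i j 0 x = 0 := by
  simp [modDerBracket]

variable {i j x} in
theorem modDerBracket_zero_right : modDerBracket i j x 0 = 0 := by
  simp [modDerBracket]

theorem modDerBracket_skew :
    modDerBracket i j x y = -((-1 : K) ^ (i * j) • modDerBracket j i y x) := by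
  simp only [modDerBracket, mul_comm j i]
  rcases neg_one_zpow_eq_or K (i * j) with h | h <;> rw [h] <;> module

theorem modDerBracket_jacobi :
    modDerBracket i (j + k) x (modDerBracket j k y z) =
      modDerBracket (i + j) k (modDerBracket i j x y) z +
        (-1 : K) ^ (i * j) • modDerBracket j (i + k) y (modDerBracket i k x z) := by
  simp only [modDerBracket, mul_add, add_mul, zpow_add₀ (show (-1 : K) ≠ 0 by simp), mul_sub,
    sub_mul, mul_smul_comm, smul_mul_assoc, mul_comm j i, mul_assoc]
  rcases neg_one_zpow_eq_or K (i * j) with h | h <;>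
  rcases neg_one_zpow_eq_or K (i * k) with h' | h' <;>
  rcases neg_one_zpow_eq_or K (j * k) with h'' | h'' <;> rw [h, h', h''] <;> module

end Commutator

/-! ### Module derivations form a graded Lie algebra, and the map preserves brackets. -/

section Derivations

variable {K A L P : Type*} [Field K] [Ring A] [Algebra K A] {𝒜 : ℤ → Submodule K A}
  [GradedAlgebra 𝒜] [GradedCommutative 𝒜]
  [AddCommGroup L] [Module K L] [Module A L] [IsScalarTower K A L] {ℒ : ℤ → Submodule K L}
  [DirectSum.Decomposition ℒ] [SetLike.GradedSMul 𝒜 ℒ]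
  [AddCommGroup P] [Module K P] [Module A P] [IsScalarTower K A P] {ℳ : ℤ → Submodule K P}
  [DirectSum.Decomposition ℳ] [SetLike.GradedSMul 𝒜 ℳ]

theorem HasBidegree.mul {d s d' s' : ℤ} {D D' : Module.End K (Sym 𝒜 ℒ ℳ)}
    (h : HasBidegree 𝒜 ℒ ℳ d s D) (h' : HasBidegree 𝒜 ℒ ℳ d' s' D') :
    HasBidegree 𝒜 ℒ ℳ (d + d') (s + s') (D * D') := by
  refine ⟨fun e Ω => ?_, fun l Ω hΩ => ?_⟩
  · have := h.1 _ ⟨_, h'.1 e Ω⟩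
    rw [add_assoc, add_comm d'] at this
    exact this
  · have h1 := h'.2 l Ω hΩ
    rw [Module.End.mul_apply]
    -- The bidegree condition on `D` concerns only natural numbers of entries; if `l + s'` is
    -- negative, then `D' Ω` vanishes.
    by_cases hn : 0 ≤ l + s'
    · obtain ⟨m, hm⟩ := Int.eq_ofNat_of_zero_le hn
      rw [hm] at h1
      have := h.2 m _ h1
      rwa [← hm, add_assoc, add_comm s'] at this
    · have h0 : D' Ω = 0 := Subtype.ext (funext fun j => h1 j (by omega))
      rw [h0, map_zero]
      exact zero_mem _

theorem Leibniz.apply {d s : ℤ} {D : Module.End K (Sym 𝒜 ℒ ℳ)}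
    {τ : Module.End K (Sym 𝒜 ℒ 𝒜)} (h : Leibniz 𝒜 ℒ ℳ d D τ) (hD : HasBidegree 𝒜 ℒ ℳ d s D)
    (hτ : HasBidegree 𝒜 ℒ 𝒜 d s τ) {e e' : ℤ} (ω : symForm 𝒜 ℒ 𝒜 e) (Ω : symForm 𝒜 ℒ ℳ e') :
    D (Sym.of 𝒜 ℒ ℳ (mulForm 𝒜 ℒ ℳ ω Ω)) =
      Sym.of 𝒜 ℒ ℳ (mulForm 𝒜 ℒ ℳ ⟨_, hτ.1 e ω⟩ Ω) +
        (-1 : K) ^ (d * e) • Sym.of 𝒜 ℒ ℳ (mulForm 𝒜 ℒ ℳ ω ⟨_, hD.1 e' Ω⟩) :=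
  Subtype.ext (h e e' ω Ω)

theorem Leibniz.mul_apply {d d' s' : ℤ} {D D' : Module.End K (Sym 𝒜 ℒ ℳ)}
    {τ τ' : Module.End K (Sym 𝒜 ℒ 𝒜)} (h : Leibniz 𝒜 ℒ ℳ d D τ)
    (h' : Leibniz 𝒜 ℒ ℳ d' D' τ') (hD' : HasBidegree 𝒜 ℒ ℳ d' s' D')
    (hτ' : HasBidegree 𝒜 ℒ 𝒜 d' s' τ') {e e' : ℤ} (ω : symForm 𝒜 ℒ 𝒜 e)
    (Ω : symForm 𝒜 ℒ ℳ e') :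
    (D (D' (Sym.of 𝒜 ℒ ℳ (mulForm 𝒜 ℒ ℳ ω Ω))) : Cochain K L P) =
      mulCochain ℒ e' (τ (τ' (Sym.of 𝒜 ℒ 𝒜 ω)) : Cochain K L A) Ω +
      (-1 : K) ^ (d * (e + d')) • mulCochain ℒ (e' + d) (τ' (Sym.of 𝒜 ℒ 𝒜 ω) : Cochain K L A)
        (D (Sym.of 𝒜 ℒ ℳ Ω) : Cochain K L P) +
      (-1 : K) ^ (d' * e) • (mulCochain ℒ (e' + d') (τ (Sym.of 𝒜 ℒ 𝒜 ω) : Cochain K L A)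
        (D' (Sym.of 𝒜 ℒ ℳ Ω) : Cochain K L P) +
      (-1 : K) ^ (d * e) • mulCochain ℒ (e' + d' + d) (ω : Cochain K L A)
        (D (D' (Sym.of 𝒜 ℒ ℳ Ω)) : Cochain K L P)) := by
  rw [h'.apply hD' hτ', map_add, map_smul, Submodule.coe_add, Submodule.coe_smul, h, h]
  rfl

theorem mulCochain_sub_left (e : ℤ) (ω ω' : Cochain K L A) (Ω : Cochain K L P) :
    mulCochain ℒ e (ω - ω') Ω = mulCochain ℒ e ω Ω - mulCochain ℒ e ω' Ω :=
  cup_sub_left ℒ _ e ω ω' Ω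

theorem mulCochain_sub_right (e : ℤ) (ω : Cochain K L A) (Ω Ω' : Cochain K L P) :
    mulCochain ℒ e ω (Ω - Ω') = mulCochain ℒ e ω Ω - mulCochain ℒ e ω Ω' :=
  cup_sub_right ℒ _ e ω Ω Ω'

/-- The terms where one of the operators acts on `ω` and the other on `Ω` occur in both products and
cancel. -/
theorem Leibniz.commutator {d s d' s' : ℤ} {D D' : Module.End K (Sym 𝒜 ℒ ℳ)}
    {τ τ' : Module.End K (Sym 𝒜 ℒ 𝒜)} (h : Leibniz 𝒜 ℒ ℳ d D τ)
    (h' : Leibniz 𝒜 ℒ ℳ d' D' τ') (hD : HasBidegree 𝒜 ℒ ℳ d s D)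
    (hτ : HasBidegree 𝒜 ℒ 𝒜 d s τ) (hD' : HasBidegree 𝒜 ℒ ℳ d' s' D')
    (hτ' : HasBidegree 𝒜 ℒ 𝒜 d' s' τ') :
    Leibniz 𝒜 ℒ ℳ (d + d') (D * D' - (-1 : K) ^ (d * d') • (D' * D))
      (τ * τ' - (-1 : K) ^ (d * d') • (τ' * τ)) := by
  intro e e' ω Ω
  simp only [LinearMap.sub_apply, LinearMap.smul_apply, Module.End.mul_apply,
    AddSubgroupClass.coe_sub, Submodule.coe_smul]
  rw [h.mul_apply h' hD' hτ', h'.mul_apply h hD hτ]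
  rw [mulCochain_sub_left, mulCochain_sub_right]
  simp only [mulCochain_smul_left, mulCochain_smul_right]
  rw [show e' + d' + d = e' + (d + d') by ring, show e' + d + d' = e' + (d + d') by ring]
  simp only [mul_add, add_mul, zpow_add₀ (show (-1 : K) ≠ 0 by simp), mul_comm d' d]
  rcases neg_one_zpow_eq_or K (d * d') with h1 | h1 <;>
  rcases neg_one_zpow_eq_or K (d * e) with h2 | h2 <;>
  rcases neg_one_zpow_eq_or K (d' * e) with h3 | h3 <;>
  rw [h1, h2, h3] <;> module

theorem HasBidegree.commutator {d s d' s' : ℤ} {D D' : Module.End K (Sym 𝒜 ℒ ℳ)}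
    (h : HasBidegree 𝒜 ℒ ℳ d s D) (h' : HasBidegree 𝒜 ℒ ℳ d' s' D') :
    HasBidegree 𝒜 ℒ ℳ (d + d') (s + s') (D * D' - (-1 : K) ^ (d * d') • (D' * D)) := by
  have h1 := h'.mul h
  rw [add_comm d', add_comm s'] at h1
  have h2 := (h.mul h').add (h1.smul (-(-1 : K) ^ (d * d')))
  have h3 : D * D' + (-(-1 : K) ^ (d * d')) • (D' * D) =
      D * D' - (-1 : K) ^ (d * d') • (D' * D) := LinearMap.ext fun Ω => Subtype.ext (by
    change (D (D' Ω) : Cochain K L P) + (-(-1 : K) ^ (d * d')) • (D' (D Ω) : Cochain K L P) =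
      (D (D' Ω) : Cochain K L P) - (-1 : K) ^ (d * d') • (D' (D Ω) : Cochain K L P)
    rw [neg_smul, sub_eq_add_neg])
  rwa [h3] at h2

theorem modDerBracket_mem_modDerShift {d s d' s' : ℤ}
    {x y : Module.End K (Sym 𝒜 ℒ ℳ) × Module.End K (Sym 𝒜 ℒ 𝒜)}
    (hx : x ∈ modDerShift 𝒜 ℒ ℳ d s) (hy : y ∈ modDerShift 𝒜 ℒ ℳ d' s') :
    modDerBracket d d' x y ∈ modDerShift 𝒜 ℒ ℳ (d + d') (s + s') := by
  obtain ⟨h1, h2, h3, h4⟩ := hx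
  obtain ⟨g1, g2, g3, g4⟩ := hy
  exact ⟨h1.commutator g1, h2.commutator g2, h3.commutator g3 h2 h2 g2 g2,
    h4.commutator g4 h1 h2 g1 g2⟩

theorem modDerBracket_mem {d d' : ℤ}
    {x y : Module.End K (Sym 𝒜 ℒ ℳ) × Module.End K (Sym 𝒜 ℒ 𝒜)}
    (hx : x ∈ modDer 𝒜 ℒ ℳ d) (hy : y ∈ modDer 𝒜 ℒ ℳ d') :
    modDerBracket d d' x y ∈ modDer 𝒜 ℒ ℳ (d + d') := by
  refine Submodule.iSup_induction _ (motive := fun x => modDerBracket d d' x y ∈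
    modDer 𝒜 ℒ ℳ (d + d')) hx (fun s x hx => ?_) ?_ (fun x x' hx hx' => ?_)
  · refine Submodule.iSup_induction _ (motive := fun y => modDerBracket d d' x y ∈
      modDer 𝒜 ℒ ℳ (d + d')) hy (fun s' y hy => ?_) ?_ (fun y y' hy hy' => ?_)
    · exact Submodule.mem_iSup_of_mem _ (modDerBracket_mem_modDerShift hx hy)
    · rw [modDerBracket_zero_right]
      exact zero_mem _
    · rw [modDerBracket_add_right]
      exact add_mem hy hy'
  · rw [modDerBracket_zero_left]
    exact zero_mem _
  · rw [modDerBracket_add_left]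
    exact add_mem hx hx'

variable (𝒜 ℒ ℳ)

theorem isGradedLie_modDer : IsGradedLie (modDer 𝒜 ℒ ℳ) modDerBracket where
  mem := modDerBracket_mem
  add_left _ _ _ := modDerBracket_add_left _ _ _ _ _
  add_right _ _ _ := modDerBracket_add_right _ _ _ _ _
  smul_left _ _ _ := modDerBracket_smul_left _ _ _ _ _
  smul_right _ _ _ := modDerBracket_smul_right _ _ _ _ _
  skew _ _ := modDerBracket_skew _ _ _ _
  jacobi _ _ _ := modDerBracket_jacobi _ _ _ _ _ _

variable {𝒜 ℒ ℳ}

/-- This is `ceOp_commutator` for the evaluation action of `End P` on `P`. -/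
theorem ceEnd_commutator {d d' : ℤ} {X X' : Cochain K L L} {σ σ' : Cochain K L (Module.End K A)}
    {φ φ' : Cochain K L (Module.End K P)} (hX : IsMultiDer 𝒜 ℒ d X σ)
    (hX' : IsMultiDer 𝒜 ℒ d' X' σ') (hφ : IsConnection 𝒜 ℒ ℳ d σ φ)
    (hφ' : IsConnection 𝒜 ℒ ℳ d' σ' φ') :
    ceEnd (hX.gerstBracket hX') (hφ.connBracket hX hX' hφ') =
      ceEnd hX hφ * ceEnd hX' hφ' - (-1 : K) ^ (d * d') • (ceEnd hX' hφ' * ceEnd hX hφ) := by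
  refine Sym.hom_ext _ _ _ fun e Ω => Subtype.ext ?_
  have h1 : ceEnd hX hφ (Sym.of 𝒜 ℒ ℳ Ω) =
    Sym.of 𝒜 ℒ ℳ ⟨_, chevalleyEilenberg_mem hX hφ Ω.2⟩ := Subtype.ext (ceEnd_of hX hφ Ω)
  have h2 : ceEnd hX' hφ' (Sym.of 𝒜 ℒ ℳ Ω) =
    Sym.of 𝒜 ℒ ℳ ⟨_, chevalleyEilenberg_mem hX' hφ' Ω.2⟩ := Subtype.ext (ceEnd_of hX' hφ' Ω)
  change _ = (ceEnd hX hφ (ceEnd hX' hφ' (Sym.of 𝒜 ℒ ℳ Ω)) : Cochain K L P) -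
    (-1 : K) ^ (d * d') • (ceEnd hX' hφ' (ceEnd hX hφ (Sym.of 𝒜 ℒ ℳ Ω)) : Cochain K L P)
  rw [h1, h2, ceEnd_of, ceEnd_of, ceEnd_of]
  have := ceOp_commutator ℒ (LinearMap.id (R := K) (M := Module.End K P)) (fun _ _ _ => rfl) e
    φ φ' hX.degree hX'.degree (mem_symForm_iff.1 Ω.2).symm
  exact this.symm

theorem leftPairOp_leftBracket {d d' : ℤ} (x : leftPairs 𝒜 ℒ ℳ d) (y : leftPairs 𝒜 ℒ ℳ d') :
    leftPairOp 𝒜 ℒ ℳ (d + d') ⟨leftBracket ℒ d d' x y,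
      (isGradedLie_leftPairs 𝒜 ℒ ℳ).mem x.2 y.2⟩ =
      modDerBracket d d' (leftPairOp 𝒜 ℒ ℳ d x) (leftPairOp 𝒜 ℒ ℳ d' y) := by
  obtain ⟨h1, h2⟩ := mem_leftPairs_iff.1 x.2
  obtain ⟨g1, g2⟩ := mem_leftPairs_iff.1 y.2
  exact Prod.ext (ceEnd_commutator h1 g1 h2 g2) (ceEnd_commutator h1 g1 h1.conn g1.conn)

end Derivations

/-! ### Unshuffles with a short part, contractions, and forms without entries. -/

section Unshuffles

variable {K L Q : Type*} [Field K] [AddCommGroup L] [Module K L] [AddCommGroup Q] [Module K Q]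

theorem unshuffleSum_eq_zero {F : List (ℤ × L) → List (ℤ × L) → Q} (h : ∀ s t, F s t = 0)
    (l : List (ℤ × L)) : unshuffleSum K l F = 0 := by
  rw [show F = fun _ _ => 0 from funext₂ h, unshuffleSum_zero]

theorem unshuffleSum_of_right_nil {F : List (ℤ × L) → List (ℤ × L) → Q}
    (h : ∀ s t, t ≠ [] → F s t = 0) (l : List (ℤ × L)) : unshuffleSum K l F = F l [] := by
  induction l generalizing F with
  | nil => rfl
  | cons a l ih =>
    rw [unshuffleSum_cons, ih fun s t ht => h _ t ht, unshuffleSum_eq_zero, add_zero]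
    intro s t
    rw [h s (a :: t) (by simp), smul_zero]

theorem unshuffleSum_of_left_nil {F : List (ℤ × L) → List (ℤ × L) → Q}
    (h : ∀ s t, s ≠ [] → F s t = 0) (l : List (ℤ × L)) : unshuffleSum K l F = F [] l := by
  induction l generalizing F with
  | nil => rfl
  | cons a l ih =>
    rw [unshuffleSum_cons, unshuffleSum_eq_zero fun s t => h _ t (by simp), zero_add, ih]
    · simp
    · intro s t hs
      rw [h s _ hs, smul_zero]

/-- Insertion of `x` as the first argument. -/
def contract (x : L) : Cochain K L Q →ₗ[K] Cochain K L Q where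
  toFun f k := (f (k + 1)).curryLeft x
  map_add' _ _ := rfl
  map_smul' _ _ := rfl

theorem ev_contract (f : Cochain K L Q) (h : ℤ × L) (l : List (ℤ × L)) :
    ev (contract h.2 f) l = ev f (h :: l) := by
  rw [ev_cons]
  rfl

theorem contract_symm {ℒ : ℤ → Submodule K L} [DirectSum.Decomposition ℒ] {f : Cochain K L Q}
    (hf : ∀ k, f k ∈ gradedSymmetric ℒ k) {x : L} (k : ℕ) :
    contract x f k ∈ gradedSymmetric ℒ k := by
  intro m ξ h i j hij
  exact LinearMap.congr_fun (headCochain_gradedSymmetric ℒ hf k m ξ h i j hij) x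

/-- There are `l.length` ways to extract one entry, and symmetry of `f` cancels the Koszul sign of
pulling that entry to the front, so all contributions are equal. -/
theorem unshuffleSum_of_left_single {ℒ : ℤ → Submodule K L} [DirectSum.Decomposition ℒ] {f : Cochain K L Q}
    (hf : ∀ k, f k ∈ gradedSymmetric ℒ k) {F : List (ℤ × L) → List (ℤ × L) → Q}
    (h : ∀ s t, s.length ≠ 1 → F s t = 0)
    (hF : ∀ a t, Homog ℒ (a :: t) → F [a] t = ev f (a :: t)) {l : List (ℤ × L)}
    (hl : Homog ℒ l) : unshuffleSum K l F = (l.length : K) • ev f l := by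
  induction l generalizing F f with
  | nil => simpa [unshuffleSum_nil] using h [] [] (by simp)
  | cons a l ih =>
    obtain ⟨ha, hl'⟩ := homog_cons.1 hl
    rw [unshuffleSum_cons, unshuffleSum_of_left_nil
      (fun s t hs => h (a :: s) t (by simpa using hs)), hF a l hl,
      -- If `a` is not the extracted entry it remains a fixed argument, so the induction runs with
      -- `f` contracted by `a`.
      ih (f := contract a.2 f) (contract_symm hf) (fun s t hs => by
        rw [h s _ hs, smul_zero]) (fun b t hbt => ?_) hl', ev_contract]
    · simp only [List.length_cons, Nat.cast_add, Nat.cast_one, add_smul, one_smul]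
      rw [add_comm]
    · obtain ⟨hb, ht⟩ := homog_cons.1 hbt
      rw [hF b _ (by simp [ha, hb, ht]), ev_contract, ev_swap_head hf ha hb ht, degSum_cons,
        degSum_nil, add_zero, smul_smul, neg_one_zpow_mul_self, one_smul]

/-- The form without entries with value `q`. -/
def zeroForm : Q →ₗ[K] Cochain K L Q where
  toFun q k := match k with
    | 0 => MultilinearMap.constOfIsEmpty K _ q
    | _ + 1 => 0
  map_add' q q' := by
    funext k
    cases k
    · rfl
    · exact (add_zero _).symm
  map_smul' c q := by
    funext k
    cases k
    · rfl
    · exact (smul_zero c).symm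

theorem ev_zeroForm_nil (q : Q) : ev (zeroForm (K := K) (L := L) q) [] = q := rfl

theorem ev_zeroForm_cons (q : Q) (h : ℤ × L) (l : List (ℤ × L)) :
    ev (zeroForm (K := K) q) (h :: l) = 0 := rfl

theorem ev_zeroForm_of_ne (q : Q) {l : List (ℤ × L)} (h : l ≠ []) :
    ev (zeroForm (K := K) q) l = 0 := by
  obtain ⟨a, t, rfl⟩ := List.exists_cons_of_ne_nil h
  rfl

theorem zeroForm_weight (q : Q) : zeroForm q ∈ weight K L Q 0 := by
  intro j hj
  cases j
  · simp at hj
  · rfl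

theorem eq_zeroForm_of_weight {f : Cochain K L Q} (hf : f ∈ weight K L Q 0) :
    f = zeroForm (ev f []) := by
  funext j
  cases j with
  | zero =>
    ext ξ
    exact congrArg (f 0) (Subsingleton.elim _ _)
  | succ j => exact hf _ (by push_cast; omega)

theorem finite_of_weight {f : Cochain K L Q} {k : ℤ} (hf : f ∈ weight K L Q k) :
    f ∈ finiteCochains K L Q :=
  ⟨(k + 1).toNat, fun j hj => hf j (by omega)⟩

theorem ev_of_weight {f : Cochain K L Q} {k : ℤ} (hf : f ∈ weight K L Q k) {l : List (ℤ × L)}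
    (hl : (l.length : ℤ) ≠ k) : ev f l = 0 := by
  rw [ev, hf _ hl]
  rfl

end Unshuffles

/-! ### Euler identity and uniqueness of derivations on generators. -/

section Generation

variable {K A L P : Type*} [Field K] [Ring A] [Algebra K A] {𝒜 : ℤ → Submodule K A}
  [GradedAlgebra 𝒜]
  [AddCommGroup L] [Module K L] [Module A L] [IsScalarTower K A L] {ℒ : ℤ → Submodule K L}
  [DirectSum.Decomposition ℒ] [SetLike.GradedSMul 𝒜 ℒ]
  [AddCommGroup P] [Module K P] [Module A P] [IsScalarTower K A P] {ℳ : ℤ → Submodule K P}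
  [SetLike.GradedSMul 𝒜 ℳ]

theorem zeroForm_mem {e : ℤ} {p : P} (hp : p ∈ ℳ e) : zeroForm p ∈ symForm 𝒜 ℒ ℳ e := by
  rw [mem_symForm_iff]
  refine ⟨finite_of_weight (zeroForm_weight p), fun k => degreeMaps_of_ev_mem (fun l _ => ?_) k,
    fun k => ?_, fun r a _ h l _ => ?_⟩
  · cases l
    · simpa [ev_zeroForm_nil] using hp
    · exact zero_mem _
  · cases k
    · exact gradedSymmetric_weight_zero
    · exact zero_mem _
  · rw [ev_zeroForm_cons, ev_zeroForm_cons, smul_zero, smul_zero]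

theorem contract_mem {e n : ℤ} {x : L} (hx : x ∈ ℒ n) {Ω : Cochain K L P}
    (hΩ : Ω ∈ symForm 𝒜 ℒ ℳ e) : contract x Ω ∈ symForm 𝒜 ℒ ℳ (e + n) := by
  rw [mem_symForm_iff] at *
  refine ⟨?_, fun k => degreeMaps_of_ev_mem (fun l hl => ?_) k,
    fun k => contract_symm hΩ.symm k, fun r a ha h l hl => ?_⟩
  · obtain ⟨N, hN⟩ := hΩ.finite
    refine ⟨N, fun k hk => ?_⟩
    change (Ω (k + 1)).curryLeft x = 0
    rw [hN _ (by omega)]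
    rfl
  · rw [ev_contract Ω (n, x), add_assoc]
    have := ev_mem_of_degreeMaps hΩ.degree (homog_cons (h := (n, x)).2 ⟨hx, hl⟩)
    rwa [degSum_cons] at this
  · obtain ⟨hh, hl'⟩ := homog_cons.1 hl
    rw [ev_contract Ω (n, x), ev_contract Ω (n, x),
      ev_swap_head hΩ.symm (a := (r + h.1, a • h.2)) (SetLike.GradedSMul.smul_mem ha hh) hx hl',
      hΩ.linear r a ha h _ (by simp [hh, hx, hl']), ev_swap_head hΩ.symm (a := h) hh hx hl',
      smul_comm a (_ : K)]
    simp only [smul_smul, neg_one_zpow_mul]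
    exact zpow_smul_congr (by grind) rfl

theorem contract_weight {x : L} {Ω : Cochain K L P} {k : ℤ} (hΩ : Ω ∈ weight K L P (k + 1)) :
    contract x Ω ∈ weight K L P k := by
  intro j hj
  change (Ω (j + 1)).curryLeft x = 0
  rw [hΩ _ (by push_cast; omega)]
  rfl

variable (𝒜 ℒ) in
/-- Homogeneous generators `b i` of `L`, of degrees `g i`, and one-forms `θ i` of degrees `-g i`
with `ζ = ∑ i, (-1) ^ (g i |ζ|) θ i (ζ) b i`. -/
structure IsDualBasis {ι : Type*} [Fintype ι] (g : ι → ℤ) (b : ι → L) (θ : ι → Cochain K L A) :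
    Prop where
  mem : ∀ i, b i ∈ ℒ (g i)
  form : ∀ i, θ i ∈ symForm 𝒜 ℒ 𝒜 (-g i)
  weight : ∀ i, θ i ∈ weight K L A 1
  sum : ∀ (n : ℤ) (ζ : L), ζ ∈ ℒ n → ∑ i, (-1 : K) ^ (g i * n) • ev (θ i) [(n, ζ)] • b i = ζ

variable {ι : Type*} [Fintype ι] {g : ι → ℤ} {b : ι → L} {θ : ι → Cochain K L A}

/-- The first argument is expanded in the generators, and linearity of `Ω` pulls the coefficients
out; the signs come from that. -/
theorem IsDualBasis.sum_apply (hb : IsDualBasis 𝒜 ℒ g b θ) {e : ℤ} {Ω : Cochain K L P}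
    (hΩ : HeadLinear 𝒜 ℒ e Ω) {h : ℤ × L} {t : List (ℤ × L)} (ht : Homog ℒ (h :: t)) :
    ∑ i, (-1 : K) ^ (g i * (e + h.1)) • (-1 : K) ^ (e * h.1) •
      ev (θ i) [h] • ev Ω ((g i, b i) :: t) = ev Ω (h :: t) := by
  obtain ⟨hh, ht'⟩ := homog_cons.1 ht
  conv_rhs => rw [ev_cons, ← hb.sum h.1 h.2 hh, map_sum]
  refine Finset.sum_congr rfl fun i _ => ?_
  have h1 := ev_mem_of_degreeMaps (mem_symForm_iff.1 (hb.form i)).degree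
    (l := [h]) (by simpa [Homog.nil] using hh)
  rw [map_smul, hΩ.evHead h1 (hb.mem i) ht', ev_cons Ω t (g i, b i)]
  simp only [smul_smul _ _ (_ : P), neg_one_zpow_mul, degSum_cons, degSum_nil]
  exact zpow_smul_congr (by grind) rfl

/-- The `θ i` have one entry, so only unshuffles with a single entry in the first part survive. Each
contributes `Ω` itself by the dual basis expansion, and there are `k` of them. -/
theorem IsDualBasis.euler (hb : IsDualBasis 𝒜 ℒ g b θ) {e : ℤ} {k : ℕ} {Ω : Cochain K L P}
    (hΩ : Ω ∈ symForm 𝒜 ℒ ℳ e) (hk : Ω ∈ GradedLR.weight K L P k) :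
    ∑ i, (-1 : K) ^ (g i * e) • mulCochain ℒ (e + g i) (θ i) (contract (b i) Ω) =
      (k : K) • Ω := by
  rw [mem_symForm_iff] at hΩ
  refine ext_ev ℒ fun l hl => ?_
  -- Since `Ω` vanishes on lists of other lengths, `k` may be replaced by the length of the list.
  have h1 : ev ((k : K) • Ω) l = (l.length : K) • ev Ω l := by
    rw [ev_smul]
    by_cases h : l.length = k
    · rw [h]
    · rw [ev_of_weight hk (by exact_mod_cast h), smul_zero, smul_zero]
  rw [h1, ev_sum, ← unshuffleSum_of_left_single hΩ.symm (F := fun s t => ∑ i,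
    (-1 : K) ^ (g i * e) • (-1 : K) ^ ((e + g i) * degSum s) • ev (θ i) s •
      ev Ω ((g i, b i) :: t)) ?_ ?_ hl, unshuffleSum_sum]
  · refine Finset.sum_congr rfl fun i _ => ?_
    rw [ev_smul, mulCochain, ev_cup _ _ _ _ _ hl, unshuffleSum_smul]
    simp only [ev_contract Ω (g i, b i)]
    rfl
  · intro s t hs
    refine Finset.sum_eq_zero fun i _ => ?_
    rw [ev_of_weight (hb.weight i) (by exact_mod_cast hs), zero_smul, smul_zero, smul_zero]
  · intro a t hat
    rw [← hb.sum_apply hΩ.linear hat]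
    refine Finset.sum_congr rfl fun i _ => ?_
    simp only [smul_smul _ _ (_ : P), neg_one_zpow_mul, degSum_cons, degSum_nil]
    exact zpow_smul_congr (by grind) rfl

theorem part_mem_symForm {e : ℤ} {Ω : Cochain K L P} (hΩ : Ω ∈ symForm 𝒜 ℒ ℳ e) (k : ℤ) :
    part k Ω ∈ symForm 𝒜 ℒ ℳ e :=
  ⟨part_finite _ _, fun j _ => part_mem (fun j => hΩ.2 j trivial) j⟩

variable [DirectSum.Decomposition ℳ] [GradedCommutative 𝒜] [CharZero K]

/-- Induction on the number of entries: by the Euler identity and the Leibniz rule, `(k + 1) • D Ω`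
is a sum of terms containing `τ (θ i)` or `D` of a form with fewer entries. Characteristic zero is
needed to divide by `k + 1`. -/
theorem IsDualBasis.eq_zero_of_leibniz (hb : IsDualBasis 𝒜 ℒ g b θ) {d : ℤ}
    {D : Module.End K (Sym 𝒜 ℒ ℳ)} {τ : Module.End K (Sym 𝒜 ℒ 𝒜)} (h : Leibniz 𝒜 ℒ ℳ d D τ)
    (hτ : ∀ i, τ (Sym.of 𝒜 ℒ 𝒜 ⟨θ i, hb.form i⟩) = 0)
    (hD : ∀ (e : ℤ) (p : P) (hp : p ∈ ℳ e), D (Sym.of 𝒜 ℒ ℳ ⟨_, zeroForm_mem hp⟩) = 0) :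
    D = 0 := by
  have key : ∀ (k : ℕ) (e : ℤ) (Ω : symForm 𝒜 ℒ ℳ e), (Ω : Cochain K L P) ∈ GradedLR.weight K L P k →
      D (Sym.of 𝒜 ℒ ℳ Ω) = 0 := by
    intro k
    induction k with
    | zero =>
      intro e Ω hΩ
      have h1 : ev (Ω : Cochain K L P) [] ∈ ℳ e := by
        simpa using ev_mem_of_degreeMaps (mem_symForm_iff.1 Ω.2).degree (l := []) (Homog.nil ℒ)
      rw [← hD e _ h1]
      congr 2
      exact Subtype.ext (eq_zeroForm_of_weight (by simpa using hΩ))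
    | succ k ih =>
      intro e Ω hΩ
      have h1 : ((k + 1 : ℕ) : K) • Sym.of 𝒜 ℒ ℳ Ω = ∑ i, (-1 : K) ^ (g i * e) •
          Sym.of 𝒜 ℒ ℳ (mulForm 𝒜 ℒ ℳ ⟨θ i, hb.form i⟩ ⟨_, contract_mem (hb.mem i) Ω.2⟩) := by
        refine Subtype.ext ?_
        rw [Submodule.coe_sum]
        exact (hb.euler Ω.2 hΩ).symm
      have h2 : ((k + 1 : ℕ) : K) • D (Sym.of 𝒜 ℒ ℳ Ω) = 0 := by
        rw [← map_smul, h1, map_sum]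
        refine Finset.sum_eq_zero fun i _ => ?_
        rw [map_smul]
        refine (congrArg _ (Subtype.ext ?_)).trans (smul_zero _)
        rw [h, hτ, ih _ ⟨_, contract_mem (hb.mem i) Ω.2⟩
          (contract_weight (by exact_mod_cast hΩ))]
        have e1 := mulCochain_smul_left ℒ (e + g i) (0 : K) (0 : Cochain K L A)
          (contract (b i) (Ω : Cochain K L P))
        have e2 := mulCochain_smul_right ℒ (e + g i + d) (0 : K) (θ i) (0 : Cochain K L P)
        simp only [zero_smul] at e1 e2
        simp only [ZeroMemClass.coe_zero, e1, e2, smul_zero, add_zero]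
      exact (smul_eq_zero.1 h2).resolve_left (by exact_mod_cast k.succ_ne_zero)
  refine Sym.hom_ext _ _ _ fun e Ω => ?_
  obtain ⟨N, hN⟩ := (mem_symForm_iff.1 Ω.2).finite
  -- A form of fixed degree is the finite sum of its components with a fixed number of entries.
  have h1 : Sym.of 𝒜 ℒ ℳ Ω = ∑ i ∈ Finset.range N,
      Sym.of 𝒜 ℒ ℳ ⟨_, part_mem_symForm Ω.2 i⟩ := by
    refine Subtype.ext ?_
    rw [Submodule.coe_sum]
    have := sum_part hN 0 N fun j hj => ⟨j, hj, by simp⟩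
    simp only [add_zero] at this
    exact this.symm
  rw [h1, map_sum]
  exact Finset.sum_eq_zero fun i _ => key i e _ (part_weight _ _)

end Generation

/-! ### Maps given degree by degree, and one-forms. -/

section GradedLift

variable {K L Q : Type*} [Field K] [AddCommGroup L] [Module K L] [AddCommGroup Q] [Module K Q]
  (ℒ : ℤ → Submodule K L) [DirectSum.Decomposition ℒ]

/-- The linear map which agrees with `T n` on elements of degree `n`. -/
noncomputable def gradedLift (T : ℤ → L →ₗ[K] Q) : L →ₗ[K] Q :=
  DirectSum.toModule K ℤ Q (fun n => T n ∘ₗ (ℒ n).subtype) ∘ₗ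
    (DirectSum.decomposeLinearEquiv ℒ).toLinearMap

theorem gradedLift_of_mem (T : ℤ → L →ₗ[K] Q) {n : ℤ} {x : L} (hx : x ∈ ℒ n) :
    gradedLift ℒ T x = T n x := by
  rw [gradedLift, LinearMap.comp_apply, LinearEquiv.coe_coe,
    DirectSum.decomposeLinearEquiv_apply, DirectSum.decompose_of_mem ℒ hx]
  exact DirectSum.toModule_lof K n _

/-- The form with one entry given by a linear map. -/
def oneForm (f : L →ₗ[K] Q) : Cochain K L Q
  | 0 => 0
  | 1 => MultilinearMap.ofSubsingleton K L Q 0 f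
  | _ + 2 => 0

theorem ev_oneForm (f : L →ₗ[K] Q) (h : ℤ × L) : ev (oneForm f) [h] = f h.2 := rfl

theorem oneForm_weight (f : L →ₗ[K] Q) : oneForm f ∈ weight K L Q 1 := by
  intro j hj
  match j with
  | 0 => rfl
  | 1 => simp at hj
  | _ + 2 => rfl

end GradedLift

/-! ### Homogeneous dual bases of finitely generated projective modules. -/

section DualBasis

variable {K A L P : Type*} [Field K] [Ring A] [Algebra K A] {𝒜 : ℤ → Submodule K A}
  [GradedAlgebra 𝒜]
  [AddCommGroup L] [Module K L] [Module A L] [IsScalarTower K A L] {ℒ : ℤ → Submodule K L}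
  [DirectSum.Decomposition ℒ] [SetLike.GradedSMul 𝒜 ℒ]
  [AddCommGroup P] [Module K P] [Module A P] [IsScalarTower K A P] {ℳ : ℤ → Submodule K P}
  [SetLike.GradedSMul 𝒜 ℳ]

theorem oneForm_mem {e : ℤ} {f : L →ₗ[K] P} (hd : ∀ n, ∀ ζ ∈ ℒ n, f ζ ∈ ℳ (e + n))
    (hl : ∀ r, ∀ a ∈ 𝒜 r, ∀ n, ∀ ζ ∈ ℒ n, f (a • ζ) = (-1 : K) ^ (r * e) • a • f ζ) :
    oneForm f ∈ symForm 𝒜 ℒ ℳ e := by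
  rw [mem_symForm_iff]
  refine ⟨finite_of_weight (oneForm_weight f), fun k => degreeMaps_of_ev_mem (fun l h => ?_) k,
    fun k => ?_, fun r a ha h l hh => ?_⟩
  · match l with
    | [] => exact zero_mem _
    | [h'] =>
      rw [ev_oneForm, degSum_cons, degSum_nil, add_zero]
      exact hd _ _ (homog_cons.1 h).1
    | _ :: _ :: _ => exact zero_mem _
  · match k with
    | 0 => exact zero_mem _
    | 1 =>
      intro n ξ h i j hij
      omega
    | _ + 2 => exact zero_mem _
  · match l with
    | [] =>
      rw [ev_oneForm, ev_oneForm]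
      exact hl r a ha h.1 h.2 (homog_cons.1 hh).1
    | _ :: _ =>
      change (0 : P) = _ • a • (0 : P)
      rw [smul_zero, smul_zero]

theorem degreeProj_smul {m n : ℤ} (a : A) {x : P} [DirectSum.Decomposition ℳ] (hx : x ∈ ℳ m) :
    degreeProj ℳ n (a • x) = degreeProj 𝒜 (n - m) a • x := by
  refine DirectSum.Decomposition.inductionOn 𝒜 ?_ ?_ ?_ a
  · simp
  · intro r a
    have h := SetLike.GradedSMul.smul_mem a.2 hx
    rw [vadd_eq_add] at h
    by_cases hr : r + m = n
    · subst hr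
      rw [degreeProj_same ℳ h, add_sub_cancel_right, degreeProj_same 𝒜 a.2]
    · rw [degreeProj_ne ℳ h hr, degreeProj_ne 𝒜 a.2 (by omega), zero_smul]
  · intro a a' h h'
    rw [add_smul, map_add, map_add, add_smul, h, h']

theorem degreeProj_mem (j : ℤ) (x : P) [DirectSum.Decomposition ℳ] : degreeProj ℳ j x ∈ ℳ j :=
  (DirectSum.decompose ℳ x j).2

theorem degreeProj_mul {r m : ℤ} {a : A} (ha : a ∈ 𝒜 r) (x : P) [DirectSum.Decomposition ℳ] :
    degreeProj ℳ (r + m) (a • x) = a • degreeProj ℳ m x := by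
  refine DirectSum.Decomposition.inductionOn ℳ ?_ ?_ ?_ x
  · simp
  · intro j x
    have h := SetLike.GradedSMul.smul_mem ha x.2
    rw [vadd_eq_add] at h
    by_cases hr : j = m
    · subst hr
      rw [degreeProj_same ℳ h, degreeProj_same ℳ x.2]
    · rw [degreeProj_ne ℳ h (by omega), degreeProj_ne ℳ x.2 hr, smul_zero]
  · intro x x' h h'
    rw [smul_add, map_add, map_add, smul_add, h, h']

variable (𝒜 ℒ) in
-- An ungraded splitting `s` of a surjection from a free module suffices. The images `x j` of the
-- standard basis are split into homogeneous components, and the component of degree `m` is paired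
-- with the degree `-m` part of the coordinate `s j`. Taking the part of degree `n` in `ζ = ∑ s j
-- (ζ) x j` gives the expansion.
theorem exists_isDualBasis [Module.Projective A L] [Module.Finite A L] :
    ∃ (ι : Type) (_ : Fintype ι) (g : ι → ℤ) (b : ι → L) (θ : ι → Cochain K L A),
      IsDualBasis 𝒜 ℒ g b θ := by
  classical
  obtain ⟨N, f, s, -, -, hfs⟩ := Module.Finite.exists_comp_eq_id_of_projective A L
  let x : Fin N → L := fun j => f (Pi.single j 1)
  have hx : ∀ ζ, ζ = ∑ j, s ζ j • x j := fun ζ => by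
    conv_lhs => rw [← LinearMap.id_apply (R := A) ζ, ← hfs, LinearMap.comp_apply,
      pi_eq_sum_univ' (s ζ), map_sum]
    refine Finset.sum_congr rfl fun j _ => ?_
    rw [map_smul]
  let φ : Fin N → L →ₗ[K] A := fun j => (LinearMap.proj j ∘ₗ s).restrictScalars K
  have hφ : ∀ j (a : A) ζ, φ j (a • ζ) = a • φ j ζ := fun j a ζ => by simp [φ]
  -- The sign turns a coordinate that is linear without signs into a graded linear map of degree
  -- `-m`.
  let T : ℤ → Fin N → L →ₗ[K] A := fun m j =>
    gradedLift ℒ fun n => (-1 : K) ^ (m * n) • degreeProj 𝒜 (-m + n) ∘ₗ φ j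
  have hT : ∀ m j n, ∀ ζ ∈ ℒ n,
      T m j ζ = (-1 : K) ^ (m * n) • degreeProj 𝒜 (-m + n) (φ j ζ) := fun m j n ζ hζ =>
    gradedLift_of_mem ℒ _ hζ
  -- One generator for each nonzero homogeneous component of each `x j`.
  refine ⟨Σ j : Fin N, {m // m ∈ (DirectSum.decompose ℒ (x j)).support}, inferInstance,
    fun i => i.2, fun i => DirectSum.decompose ℒ (x i.1) i.2,
    fun i => oneForm (T i.2 i.1), fun i => SetLike.coe_mem _, fun i => oneForm_mem ?_ ?_,
    fun i => oneForm_weight _, ?_⟩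
  · intro n ζ hζ
    rw [hT _ _ n ζ hζ]
    exact Submodule.smul_mem _ _ (degreeProj_mem _ _)
  · intro r a ha n ζ hζ
    have h := SetLike.GradedSMul.smul_mem ha hζ
    rw [vadd_eq_add] at h
    rw [hT _ _ _ _ h, hT _ _ _ _ hζ, hφ, show ∀ m, -m + (r + n) = r + (-m + n) by intro m; ring,
      degreeProj_mul ha, smul_comm a (_ : K)]
    simp only [smul_smul _ _ (_ : A), neg_one_zpow_mul]
    exact zpow_smul_congr (by grind) rfl
  · intro n ζ hζ
    rw [Fintype.sum_sigma]
    conv_rhs => rw [← degreeProj_same ℒ hζ, hx ζ, map_sum]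
    refine Finset.sum_congr rfl fun j _ => ?_
    conv_rhs => rw [← DirectSum.sum_support_decompose ℒ (x j), Finset.smul_sum, map_sum,
      ← Finset.sum_coe_sort]
    refine Finset.sum_congr rfl fun m _ => ?_
    rw [ev_oneForm, hT _ _ n ζ hζ, smul_assoc, smul_smul, neg_one_zpow_mul_self, one_smul,
      degreeProj_smul (𝒜 := 𝒜) _ (SetLike.coe_mem _), sub_eq_neg_add]
    rfl

end DualBasis

/-! ### Sign twists of forms. -/

section SignTwist

variable {K L Q : Type*} [Field K] [AddCommGroup L] [Module K L] [AddCommGroup Q] [Module K Q]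
  (ℒ : ℤ → Submodule K L) [DirectSum.Decomposition ℒ]

/-- Multiplication of the values of a form with `(-1) ^ (m |ξ|)`. -/
noncomputable def signTwist (m : ℤ) : Cochain K L Q →ₗ[K] Cochain K L Q where
  toFun f k := ofHomogeneous ℒ fun n => (-1 : K) ^ (m * ∑ i, n i) • f k
  map_add' f f' := by
    funext k
    refine ext_homogeneous ℒ fun n ξ h => ?_
    simp [ofHomogeneous_apply ℒ _ n ξ h]
  map_smul' c f := by
    funext k
    refine ext_homogeneous ℒ fun n ξ h => ?_
    simp [ofHomogeneous_apply ℒ _ n ξ h, smul_comm c]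

theorem signTwist_apply (m : ℤ) (f : Cochain K L Q) {k : ℕ} {n : Fin k → ℤ} {ξ : Fin k → L}
    (h : ∀ i, ξ i ∈ ℒ (n i)) : signTwist ℒ m f k ξ = (-1 : K) ^ (m * ∑ i, n i) • f k ξ :=
  ofHomogeneous_apply ℒ _ n ξ h

variable {ℒ}

end SignTwist

/-! ### Injectivity. -/

section Pairs

variable {K A L P : Type*} [Field K] [Ring A] [Algebra K A] {𝒜 : ℤ → Submodule K A}
  [GradedAlgebra 𝒜]
  [AddCommGroup L] [Module K L] [Module A L] [IsScalarTower K A L] {ℒ : ℤ → Submodule K L}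
  [DirectSum.Decomposition ℒ] [SetLike.GradedSMul 𝒜 ℒ]
  [AddCommGroup P] [Module K P] [Module A P] [IsScalarTower K A P] {ℳ : ℤ → Submodule K P}
  [DirectSum.Decomposition ℳ] [SetLike.GradedSMul 𝒜 ℳ]

/-- A form without entries has no slot for `X`, so only the connection contributes, with all
arguments. Hence the operator determines `φ`. -/
theorem ev_chevalleyEilenberg_zeroForm (d e : ℤ) (X : Cochain K L L)
    (φ : Cochain K L (Module.End K P)) (p : P) {l : List (ℤ × L)} (hl : Homog ℒ l) :
    ev (chevalleyEilenberg ℒ d e X φ (zeroForm p)) l = (-1 : K) ^ (e * degSum l) • ev φ l p := by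
  rw [chevalleyEilenberg, ev_sub, ev_smul, ev_cup _ _ _ _ _ hl, ev_gerst _ _ _ hl,
    unshuffleSum_of_right_nil, unshuffleSum_eq_zero, smul_zero, sub_zero]
  · rfl
  · intro s t
    rw [evHead_apply _ _ 0, ev_zeroForm_cons]
  · intro s t ht
    rw [ev_zeroForm_of_ne p ht, map_zero, smul_zero]

theorem ev_gerst_of_weight_one {θ : Cochain K L P} (hθ : θ ∈ weight K L P 1) (X : Cochain K L L)
    {l : List (ℤ × L)} (hl : Homog ℒ l) : ev (gerst ℒ θ X) l = evHead θ [] (ev X l) := by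
  rw [ev_gerst _ _ _ hl, unshuffleSum_of_right_nil]
  intro s t ht
  rw [evHead_apply _ _ 0, ev_of_weight hθ]
  cases t
  · exact absurd rfl ht
  · simp only [List.length_cons]
    omega

variable {ι : Type*} [Fintype ι] {g : ι → ℤ} {b : ι → L} {θ : ι → Cochain K L A}

theorem IsConnection.eq_zero {d : ℤ} {X : Cochain K L L} {σ : Cochain K L (Module.End K A)}
    {φ : Cochain K L (Module.End K P)} (hX : IsMultiDer 𝒜 ℒ d X σ)
    (hφ : IsConnection 𝒜 ℒ ℳ d σ φ) (h : ceEnd hX hφ = 0) : φ = 0 := by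
  refine ext_ev ℒ fun l hl => linearMap_ext_homogeneous ℳ fun r p hp => ?_
  have h1 := ceEnd_of hX hφ ⟨_, zeroForm_mem hp⟩
  rw [h] at h1
  have h2 := congrArg (fun f => ev f l) h1
  simp only [ev_chevalleyEilenberg_zeroForm d r X φ p hl] at h2
  have h3 := congrArg (fun x => (-1 : K) ^ (r * degSum l) • x) h2
  simp only [smul_smul, neg_one_zpow_mul_self, one_smul] at h3
  rw [← h3]
  exact smul_zero _

/-- The symbol vanishes by the case of forms without entries. The operator on `θ i` is then `θ i ∘
X` up to sign, so all coefficients in the dual basis expansion of the values of `X` are zero. -/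
theorem IsDualBasis.multiDer_eq_zero (hb : IsDualBasis 𝒜 ℒ g b θ) {d : ℤ} {X : Cochain K L L}
    {σ : Cochain K L (Module.End K A)} (hX : IsMultiDer 𝒜 ℒ d X σ)
    (h : ceEnd hX hX.conn = 0) : X = 0 := by
  have hσ := hX.conn.eq_zero hX h
  refine ext_ev ℒ fun l hl => ?_
  rw [← hb.sum _ _ (ev_mem_of_degreeMaps hX.degree hl), ev_zero]
  refine Finset.sum_eq_zero fun i _ => ?_
  have h1 := ceEnd_of hX hX.conn ⟨_, hb.form i⟩
  rw [h] at h1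
  have h2 := congrArg (fun f => ev f l) h1
  have h3 : cup ℒ (fun _ _ => LinearMap.id) (-g i) σ (θ i) = 0 := by
    have := cup_smul_left ℒ (fun _ _ => LinearMap.id) (-g i) (0 : K) σ (θ i)
    rwa [zero_smul, zero_smul, ← hσ] at this
  simp only [chevalleyEilenberg] at h2
  rw [h3, ev_sub, ev_smul, ev_gerst_of_weight_one (hb.weight i) X hl] at h2
  have h4 : evHead (θ i) [] (ev X l) = 0 := by
    have h5 := congrArg (fun x => (-1 : K) ^ (d * -g i) • x) h2
    simp only [smul_sub, smul_smul, neg_one_zpow_mul_self, one_smul] at h5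
    have h6 : ∀ y : A, (-1 : K) ^ (d * -g i) • (0 : A) =
        (-1 : K) ^ (d * -g i) • (0 : A) - y → y = 0 := fun y hy => by simpa using hy
    exact h6 _ h5
  rw [← evHead_apply, h4, zero_smul, smul_zero]

theorem IsDualBasis.leftPairOp_injective (hb : IsDualBasis 𝒜 ℒ g b θ) (d : ℤ) :
    Function.Injective (leftPairOp 𝒜 ℒ ℳ d) := by
  rw [injective_iff_map_eq_zero]
  intro x hx
  obtain ⟨h1, h2⟩ := mem_leftPairs_iff.1 x.2
  have e1 : ceEnd h1 h2 = 0 := congrArg Prod.fst hx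
  have e2 : ceEnd h1 h1.conn = 0 := congrArg Prod.snd hx
  exact Subtype.ext (Prod.ext (Prod.ext (hb.multiDer_eq_zero h1 e2) (h1.conn.eq_zero h1 e2))
    (h2.eq_zero h1 e1))

end Pairs

/-! ### The connection determined by a derivation. -/

section Connections

variable {K A L P : Type*} [Field K] [Ring A] [Algebra K A] {𝒜 : ℤ → Submodule K A}
  [GradedAlgebra 𝒜]
  [AddCommGroup L] [Module K L] [Module A L] [IsScalarTower K A L] {ℒ : ℤ → Submodule K L}
  [DirectSum.Decomposition ℒ] [SetLike.GradedSMul 𝒜 ℒ]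
  [AddCommGroup P] [Module K P] [Module A P] [IsScalarTower K A P] {ℳ : ℤ → Submodule K P}
  [DirectSum.Decomposition ℳ] [SetLike.GradedSMul 𝒜 ℳ]

variable (𝒜 ℒ ℳ) in
/-- The elements of `P` as forms without entries. -/
noncomputable def zeroSym : P →ₗ[K] Sym 𝒜 ℒ ℳ :=
  zeroForm.codRestrict (Sym 𝒜 ℒ ℳ) fun p =>
    DirectSum.Decomposition.inductionOn ℳ (motive := fun p => zeroForm p ∈ Sym 𝒜 ℒ ℳ)
      (by rw [map_zero]; exact zero_mem _)
      (fun p => Submodule.mem_iSup_of_mem _ (zeroForm_mem p.2))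
      (fun p p' h h' => by rw [map_add]; exact add_mem h h') p

/-- The family of endomorphisms `∇(ξ)(p) = (-1) ^ (|p| |ξ|) D(p)(ξ)`. -/
noncomputable def connOf (D : Module.End K (Sym 𝒜 ℒ ℳ)) : Cochain K L (Module.End K P) :=
  fun k => flipMulti (gradedLift ℳ fun r => LinearMap.proj k ∘ₗ signTwist ℒ r ∘ₗ
    (Sym 𝒜 ℒ ℳ).subtype ∘ₗ D ∘ₗ zeroSym 𝒜 ℒ ℳ)

theorem connOf_apply (D : Module.End K (Sym 𝒜 ℒ ℳ)) {k : ℕ} {n : Fin k → ℤ} {ξ : Fin k → L}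
    (h : ∀ i, ξ i ∈ ℒ (n i)) {r : ℤ} {p : P} (hp : p ∈ ℳ r) :
    connOf D k ξ p =
      (-1 : K) ^ (r * ∑ i, n i) • (D (zeroSym 𝒜 ℒ ℳ p) : Cochain K L P) k ξ := by
  rw [connOf, flipMulti_apply, gradedLift_of_mem ℳ _ hp]
  exact signTwist_apply ℒ r _ h

theorem ev_connOf (D : Module.End K (Sym 𝒜 ℒ ℳ)) {l : List (ℤ × L)} (hl : Homog ℒ l) {r : ℤ}
    {p : P} (hp : p ∈ ℳ r) : ev (connOf D) l p =
      (-1 : K) ^ (r * degSum l) • ev (D (zeroSym 𝒜 ℒ ℳ p) : Cochain K L P) l := by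
  rw [ev, connOf_apply D (homog_get hl) hp, sum_get_fst]
  rfl

theorem ev_mulCochain_zeroForm_left (e : ℤ) (a : A) (Ω : Cochain K L P) {l : List (ℤ × L)}
    (hl : Homog ℒ l) : ev (mulCochain ℒ e (zeroForm a) Ω) l = a • ev Ω l := by
  rw [mulCochain, ev_cup _ _ _ _ _ hl, unshuffleSum_of_left_nil]
  · rw [degSum_nil, mul_zero, zpow_zero, one_smul]
    rfl
  · intro s t hs
    rw [ev_zeroForm_of_ne a hs, map_zero, LinearMap.zero_apply, smul_zero]

theorem ev_mulCochain_zeroForm_right (e : ℤ) (ω : Cochain K L A) (p : P) {l : List (ℤ × L)}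
    (hl : Homog ℒ l) : ev (mulCochain ℒ e ω (zeroForm p)) l =
      (-1 : K) ^ (e * degSum l) • ev ω l • p := by
  rw [mulCochain, ev_cup _ _ _ _ _ hl, unshuffleSum_of_right_nil]
  · rfl
  · intro s t ht
    rw [ev_zeroForm_of_ne p ht, map_zero, smul_zero]

theorem connOf_weight {d s : ℤ} {D : Module.End K (Sym 𝒜 ℒ ℳ)} (h : HasBidegree 𝒜 ℒ ℳ d s D) :
    connOf D ∈ weight K L (Module.End K P) s := by
  intro j hj
  refine ext_homogeneous ℒ fun n ξ hξ => linearMap_ext_homogeneous ℳ fun r p hp => ?_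
  rw [connOf_apply D hξ hp, h.2 0 (zeroSym 𝒜 ℒ ℳ p) (zeroForm_weight p) j (by simpa using hj)]
  simp

variable [GradedCommutative 𝒜]

/-- Degree, symmetry and linearity in the arguments hold for each form `D(p)` and are inherited. The
symbol rule is the Leibniz rule of `D` on the product of the forms without entries `a` and `p`. -/
theorem isConnection_connOf {d s : ℤ} {D : Module.End K (Sym 𝒜 ℒ ℳ)}
    {τ : Module.End K (Sym 𝒜 ℒ 𝒜)} (hD : HasBidegree 𝒜 ℒ ℳ d s D) (h : Leibniz 𝒜 ℒ ℳ d D τ) :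
    IsConnection 𝒜 ℒ ℳ d (connOf τ) (connOf D) := by
  have hf : ∀ {r : ℤ} {p : P} (_ : p ∈ ℳ r),
      IsForm 𝒜 ℒ ℳ (r + d) (D (zeroSym 𝒜 ℒ ℳ p) : Cochain K L P) := fun {r p} hp =>
    mem_symForm_iff.1 (hD.1 r ⟨_, zeroForm_mem hp⟩)
  refine ⟨finite_of_weight (connOf_weight hD), fun k => degreeMaps_of_ev_mem (fun l hl => ?_) k,
    fun k => ?_, ?_, ?_⟩
  · intro r p hp
    rw [ev_connOf D hl hp, ← add_assoc]
    exact Submodule.smul_mem _ _ (ev_mem_of_degreeMaps (hf hp).degree hl)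
  · intro n ξ hξ i j hij
    refine linearMap_ext_homogeneous ℳ fun r p hp => ?_
    rw [LinearMap.smul_apply, connOf_apply D hξ hp, connOf_apply D (n := n ∘ Equiv.swap i j)
      (ξ := ξ ∘ Equiv.swap i j) (fun a => hξ _) hp, (hf hp).symm k n ξ hξ i j hij, smul_comm,
      show ∑ a, (n ∘ Equiv.swap i j) a = ∑ a, n a from Equiv.sum_comp _ n]
  · intro r a ha x l hl
    refine linearMap_ext_homogeneous ℳ fun m p hp => ?_
    rw [LinearMap.smul_apply, LinearMap.smul_apply, ev_connOf D hl hp,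
      ev_connOf D (homog_smul ha hl) hp, (hf hp).linear r a ha x l hl, smul_comm a (_ : K)]
    simp only [smul_smul _ _ (_ : P), neg_one_zpow_mul, degSum_cons]
    exact zpow_smul_congr (by grind) rfl
  · intro l hl r a ha p
    change ev (connOf D) l (a • p) = _ + _ • a • ev (connOf D) l p
    refine DirectSum.Decomposition.inductionOn ℳ ?_ ?_ ?_ p
    · simp
    · rintro m ⟨p, hp⟩
      have e1 := SetLike.GradedSMul.smul_mem ha hp
      rw [vadd_eq_add] at e1
      have e2 := h r m ⟨_, zeroForm_mem ha⟩ ⟨_, zeroForm_mem hp⟩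
      have e3 : Sym.of 𝒜 ℒ ℳ (mulForm 𝒜 ℒ ℳ (⟨_, zeroForm_mem ha⟩ : symForm 𝒜 ℒ 𝒜 r)
          ⟨_, zeroForm_mem hp⟩) = zeroSym 𝒜 ℒ ℳ (a • p) := by
        refine Subtype.ext (ext_ev ℒ fun l hl => ?_)
        refine (ev_mulCochain_zeroForm_left m a (zeroForm p) hl).trans ?_
        change _ = ev (zeroForm (a • p)) l
        cases l
        · rfl
        · rw [ev_zeroForm_cons, ev_zeroForm_cons, smul_zero]
      rw [e3] at e2
      change ev (connOf D) l (a • p) = ev (connOf τ) l a • p + _ • a • ev (connOf D) l p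
      rw [ev_connOf D hl e1, ev_connOf D hl hp, ev_connOf τ hl ha, e2, ev_add, ev_smul,
        ev_mulCochain_zeroForm_left _ _ _ hl, ev_mulCochain_zeroForm_right _ _ _ hl, smul_add,
        smul_comm a (_ : K), smul_assoc]
      simp only [smul_smul _ _ (_ : P), neg_one_zpow_mul]
      refine congrArg₂ (· + ·) ?_ ?_
      · exact zpow_smul_congr (by grind) rfl
      · exact zpow_smul_congr (by grind) rfl
    · intro p p' e e'
      rw [smul_add, map_add, map_add, e, e']
      simp only [smul_add]
      abel

end Connections

/-! ### Reconstruction of a pair from a derivation. -/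

section Surjectivity

variable {K A L P : Type*} [Field K] [Ring A] [Algebra K A] {𝒜 : ℤ → Submodule K A}
  [GradedAlgebra 𝒜]
  [AddCommGroup L] [Module K L] [Module A L] [IsScalarTower K A L] {ℒ : ℤ → Submodule K L}
  [DirectSum.Decomposition ℒ] [SetLike.GradedSMul 𝒜 ℒ]
  [AddCommGroup P] [Module K P] [Module A P] [IsScalarTower K A P] {ℳ : ℤ → Submodule K P}
  [DirectSum.Decomposition ℳ] [SetLike.GradedSMul 𝒜 ℳ]
  {ι : Type*} [Fintype ι] {g : ι → ℤ} {b : ι → L} {θ : ι → Cochain K L A}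

/-- The `L`-valued family `ξ ↦ ∑ i, (-1) ^ (g i |ξ|) ρ i (ξ) b i`. -/
noncomputable def dualSum (ℒ : ℤ → Submodule K L) [DirectSum.Decomposition ℒ] (g : ι → ℤ)
    (b : ι → L) (ρ : ι → Cochain K L A) : Cochain K L L :=
  fun k => ∑ i, ((LinearMap.toSpanSingleton A L (b i)).restrictScalars K).compMultilinearMap
    (signTwist ℒ (g i) (ρ i) k)

theorem dualSum_apply (ρ : ι → Cochain K L A) {k : ℕ} {n : Fin k → ℤ} {ξ : Fin k → L}
    (h : ∀ i, ξ i ∈ ℒ (n i)) : dualSum ℒ g b ρ k ξ =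
      ∑ i, (-1 : K) ^ (g i * ∑ j, n j) • ρ i k ξ • b i := by
  rw [dualSum, sum_apply]
  refine Finset.sum_congr rfl fun i _ => ?_
  change signTwist ℒ (g i) (ρ i) k ξ • b i = _
  rw [signTwist_apply ℒ _ _ h, smul_assoc]

theorem ev_dualSum (ρ : ι → Cochain K L A) {l : List (ℤ × L)} (hl : Homog ℒ l) :
    ev (dualSum ℒ g b ρ) l = ∑ i, (-1 : K) ^ (g i * degSum l) • ev (ρ i) l • b i := by
  rw [ev, dualSum_apply ρ (homog_get hl), sum_get_fst]
  rfl

theorem dualSum_weight {ρ : ι → Cochain K L A} {k : ℤ} (h : ∀ i, ρ i ∈ weight K L A k) :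
    dualSum ℒ g b ρ ∈ weight K L L k := by
  intro j hj
  refine ext_homogeneous ℒ fun n ξ hξ => ?_
  rw [dualSum_apply ρ hξ]
  refine Finset.sum_eq_zero fun i _ => ?_
  rw [h i j hj, zero_apply, zero_smul, smul_zero]

theorem dualSum_symm {ρ : ι → Cochain K L A} (h : ∀ i k, ρ i k ∈ gradedSymmetric ℒ k) (k : ℕ) :
    dualSum ℒ g b ρ k ∈ gradedSymmetric ℒ k := by
  intro n ξ hξ i j hij
  rw [dualSum_apply ρ hξ, dualSum_apply ρ (n := n ∘ Equiv.swap i j)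
    (ξ := ξ ∘ Equiv.swap i j) (fun a => hξ _), Finset.smul_sum,
    show ∑ a, (n ∘ Equiv.swap i j) a = ∑ a, n a from Equiv.sum_comp _ n]
  refine Finset.sum_congr rfl fun a _ => ?_
  rw [h a k n ξ hξ i j hij, smul_assoc, smul_comm]

theorem dualSum_degree (hb : ∀ i, b i ∈ ℒ (g i)) {d : ℤ} {ρ : ι → Cochain K L A}
    (h : ∀ i k, ρ i k ∈ degreeMaps ℒ 𝒜 (d - g i) k) (k : ℕ) :
    dualSum ℒ g b ρ k ∈ degreeMaps ℒ ℒ d k := by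
  refine degreeMaps_of_ev_mem (fun l hl => ?_) k
  rw [ev_dualSum ρ hl]
  refine sum_mem fun i _ => Submodule.smul_mem _ _ ?_
  have := SetLike.GradedSMul.smul_mem (ev_mem_of_degreeMaps (h i) hl) (hb i)
  rw [vadd_eq_add, show d - g i + degSum l + g i = d + degSum l by ring] at this
  exact this

section Reconstruction

variable {d s : ℤ} {τ : Module.End K (Sym 𝒜 ℒ 𝒜)} (hb : IsDualBasis 𝒜 ℒ g b θ)

/-- The forms `σ ∘ θ i - τ (θ i)`, where `σ` is the symbol determined by `τ`. -/
noncomputable def symbolDefect (τ : Module.End K (Sym 𝒜 ℒ 𝒜)) (hb : IsDualBasis 𝒜 ℒ g b θ)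
    (i : ι) : Cochain K L A :=
  cup ℒ (fun _ _ => LinearMap.id) (-g i) (connOf τ) (θ i) -
    (τ (Sym.of 𝒜 ℒ 𝒜 ⟨θ i, hb.form i⟩) : Cochain K L A)

theorem symbolDefect_weight (hτ : HasBidegree 𝒜 ℒ 𝒜 d s τ) (i : ι) :
    symbolDefect τ hb i ∈ weight K L A (s + 1) := by
  refine sub_mem (cup_weight ℒ _ _ (connOf_weight hτ) (hb.weight i)) ?_
  have := hτ.2 1 (Sym.of 𝒜 ℒ 𝒜 ⟨θ i, hb.form i⟩) (by exact_mod_cast hb.weight i)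
  rw [add_comm]
  exact_mod_cast this

variable [GradedCommutative 𝒜]

theorem symbolDefect_degree (hτ : HasBidegree 𝒜 ℒ 𝒜 d s τ) (hL : Leibniz 𝒜 ℒ 𝒜 d τ τ) (i : ι)
    (k : ℕ) : symbolDefect τ hb i k ∈ degreeMaps ℒ 𝒜 (d - g i) k := by
  have h1 := (mem_symForm_iff.1 (hτ.1 _ ⟨θ i, hb.form i⟩)).degree k
  rw [neg_add_eq_sub] at h1
  refine sub_mem (cup_degree (ℰ := endDegree 𝒜) (fun i j x m hx hm => ?_)
    (isConnection_connOf hτ hL).degree (mem_symForm_iff.1 (hb.form i)).degree k) h1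
  rw [add_comm]
  exact hx _ _ hm

theorem symbolDefect_symm (hτ : HasBidegree 𝒜 ℒ 𝒜 d s τ) (hL : Leibniz 𝒜 ℒ 𝒜 d τ τ) (i : ι)
    (k : ℕ) : symbolDefect τ hb i k ∈ gradedSymmetric ℒ k :=
  sub_mem (cup_gradedSymmetric _ _ _ _ _ (isConnection_connOf hτ hL).symm
    (mem_symForm_iff.1 (hb.form i)).symm k)
    ((mem_symForm_iff.1 (hτ.1 _ ⟨θ i, hb.form i⟩)).symm k)

/-- The choice of `X` is forced: a symbol of the form `σ ∘ ω ∓ ω ∘ X` determines `θ i (X)` up to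
sign as `σ ∘ θ i - τ (θ i)`. Here `τ (θ i)` is `A`-linear, and the failure of `σ ∘ θ i` is `σ(…)(a)
θ i (h)`, which sums against the `b i` to the Leibniz term. -/
theorem isMultiDer_dualSum (hτ : HasBidegree 𝒜 ℒ 𝒜 d s τ) (hL : Leibniz 𝒜 ℒ 𝒜 d τ τ) :
    IsMultiDer 𝒜 ℒ d (dualSum ℒ g b (symbolDefect τ hb)) (connOf τ) := by
  refine ⟨finite_of_weight (dualSum_weight (symbolDefect_weight hb hτ)),
    dualSum_degree hb.mem (symbolDefect_degree hb hτ hL), dualSum_symm (symbolDefect_symm hb hτ hL),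
    ?_, isConnection_connOf hτ hL⟩
  intro r a ha h l hl
  obtain ⟨hh, hl'⟩ := homog_cons.1 hl
  have hσ := isConnection_connOf hτ hL
  rw [ev_dualSum _ hl, ev_dualSum _ (homog_smul ha hl), Finset.smul_sum, Finset.smul_sum]
  -- The element multiplying the symbol is expanded in the generators, so that both sides can be
  -- compared for each `i`.
  conv_rhs => rw [← hb.sum h.1 h.2 hh, Finset.smul_sum, Finset.smul_sum]
  rw [← Finset.sum_add_distrib]
  refine Finset.sum_congr rfl fun i _ => ?_
  have h1 := (mem_symForm_iff.1 (hτ.1 _ ⟨θ i, hb.form i⟩)).linear r a ha h l hl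
  have h2 := ev_cup_smul (B := LinearMap.id (R := K) (M := Module.End K A)) (fun _ _ _ => rfl)
    hσ.linear hσ.symbol (mem_symForm_iff.1 (hb.form i)).linear ha hl
  -- The form `θ i` takes only `h` as argument, so all other entries go to the symbol.
  rw [unshuffleSum_of_right_nil] at h2
  · rw [symbolDefect, ev_sub, ev_sub, h1, h2]
    simp only [add_smul, sub_smul, smul_sub, smul_add, smul_assoc, degSum_cons,
      smul_comm a (_ : K), smul_comm (ev (connOf τ) l a) (_ : K)]
    simp only [smul_smul _ _ (_ : L), neg_one_zpow_mul]
    rw [add_sub_right_comm]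
    refine congrArg₂ (· + ·) (congrArg₂ (· - ·) ?_ ?_) ?_
    · exact zpow_smul_congr (by grind) rfl
    · exact zpow_smul_congr (by grind) rfl
    · exact zpow_smul_congr (by grind) rfl
  · intro u t ht
    rw [ev_of_weight (hb.weight i), smul_zero, smul_zero]
    cases t
    · exact absurd rfl ht
    · simp only [List.length_cons]
      omega

theorem cup_connOf_zeroForm (τ : Module.End K (Sym 𝒜 ℒ ℳ)) {e : ℤ} {p : P} (hp : p ∈ ℳ e) :
    cup ℒ (fun _ _ => LinearMap.id) e (connOf τ) (zeroForm p) =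
      (τ (zeroSym 𝒜 ℒ ℳ p) : Cochain K L P) := by
  refine ext_ev ℒ fun l hl => ?_
  rw [ev_cup _ _ _ _ _ hl, unshuffleSum_of_right_nil]
  · rw [ev_zeroForm_nil, LinearMap.id_apply, ev_connOf τ hl hp, smul_smul, neg_one_zpow_mul_self,
      one_smul]
  · intro s t ht
    rw [ev_zeroForm_of_ne p ht, map_zero, smul_zero]

theorem cup_sum_smul_right {M N Q : Type*} [AddCommGroup M] [Module K M] [AddCommGroup N]
    [Module K N] [AddCommGroup Q] [Module K Q] (ℒ : ℤ → Submodule K L)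
    [DirectSum.Decomposition ℒ] (B : M →ₗ[K] N →ₗ[K] Q) (e : ℤ) (f : Cochain K L M) (c : ι → K)
    (x : ι → Cochain K L N) : cup ℒ (fun _ _ => B) e f (∑ i, c i • x i) =
      ∑ i, c i • cup ℒ (fun _ _ => B) e f (x i) := by
  let Φ : Cochain K L N →ₗ[K] Cochain K L Q :=
    { toFun := cup ℒ (fun _ _ => B) e f
      map_add' := cup_add_right ℒ _ e _
      map_smul' := fun c => cup_smul_right ℒ _ e c _ }
  exact (map_sum Φ _ _).trans (Finset.sum_congr rfl fun i _ => map_smul Φ _ _)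

/-- For `ω = θ i` this is not immediate, since the values `θ j (b i)` need not be Kronecker deltas.
The one-form `ω` is expanded as `∑ ± θ i a i` with `a i = ω(b i)`. The difference of `σ ∘ _` and `τ`
is linear over the `a i`, because both agree on forms without entries, so it is determined by the
defects of the `θ i`, as is `ω ∘ X`. -/
theorem gerst_dualSum (hτ : HasBidegree 𝒜 ℒ 𝒜 d s τ) (hL : Leibniz 𝒜 ℒ 𝒜 d τ τ) {e : ℤ}
    (ω : symForm 𝒜 ℒ 𝒜 e) (hω : (ω : Cochain K L A) ∈ weight K L A 1) :
    (-1 : K) ^ (d * e) • gerst ℒ (ω : Cochain K L A) (dualSum ℒ g b (symbolDefect τ hb)) =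
      cup ℒ (fun _ _ => LinearMap.id) e (connOf τ) (ω : Cochain K L A) -
        (τ (Sym.of 𝒜 ℒ 𝒜 ω) : Cochain K L A) := by
  have hω' := mem_symForm_iff.1 ω.2
  obtain ⟨a, hc⟩ : ∃ a : ι → A, ∀ i, contract (b i) (ω : Cochain K L A) = zeroForm (a i) :=
    ⟨_, fun i => eq_zeroForm_of_weight (contract_weight (by simpa using hω))⟩
  have ha' : ∀ i, a i = ev (ω : Cochain K L A) [(g i, b i)] := fun i => by
    rw [← ev_contract (ω : Cochain K L A) (g i, b i), hc]
    rfl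
  have ha : ∀ i, a i ∈ 𝒜 (e + g i) := fun i => by
    have := ev_mem_of_degreeMaps (mem_symForm_iff.1 (contract_mem (hb.mem i) ω.2)).degree
      (Homog.nil ℒ)
    rw [hc, degSum_nil, add_zero] at this
    exact this
  have hE : (ω : Cochain K L A) = ∑ i, (-1 : K) ^ (g i * e) •
      mulCochain ℒ (e + g i) (θ i) (zeroForm (a i)) := by
    have := hb.euler (k := 1) ω.2 (by exact_mod_cast hω)
    rw [Nat.cast_one, one_smul] at this
    simp only [hc] at this
    exact this.symm
  have hE' : Sym.of 𝒜 ℒ 𝒜 ω = ∑ i, (-1 : K) ^ (g i * e) • Sym.of 𝒜 ℒ 𝒜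
      (mulForm 𝒜 ℒ 𝒜 ⟨θ i, hb.form i⟩ ⟨_, zeroForm_mem (ha i)⟩) := by
    refine Subtype.ext ?_
    rw [Submodule.coe_sum]
    exact hE
  have hA := cup_sum_smul_right ℒ (LinearMap.id (R := K) (M := Module.End K A)) e (connOf τ)
    (fun i => (-1 : K) ^ (g i * e)) fun i => mulCochain ℒ (e + g i) (θ i) (zeroForm (a i))
  rw [← hE] at hA
  have hB : (τ (Sym.of 𝒜 ℒ 𝒜 ω) : Cochain K L A) = ∑ i, (-1 : K) ^ (g i * e) •
      (mulCochain ℒ (e + g i) (τ (Sym.of 𝒜 ℒ 𝒜 ⟨θ i, hb.form i⟩) : Cochain K L A)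
        (zeroForm (a i)) + (-1 : K) ^ (d * -g i) • mulCochain ℒ (e + g i + d) (θ i)
          (τ (zeroSym 𝒜 ℒ 𝒜 (a i)) : Cochain K L A)) := by
    rw [hE', map_sum, Submodule.coe_sum]
    refine Finset.sum_congr rfl fun i _ => ?_
    rw [map_smul, Submodule.coe_smul, hL]
    rfl
  have hσ := isConnection_connOf hτ hL
  -- The Leibniz terms in which `σ` or `τ` acts on `a i` coincide and drop out.
  have h1 : cup ℒ (fun _ _ => LinearMap.id) e (connOf τ) (ω : Cochain K L A) -
        (τ (Sym.of 𝒜 ℒ 𝒜 ω) : Cochain K L A) = ∑ i, (-1 : K) ^ (g i * e) •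
      mulCochain ℒ (e + g i) (symbolDefect τ hb i) (zeroForm (a i)) := by
    rw [hA, hB, ← Finset.sum_sub_distrib]
    refine Finset.sum_congr rfl fun i _ => ?_
    have h2 := cup_mulCochain ℒ (φ := connOf τ) (σ := connOf τ) (ω := θ i) (Ω := zeroForm (a i))
      (d := d) (e := -g i) (e + g i) fun s t hs ht p => hσ.symbol s hs (-g i + degSum t)
        (ev (θ i) t) (ev_mem_of_degreeMaps (mem_symForm_iff.1 (hb.form i)).degree ht) p
    rw [show -g i + (e + g i) = e by ring, cup_connOf_zeroForm τ (ha i)] at h2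
    rw [h2, ← smul_sub, symbolDefect, mulCochain_sub_left, add_sub_add_right_eq_sub]
  rw [h1]
  refine ext_ev ℒ fun l hl => ?_
  have hX := dualSum_degree hb.mem (symbolDefect_degree hb hτ hL)
  rw [ev_smul, ev_gerst_of_weight_one hω _ hl, ev_dualSum _ hl, map_sum, ev_sum, Finset.smul_sum]
  refine Finset.sum_congr rfl fun i _ => ?_
  have h3 := ev_mem_of_degreeMaps (symbolDefect_degree hb hτ hL i) hl
  rw [map_smul, hω'.linear.evHead h3 (hb.mem i) (Homog.nil ℒ), ← ev_cons _ [] (g i, b i), ← ha',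
    ev_smul, ev_mulCochain_zeroForm_right _ _ _ hl]
  simp only [smul_smul _ _ (_ : A), neg_one_zpow_mul]
  exact zpow_smul_congr (by grind) rfl

/-- The difference is written with a scalar `-1` so that the closure lemmas `Leibniz.add` and
`Leibniz.smul` apply to it. -/
theorem eq_of_add_neg_one_smul {D D' : Module.End K (Sym 𝒜 ℒ ℳ)} (h : D + (-1 : K) • D' = 0) :
    D = D' := by
  refine LinearMap.ext fun Ω => Subtype.ext ?_
  have h1 : (D Ω : Cochain K L P) + (-1 : K) • (D' Ω : Cochain K L P) = 0 :=
    congrArg Subtype.val (LinearMap.congr_fun h Ω)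
  rwa [neg_one_smul, ← sub_eq_add_neg, sub_eq_zero] at h1

theorem ceEnd_connOf_zeroForm {X : Cochain K L L} {D : Module.End K (Sym 𝒜 ℒ ℳ)}
    (hX : IsMultiDer 𝒜 ℒ d X (connOf τ)) (hφ : IsConnection 𝒜 ℒ ℳ d (connOf τ) (connOf D))
    {e : ℤ} {p : P} (hp : p ∈ ℳ e) :
    (ceEnd hX hφ + (-1 : K) • D) (Sym.of 𝒜 ℒ ℳ ⟨_, zeroForm_mem hp⟩) = 0 := by
  refine Subtype.ext ?_
  change (ceEnd hX hφ (Sym.of 𝒜 ℒ ℳ ⟨_, zeroForm_mem hp⟩) : Cochain K L P) +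
    (-1 : K) • (D (zeroSym 𝒜 ℒ ℳ p) : Cochain K L P) = 0
  rw [ceEnd_of, neg_one_smul, ← sub_eq_add_neg, sub_eq_zero]
  refine ext_ev ℒ fun l hl => ?_
  rw [ev_chevalleyEilenberg_zeroForm d e X _ p hl, ev_connOf D hl hp, smul_smul,
    neg_one_zpow_mul_self, one_smul]

variable [CharZero K]

/-- The differences of the reconstructed operators and the given ones are again derivations with
matching symbols. They vanish on forms without entries by the choice of the connections, and the
symbol difference kills every `θ i` by the choice of `X`, so uniqueness on generators applies. -/
theorem exists_leftPairOp_eq (hb : IsDualBasis 𝒜 ℒ g b θ) {D : Module.End K (Sym 𝒜 ℒ ℳ)}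
    (h : (D, τ) ∈ modDerShift 𝒜 ℒ ℳ d s) : ∃ x, leftPairOp 𝒜 ℒ ℳ d x = (D, τ) := by
  obtain ⟨hD, hτ, hL, hDL⟩ := h
  have hX := isMultiDer_dualSum hb hτ hL
  have hφ := isConnection_connOf hD hDL
  -- The vanishing of the symbol difference on the `θ i` serves both applications of uniqueness,
  -- since both differences have this symbol.
  have e0 : ∀ i, (ceEnd hX hX.conn + (-1 : K) • τ) (Sym.of 𝒜 ℒ 𝒜 ⟨θ i, hb.form i⟩) = 0 := by
    intro i
    refine Subtype.ext ?_
    change (ceEnd hX hX.conn (Sym.of 𝒜 ℒ 𝒜 ⟨θ i, hb.form i⟩) : Cochain K L A) +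
      (-1 : K) • (τ (Sym.of 𝒜 ℒ 𝒜 ⟨θ i, hb.form i⟩) : Cochain K L A) = 0
    rw [ceEnd_of, neg_one_smul, ← sub_eq_add_neg, sub_eq_zero, chevalleyEilenberg,
      gerst_dualSum hb hτ hL ⟨θ i, hb.form i⟩ (hb.weight i), sub_sub_cancel]
  have e1 : ceEnd hX hX.conn = τ := eq_of_add_neg_one_smul (hb.eq_zero_of_leibniz
    ((ceEnd_leibniz hX hX.conn).add (hL.smul _)) e0 fun e p hp => ceEnd_connOf_zeroForm hX hX.conn hp)
  have e2 : ceEnd hX hφ = D := eq_of_add_neg_one_smul (hb.eq_zero_of_leibniz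
    ((ceEnd_leibniz hX hφ).add (hDL.smul _)) e0 fun e p hp => ceEnd_connOf_zeroForm hX hφ hp)
  exact ⟨⟨((_, _), _), mem_leftPairs_iff.2 ⟨hX, hφ⟩⟩, Prod.ext e2 e1⟩

theorem modDer_le_range_leftPairOp (hb : IsDualBasis 𝒜 ℒ g b θ) (d : ℤ) :
    modDer 𝒜 ℒ ℳ d ≤ LinearMap.range (leftPairOp 𝒜 ℒ ℳ d) :=
  iSup_le fun _ _ h => exists_leftPairOp_eq hb h

end Reconstruction

end Surjectivity

end GradedLR

/-! ### The proposition. -/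

theorem mainTheorem6 {K A L P : Type*} [Field K] [CharZero K]
    [Ring A] [Algebra K A] (𝒜 : ℤ → Submodule K A) [GradedAlgebra 𝒜] [GradedCommutative 𝒜]
    [AddCommGroup L] [Module K L] [Module A L] [IsScalarTower K A L]
    (ℒ : ℤ → Submodule K L) [DirectSum.Decomposition ℒ] [SetLike.GradedSMul 𝒜 ℒ]
    [AddCommGroup P] [Module K P] [Module A P] [IsScalarTower K A P]
    (ℳ : ℤ → Submodule K P) [DirectSum.Decomposition ℳ] [SetLike.GradedSMul 𝒜 ℳ] :
    ∃ (h₁ : IsGradedLie (leftPairs 𝒜 ℒ ℳ) (leftBracket ℒ))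
      (h₂ : IsGradedLie (modDer 𝒜 ℒ ℳ) modDerBracket)
      (ηL : (d : ℤ) → leftPairs 𝒜 ℒ ℳ d →ₗ[K] modDer 𝒜 ℒ ℳ d),
      -- a morphism of graded Lie algebras
      IsGradedLieHom h₁ h₂ ηL ∧
      -- given by `D(Ω) = ∇ ∘ Ω - (-1)^{d e} Ω ∘ X`
      (∀ (d e : ℤ) (x : leftPairs 𝒜 ℒ ℳ d) (Ω : symForm 𝒜 ℒ ℳ e),
        ((ηL d x).1.1 (Sym.of 𝒜 ℒ ℳ Ω) : Cochain K L P) =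
          chevalleyEilenberg ℒ d e x.1.1.1 x.1.2 Ω) ∧
      -- with symbol `η(𝕏)`
      (∀ (d e : ℤ) (x : leftPairs 𝒜 ℒ ℳ d) (ω : symForm 𝒜 ℒ 𝒜 e),
        ((ηL d x).1.2 (Sym.of 𝒜 ℒ 𝒜 ω) : Cochain K L A) = eta ℒ d e x.1.1 ω) ∧
      -- taking `ℓ`-forms to `(ℓ + k - 1)`-forms on `𝓛^k(P)`
      (∀ (d : ℤ) (k : ℕ) (x : leftPairs 𝒜 ℒ ℳ d), x.1 ∈ leftPairsWeight 𝒜 ℒ ℳ k d →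
        (ηL d x).1 ∈ modDerShift 𝒜 ℒ ℳ d (k - 1)) ∧
      -- an isomorphism if `L` is projective and finitely generated
      (Module.Projective A L → Module.Finite A L → ∀ d, Function.Bijective (ηL d)) := by
  refine ⟨isGradedLie_leftPairs 𝒜 ℒ ℳ, isGradedLie_modDer 𝒜 ℒ ℳ,
    fun d => (leftPairOp 𝒜 ℒ ℳ d).codRestrict _ leftPairOp_mem,
    fun _ _ x y => leftPairOp_leftBracket x y, fun _ _ x Ω => leftPairOp_fst x Ω,
    fun _ _ x ω => leftPairOp_snd x ω, fun _ _ _ hx => leftPairOp_mem_modDerShift hx, ?_⟩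
  intro hp hf d
  obtain ⟨ι, _, g, b, θ, hb⟩ := exists_isDualBasis 𝒜 ℒ
  refine ⟨fun x y h => hb.leftPairOp_injective d (congrArg Subtype.val h), fun y => ?_⟩
  obtain ⟨x, hx⟩ := modDer_le_range_leftPairOp hb d y.2
  exact ⟨x, Subtype.ext hx⟩
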